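/- **Setting.** Let $(\Omega,\mathcal F,\mathbb P)$ be a probability space carrying positive finite random conductances $b_t(x)=a_t(x,x+1)$, $t\in\mathbb R$, $x\in\mathbb Z$, such that for each $x$ the map $(t,\omega)\mapsto b_t(x)$ is jointly measurable and $t\mapsto b_t(x)$ is locally Lebesgue integrable, together with a group of space-time shifts $\tau_{t,x}\colon\Omega\to\Omega$ ($\tau_{0,0}=\mathrm{id}$, $\tau_{s,y}\circ\tau_{t,x}=\tau_{s+t,x+y}$) with $b_t(x)\circ\tau_{s,y}=b_{t+s}(x+y)$. Assume that $\mathbb P$ is invariant and ergodic under $\{\tau_{t,x}\}$ (every event $A$ with $\mathbb P(A\,\triangle\,\tau_{t,x}^{-1}A)=0$ for all $t,x$ has probability $0$ or $1$), and that $\mathbb E[b_0(0)]<\infty$ and $\mathbb E[b_0(0)^{-1}]<\infty$. For $t\le s$ let $\mathsf K_0:=0$, $$\mathsf K_{n+1}(s,x;t,y):=e^{-\int_t^s 2b_u(x)\,du}\,\delta_{x,y}+\int_t^s dr\,e^{-\int_r^s2b_u(x)\,du}\,b_r(x)\sum_{z=\pm1}\mathsf K_n(r,x+z;t,y),$$ and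 $\mathsf K:=\lim_n\mathsf K_n$. This is the transition function of the dual walk $Y$ (the variable-speed simple random walk with jump rate $2b_t(x)$ run backwards in time): started from $0$, $P^0(Y_t=y)=\mathsf K(0,0;-t,y)$. For $\epsilon>0$ put $$\varphi_\epsilon:=\epsilon\int_0^\infty dt\,e^{-\epsilon t}\sum_{y\in\mathbb Z}\mathsf K(t,y;0,0),\qquad \phi_\epsilon(f):=\mathbb E(\varphi_\epsilon f),\quad f\in L^\infty(\mathbb P),$$ and let $\mathcal H:=\{f\in L^0(\mathbb P)\colon \mathbb E(b_0(0)^{-1}f^2)<\infty\}$, with norm $[\mathbb E(b_0(0)^{-1}f^2)]^{1/2}$. **Theorem.** For each $\epsilon>0$, $\mathbb E(\varphi_\epsilon)=1$, $L^\infty(\mathbb P)\subseteq\mathcal H$, and $\phi_\epsilon$ extends to a continuous linear functional on $\mathcal H$ with norm at most $[\mathbb E(b_0(0))]^{1/2}$. Every sequence $\epsilon_k>0$ with $\epsilon_k\to0$ has a subsequence along which $\phi_{\epsilon_k}$ converges weakly (i.e. pointwise on $\mathcal H$) to a continuous linear functional. Whenever $\phi_{\epsilon_k}$ converges weakly along some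 $\epsilon_k>0$, $\epsilon_k\to0$, the limit is of the form $f\mapsto\mathbb E(\varphi f)$, $f\in\mathcal H$, for some measurable $\varphi\colon\Omega\to\mathbb R$ with $$\varphi\ge0\ \text{ $\mathbb P$-a.s.},\qquad \mathbb E(\varphi)=1,\qquad \mathbb E(b_0(0)\varphi^2)\le\mathbb E(b_0(0)),$$ and, for each $t>0$, $$\varphi=\sum_{x\in\mathbb Z}\varphi\circ\tau_{t,x}\,\mathsf K(t,x;0,0)\qquad\mathbb P\text{-a.s.}$$ Moreover, $\varphi$ can be chosen (within its $\mathbb P$-a.s. equivalence class) so that in addition $\mathbb P(\varphi>0)=1$ and, on a set of full $\mathbb P$-measure, for every $x\in\mathbb Z$ the map $t\mapsto\varphi\circ\tau_{t,x}$, $t\in\mathbb R$, is continuous and weakly differentiable with $$\frac{\partial}{\partial t}\varphi\circ\tau_{t,x}+(\mathcal L^+\varphi)\circ\tau_{t,x}=0,\qquad \mathcal L^+f:=b_0(1)\,f\circ\tau_{0,1}+b_0(-1)\,f\circ\tau_{0,-1}-2b_0(0)f,$$ in the sense that $t\mapsto(\mathcal L^+\varphi)\circ\tau_{t,x}$ is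 locally integrable and $\varphi\circ\tau_{t,x}-\varphi\circ\tau_{s,x}=-\int_s^t(\mathcal L^+\varphi)\circ\tau_{u,x}\,du$ for all $s,t\in\mathbb R$. Finally, $\mathbb Q(d\omega):=\varphi(\omega)\,\mathbb P(d\omega)$ is a probability measure that is stationary and ergodic for the Markov chain $t\mapsto\tau_{-t,Y_t}(\omega)$ with transition function $p_t(\omega,A)=\sum_{y\in\mathbb Z}\mathsf K(0,0;-t,y)(\omega)\,1_A(\tau_{-t,y}\omega)$: for all $t\ge0$ and $A\in\mathcal F$, $\int p_t(\omega,A)\,\mathbb Q(d\omega)=\mathbb Q(A)$; and if $A\in\mathcal F$ is such that for each $t>0$, $p_t(\omega,A)=1$ for $\mathbb Q$-a.e. $\omega\in A$, then $\mathbb Q(A)\in\{0,1\}$. -/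

import Mathlib

open MeasureTheory Filter Topology
open scoped ENNReal

namespace DynCond

/-- The standing assumption on the random conductances. The number `b ω t x` is the conductance
`a_t(x, x+1)` of the edge `(x, x+1)` at time `t` in the environment `ω`, and `τ t x` is the
space-time shift by `(t, x)`. -/
structure IsErgodicEnvironment {Ω : Type*} [MeasurableSpace Ω] (P : Measure Ω)
    (b : Ω → ℝ → ℤ → ℝ) (τ : ℝ → ℤ → Ω → Ω) : Prop where
  pos : ∀ ω t x, 0 < b ω t x
  measurable : ∀ x, Measurable (fun p : ℝ × Ω => b p.2 p.1 x)
  locallyIntegrable : ∀ ω x, LocallyIntegrable (fun t => b ω t x) volume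
  shift_zero : ∀ ω, τ 0 0 ω = ω
  shift_add : ∀ s y t x ω, τ s y (τ t x ω) = τ (s + t) (y + x) ω
  covariant : ∀ t x s y ω, b (τ s y ω) t x = b ω (t + s) (x + y)
  invariant : ∀ t x, MeasurePreserving (τ t x) P P
  ergodic : ∀ A : Set Ω, MeasurableSet A → (∀ t x, τ t x ⁻¹' A =ᵐ[P] A) → P A = 0 ∨ P A = 1

/-- The kernels `K_n(s, x; t, y)`, `t ≤ s`, of the dual walk (variable-speed simple random walk run
backwards in time, with generator `b_t(x) (f(x+1) + f(x-1) - 2 f(x))`) making fewer than `n` steps,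
in a fixed configuration `b` of conductances: the Picard iterates of the Kolmogorov backward
equation. -/
noncomputable def dualKernelN (b : ℝ → ℤ → ℝ) : ℕ → ℝ → ℤ → ℝ → ℤ → ℝ≥0∞
  | 0, _, _, _, _ => 0
  | n + 1, s, x, t, y =>
      (if x = y then ENNReal.ofReal (Real.exp (-∫ u in t..s, 2 * b u x)) else 0) +
        ∫⁻ r in Set.Ioc t s, ENNReal.ofReal (Real.exp (-∫ u in r..s, 2 * b u x) * b r x) *
          (dualKernelN b n r (x + 1) t y + dualKernelN b n r (x - 1) t y)

/-- The transition function `K(s, x; t, y)`, `t ≤ s`, of the dual walk `Y`: the limit of the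
nondecreasing sequence `K_n(s, x; t, y)`, i.e. the minimal nonnegative solution of the Kolmogorov
backward equation. For the walk started from `x` at time `0` in the environment `b`, the
probability of `Y_t = y` is `K(0, x; -t, y)`. -/
noncomputable def dualKernel (b : ℝ → ℤ → ℝ) (s : ℝ) (x : ℤ) (t : ℝ) (y : ℤ) : ℝ≥0∞ :=
  ⨆ n, dualKernelN b n s x t y

/-- The approximate density `φ_ε = ε ∫₀^∞ e^{-εt} ∑_y K(t, y; 0, 0) dt`. -/
noncomputable def approxDensity {Ω : Type*} (b : Ω → ℝ → ℤ → ℝ) (ε : ℝ) (ω : Ω) : ℝ≥0∞ :=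
  ENNReal.ofReal ε * ∫⁻ t in Set.Ioi (0 : ℝ),
    ENNReal.ofReal (Real.exp (-(ε * t))) * ∑' y : ℤ, dualKernel (b ω) t y 0 0

/-- The measure `b_0(0)⁻¹ P`. As `0 < b_0(0) < ∞`, it has the same null sets as `P`. -/
noncomputable def weightedMeasure {Ω : Type*} [MeasurableSpace Ω] (P : Measure Ω)
    (b : Ω → ℝ → ℤ → ℝ) : Measure Ω :=
  P.withDensity (fun ω => ENNReal.ofReal (b ω 0 0)⁻¹)

/-- The Hilbert space of classes of measurable `f` with `E (b_0(0)⁻¹ f²) < ∞`, normed by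
the square root of this quantity. -/
abbrev WeightedL2 {Ω : Type*} [MeasurableSpace Ω] (P : Measure Ω) (b : Ω → ℝ → ℤ → ℝ) : Type _ :=
  Lp ℝ 2 (weightedMeasure P b)

/-- The adjoint generator of the dual walk, lifted to functions of the environment. -/
def adjointGen {Ω : Type*} (b : Ω → ℝ → ℤ → ℝ) (τ : ℝ → ℤ → Ω → Ω) (f : Ω → ℝ) (ω : Ω) : ℝ :=
  b ω 0 1 * f (τ 0 1 ω) + b ω 0 (-1) * f (τ 0 (-1) ω) - 2 * b ω 0 0 * f ω

/-- `g'` is the derivative of the function `g` of one real variable in the weak (Lebesgue) sense: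
`g` is the indefinite integral of the locally integrable function `g'`. -/
def HasWeakDeriv (g g' : ℝ → ℝ) : Prop :=
  LocallyIntegrable g' volume ∧ ∀ s t : ℝ, g t - g s = ∫ u in s..t, g' u

/-- The transition function of the Markov chain `t ↦ τ_{-t, Y_t}(ω)` (the environment seen from the
dual walk): the probability that `τ_{-t, Y_t}(ω) ∈ A` for `Y` started from `0` in environment `ω`. -/
noncomputable def envTransition {Ω : Type*} (b : Ω → ℝ → ℤ → ℝ) (τ : ℝ → ℤ → Ω → Ω)
    (t : ℝ) (ω : Ω) (A : Set Ω) : ℝ≥0∞ :=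
  ∑' y : ℤ, dualKernel (b ω) 0 0 (-t) y * A.indicator 1 (τ (-t) y ω)

/-- `Q` is a stationary probability measure of the environment seen from the dual walk. -/
def IsStationaryForDual {Ω : Type*} [MeasurableSpace Ω] (b : Ω → ℝ → ℤ → ℝ)
    (τ : ℝ → ℤ → Ω → Ω) (Q : Measure Ω) : Prop :=
  IsProbabilityMeasure Q ∧ ∀ t : ℝ, 0 ≤ t → ∀ A : Set Ω, MeasurableSet A →
    ∫⁻ ω, envTransition b τ t ω A ∂Q = Q A

/-- `Q` is ergodic for the environment seen from the dual walk: a set of environments that the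
chain started in it a.s. does not leave is `Q`-trivial. -/
def IsErgodicForDual {Ω : Type*} [MeasurableSpace Ω] (b : Ω → ℝ → ℤ → ℝ)
    (τ : ℝ → ℤ → Ω → Ω) (Q : Measure Ω) : Prop :=
  ∀ A : Set Ω, MeasurableSet A →
    (∀ t : ℝ, 0 < t → ∀ᵐ ω ∂Q, ω ∈ A → envTransition b τ t ω A = 1) → Q A = 0 ∨ Q A = 1

end DynCond

/-! The invariant density is a weak limit of resolvent averages. By shifting the environment and
using the invariance of `P`, `E(φ_ε f) = E(u)`, where `u` is the `ε`-resolvent of the environment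
process applied to `f` (`lintegral_envResolvent`).

Everything rests on one bound that is uniform in `ε`, `sq_integral_envResolvent_le`: with `β =
b_0(0)`, `(E u)² ≤ E(β) E(β⁻¹ f²)`. Along orbits `u` has the time derivative `V = ε (f - u) + β L`,
where `L` is the discrete spatial Laplacian of `u`. By stationarity time derivatives have mean zero.
Applied to `u` this gives `E(V) = 0`; applied to the squared spatial gradient of `u` it gives `E(L
V) = 0` after summation by parts. So `E(u) = E(v)` for `v = f + ε⁻¹ β L`, and expanding the square
yields `E(β⁻¹ v²) = E(β⁻¹ f²) + 2 ε⁻¹ E(u L) - ε⁻² E(β L²)`. Here `E(u L) ≤ 0`, being minus the mean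
squared gradient, so `E(β⁻¹ v²) ≤ E(β⁻¹ f²)`, and Cauchy-Schwarz concludes.

Testing with truncations of `β φ_ε` turns this into `E(β φ_ε²) ≤ E(β)`. In the weighted space `E(φ_ε
f)` is the inner product of `f` with `β φ_ε`, so these vectors are bounded, have weakly convergent
subsequences, and each limit has the form `β φ` (`exists_density`). Moving `φ_ε` by time `t` costs
at most `ε t`, so `φ` is invariant (`lintegral_density_mul_dualSemigroup`, `density_eq_tsum`). The
kernel is strictly positive, so the zero set of `φ`, and likewise any set closed under the chain, is
almost surely preserved by all forward (respectively backward) shifts; ergodicity of `P` makes it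
trivial. This gives `φ > 0` and the ergodicity of `Q`.

For the regularity in time, the invariance relation read along an orbit says that `φ` is transported
by the forward equation. The values at integer times determine a continuous solution, which agrees
with `φ` at almost every time; short-time averages of `φ` recover it at every time and define the
regular version (`exists_regular_version`).

Two technical points shape the file. First, the jump rates are unbounded, so non-explosion and
Chapman-Kolmogorov need a maximum principle (`eq_zero_of_le_jumpOp`), obtained from a barrier linear
in space. Second, `(t, ω) ↦ τ_{t,x} ω` is not assumed jointly measurable. Functions built from the
conductances are nevertheless measurable along orbits, and `OrbitMeasurable` keeps track of this
through the weak limit. -/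

namespace DynCond

/-! ### Calculus of indefinite Lebesgue integrals -/

section Calculus

theorem absolutelyContinuousOnInterval_lipschitzOn_comp {g F : ℝ → ℝ} {K : NNReal} {a b : ℝ}
    {S : Set ℝ} (hg : LipschitzOnWith K g S) (hF : AbsolutelyContinuousOnInterval F a b)
    (hS : Set.MapsTo F (Set.uIcc a b) S) :
    AbsolutelyContinuousOnInterval (fun t => g (F t)) a b := by
  rw [absolutelyContinuousOnInterval_iff] at hF ⊢
  intro ε hε
  -- Dividing by `K + 1` instead of `K` covers `K = 0` and makes the last inequality strict.
  obtain ⟨δ, hδ, h⟩ := hF (ε / (K + 1)) (by positivity)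
  refine ⟨δ, hδ, fun E hE hlt => ?_⟩
  have h1 := h E hE hlt
  calc
    _ ≤ ∑ i ∈ Finset.range E.1, K * dist (F (E.2 i).1) (F (E.2 i).2) := by
      apply Finset.sum_le_sum
      intro i hi
      exact hg.dist_le_mul _ (hS (hE.left i hi).left) _ (hS (hE.left i hi).right)
    _ = K * ∑ i ∈ Finset.range E.1, dist (F (E.2 i).1) (F (E.2 i).2) := by
      rw [Finset.mul_sum]
    _ ≤ K * (ε / (K + 1)) := by gcongr
    _ < (K + 1) * (ε / (K + 1)) := by gcongr; linarith
    _ = ε := by field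

theorem intervalIntegrable_of_locallyIntegrable {f : ℝ → ℝ} (hf : LocallyIntegrable f volume)
    (a b : ℝ) : IntervalIntegrable f volume a b :=
  (hf.integrableOn_isCompact isCompact_uIcc).intervalIntegrable

namespace HasWeakDeriv

variable {F G f g : ℝ → ℝ}

theorem eq_add_integral (h : HasWeakDeriv F f) (a t : ℝ) : F t = F a + ∫ u in a..t, f u := by
  rw [← h.2 a t]; ring

theorem absolutelyContinuousOnInterval (h : HasWeakDeriv F f) (a b : ℝ) :
    AbsolutelyContinuousOnInterval F a b := by
  have h1 := (intervalIntegrable_of_locallyIntegrable h.1 a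
    b).absolutelyContinuousOnInterval_intervalIntegral
    (c := a) (by simp)
  have h2 : AbsolutelyContinuousOnInterval (fun _ : ℝ => F a) a b :=
    ((LipschitzWith.const (F a)).lipschitzOnWith (s := Set.uIcc a b)).absolutelyContinuousOnInterval
  have h3 := h2.add h1
  have h4 : F = (fun _ : ℝ => F a) + fun x => ∫ v in a..x, f v := by
    funext t; exact h.eq_add_integral a t
  rw [h4]; exact h3

theorem continuous (h : HasWeakDeriv F f) : Continuous F := by
  have h4 : F = fun x => F 0 + ∫ v in (0 : ℝ)..x, f v := by
    funext t; exact h.eq_add_integral 0 t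
  rw [h4]
  exact continuous_const.add
    (intervalIntegral.continuous_primitive
      (fun a b => intervalIntegrable_of_locallyIntegrable h.1 a b) 0)

theorem ae_hasDerivAt (h : HasWeakDeriv F f) : ∀ᵐ t, HasDerivAt F (f t) t := by
  filter_upwards [LocallyIntegrable.ae_hasDerivAt_integral h.1] with t ht
  have h4 : F = fun x => F 0 + ∫ v in (0 : ℝ)..x, f v := by
    funext t; exact h.eq_add_integral 0 t
  rw [h4]
  exact (ht 0).const_add (F 0)

/-- The route to the product and exponential rules: absolute continuity is stable under these
operations, derivatives are computed pointwise almost everywhere, and the fundamental theorem of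
calculus for absolutely continuous functions returns the integral form. -/
theorem of_absolutelyContinuous (hF : ∀ a b, AbsolutelyContinuousOnInterval F a b)
    (hf : LocallyIntegrable f volume) (hd : ∀ᵐ t, HasDerivAt F (f t) t) : HasWeakDeriv F f := by
  refine ⟨hf, fun s t => ?_⟩
  rw [← (hF s t).integral_deriv_eq_sub]
  refine intervalIntegral.integral_congr_ae ?_
  filter_upwards [hd] with u hu _ using hu.deriv

theorem mul (hF : HasWeakDeriv F f) (hG : HasWeakDeriv G g) :
    HasWeakDeriv (fun t => F t * G t) (fun t => f t * G t + F t * g t) := by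
  refine of_absolutelyContinuous
    (fun a b => (hF.absolutelyContinuousOnInterval a b).fun_mul
      (hG.absolutelyContinuousOnInterval a b)) ?_ ?_
  · have h1 := hF.1.mul_continuous hG.continuous
    have h2 := hG.1.continuous_mul hF.continuous
    exact h1.add h2
  · filter_upwards [hF.ae_hasDerivAt, hG.ae_hasDerivAt] with t h1 h2 using h1.mul h2

theorem exp (hF : HasWeakDeriv F f) :
    HasWeakDeriv (fun t => Real.exp (F t)) (fun t => Real.exp (F t) * f t) := by
  refine of_absolutelyContinuous (fun a b => ?_) ?_ ?_
  -- The exponential is only locally Lipschitz, so it is restricted to a ball that contains the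
  -- compact image of the interval.
  · have hc : IsCompact (F '' Set.uIcc a b) := isCompact_uIcc.image hF.continuous
    obtain ⟨R, hR⟩ := hc.isBounded.subset_closedBall 0
    have h1 : ContDiffOn ℝ 1 Real.exp (Metric.closedBall 0 R) := Real.contDiff_exp.contDiffOn
    obtain ⟨K, hK⟩ := h1.exists_lipschitzOnWith (by decide) (convex_closedBall _ _)
      (isCompact_closedBall _ _)
    exact absolutelyContinuousOnInterval_lipschitzOn_comp hK
      (hF.absolutelyContinuousOnInterval a b) (fun t ht => hR ⟨t, ht, rfl⟩)
  · exact hF.1.continuous_mul hF.continuous.rexp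
  · filter_upwards [hF.ae_hasDerivAt] with t h1 using h1.exp

theorem neg (hF : HasWeakDeriv F f) : HasWeakDeriv (fun t => -F t) (fun t => -f t) := by
  refine ⟨hF.1.neg, fun s t => ?_⟩
  rw [intervalIntegral.integral_neg, ← hF.2 s t]; ring

theorem sub (hF : HasWeakDeriv F f) (hG : HasWeakDeriv G g) :
    HasWeakDeriv (fun t => F t - G t) (fun t => f t - g t) := by
  refine ⟨hF.1.sub hG.1, fun s t => ?_⟩
  rw [intervalIntegral.integral_sub (intervalIntegrable_of_locallyIntegrable hF.1 _ _)
    (intervalIntegrable_of_locallyIntegrable hG.1 _ _),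
    ← hF.2 s t, ← hG.2 s t]; ring

theorem add (hF : HasWeakDeriv F f) (hG : HasWeakDeriv G g) :
    HasWeakDeriv (fun t => F t + G t) (fun t => f t + g t) := by
  refine ⟨hF.1.add hG.1, fun s t => ?_⟩
  rw [intervalIntegral.integral_add (intervalIntegrable_of_locallyIntegrable hF.1 _ _)
    (intervalIntegrable_of_locallyIntegrable hG.1 _ _),
    ← hF.2 s t, ← hG.2 s t]; ring

theorem const (c : ℝ) : HasWeakDeriv (fun _ => c) (fun _ => 0) :=
  ⟨locallyIntegrable_const 0, fun s t => by simp⟩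

theorem congr_right (hF : HasWeakDeriv F f) (h : ∀ t, f t = g t) : HasWeakDeriv F g := by
  have : f = g := funext h
  exact this ▸ hF

theorem const_mul (c : ℝ) (hF : HasWeakDeriv F f) :
    HasWeakDeriv (fun t => c * F t) (fun t => c * f t) :=
  ((const c).mul hF).congr_right (fun t => by ring)

end HasWeakDeriv

theorem hasWeakDeriv_integral {f : ℝ → ℝ} (hf : LocallyIntegrable f volume) (a : ℝ) :
    HasWeakDeriv (fun t => ∫ u in a..t, f u) f := by
  refine ⟨hf, fun s t => ?_⟩
  rw [intervalIntegral.integral_interval_sub_left (intervalIntegrable_of_locallyIntegrable hf _ _)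
    (intervalIntegrable_of_locallyIntegrable hf _ _)]

/-- Variation of constants: from the mild form of a linear equation to the equation. -/
theorem HasWeakDeriv.of_mild {Γ γ h J : ℝ → ℝ} (hΓ : HasWeakDeriv Γ γ)
    (hG : HasWeakDeriv (fun t => Real.exp (Γ t) * h t) (fun t => Real.exp (Γ t) * J t)) :
    HasWeakDeriv h (fun t => J t - γ t * h t) := by
  have h1 := hΓ.neg.exp.mul hG
  have h2 : ∀ t, Real.exp (-Γ t) * Real.exp (Γ t) = 1 := fun t => by
    rw [← Real.exp_add]; simp
  have h3 : (fun t => Real.exp (-Γ t) * (Real.exp (Γ t) * h t)) = h := by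
    funext t; rw [← mul_assoc, h2, one_mul]
  rw [h3] at h1
  refine h1.congr_right (fun t => ?_)
  linear_combination (J t - γ t * h t) * h2 t

/-- Exchange of the order of integration over a triangle. -/
theorem lintegral_triangle_swap {f : ℝ → ℝ → ℝ≥0∞} (hf : Measurable (Function.uncurry f))
    (t s : ℝ) :
    ∫⁻ r in Set.Ioc t s, ∫⁻ q in Set.Ioc t r, f r q =
      ∫⁻ q in Set.Ioc t s, ∫⁻ r in Set.Ioc q s, f r q := by
  -- Removing the null diagonal makes both iterated integrals run over the same triangle `t < q < r
  -- ≤ s`.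
  have e1 : ∀ r, ∫⁻ q in Set.Ioc t r, f r q = ∫⁻ q in Set.Ioo t r, f r q := fun r =>
    setLIntegral_congr Ioo_ae_eq_Ioc.symm
  have hm : MeasurableSet {p : ℝ × ℝ | t < p.2 ∧ p.2 < p.1 ∧ p.1 ≤ s} :=
    (measurableSet_lt measurable_const measurable_snd).inter
      ((measurableSet_lt measurable_snd measurable_fst).inter
        (measurableSet_le measurable_fst measurable_const))
  have hF : Measurable ({p : ℝ × ℝ | t < p.2 ∧ p.2 < p.1 ∧ p.1 ≤ s}.indicator
      (Function.uncurry f)) := hf.indicator hm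
  calc _ = ∫⁻ r, ∫⁻ q, {p : ℝ × ℝ | t < p.2 ∧ p.2 < p.1 ∧ p.1 ≤ s}.indicator
        (Function.uncurry f) (r, q) := by
        rw [← lintegral_indicator measurableSet_Ioc]
        congr 1; funext r
        simp only [e1]
        by_cases hr : r ∈ Set.Ioc t s
        · rw [Set.indicator_of_mem hr, ← lintegral_indicator measurableSet_Ioo]
          congr 1; funext q
          simp only [Set.indicator, Set.mem_Ioo, Set.mem_ofPred_eq, Function.uncurry]
          simp only [hr.2, and_true]
        · rw [Set.indicator_of_notMem hr]
          symm
          rw [lintegral_eq_zero_of_ae_eq_zero]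
          refine Eventually.of_forall fun q => ?_
          refine Set.indicator_of_notMem ?_ _
          rintro ⟨h1, h2, h3⟩
          exact hr ⟨h1.trans h2, h3⟩
    _ = ∫⁻ q, ∫⁻ r, {p : ℝ × ℝ | t < p.2 ∧ p.2 < p.1 ∧ p.1 ≤ s}.indicator
        (Function.uncurry f) (r, q) := lintegral_lintegral_swap hF.aemeasurable
    _ = _ := by
        rw [← lintegral_indicator measurableSet_Ioc]
        congr 1; funext q
        by_cases hq : q ∈ Set.Ioc t s
        · rw [Set.indicator_of_mem hq, ← lintegral_indicator measurableSet_Ioc]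
          congr 1; funext r
          simp only [Set.indicator, Set.mem_Ioc, Set.mem_ofPred_eq, Function.uncurry]
          simp only [hq.1, true_and]
        · rw [Set.indicator_of_notMem hq]
          rw [lintegral_eq_zero_of_ae_eq_zero]
          refine Eventually.of_forall fun r => ?_
          refine Set.indicator_of_notMem ?_ _
          rintro ⟨h1, h2, h3⟩
          exact hq ⟨h1, h2.le.trans h3⟩

end Calculus

end DynCond

namespace DynCond

/-! ### The Kolmogorov backward equation in a fixed configuration -/

/-- A configuration of conductances. -/
structure IsConductance (b : ℝ → ℤ → ℝ) : Prop where
  pos : ∀ t x, 0 < b t x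
  measurable : ∀ x, Measurable (fun t => b t x)
  locallyIntegrable : ∀ x, LocallyIntegrable (fun t => b t x) volume

/-- A jointly measurable field of configurations. -/
structure IsConductanceField {Ω : Type*} [MeasurableSpace Ω] (b : Ω → ℝ → ℤ → ℝ) : Prop where
  pos : ∀ ω t x, 0 < b ω t x
  measurable : ∀ x, Measurable (fun p : ℝ × Ω => b p.2 p.1 x)
  locallyIntegrable : ∀ ω x, LocallyIntegrable (fun t => b ω t x) volume

/-- The integrated jump rate at `x` over the times from `0` to `t`. -/
noncomputable def cumRate (b : ℝ → ℤ → ℝ) (x : ℤ) (t : ℝ) : ℝ := ∫ u in (0 : ℝ)..t, 2 * b u x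

/-- The probability that the dual walk stays at `x` from time `s` back to time `r`. -/
noncomputable def stayProb (b : ℝ → ℤ → ℝ) (x : ℤ) (r s : ℝ) : ℝ≥0∞ :=
  ENNReal.ofReal (Real.exp (-∫ u in r..s, 2 * b u x))

/-- The density at `r` of the time of the first jump, in a given direction, of the dual walk that
starts from `x` at time `s`. -/
noncomputable def jumpDensity (b : ℝ → ℤ → ℝ) (x : ℤ) (r s : ℝ) : ℝ≥0∞ :=
  ENNReal.ofReal (Real.exp (-∫ u in r..s, 2 * b u x) * b r x)

/-- The expectation of `v` at the time and place after the first jump, on the event that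
this jump happens after time `t`. -/
noncomputable def jumpOp (b : ℝ → ℤ → ℝ) (t : ℝ) (v : ℝ → ℤ → ℝ≥0∞) (s : ℝ) (x : ℤ) : ℝ≥0∞ :=
  ∫⁻ q in Set.Ioc t s, jumpDensity b x q s * (v q (x + 1) + v q (x - 1))

theorem dualKernelN_succ (b : ℝ → ℤ → ℝ) (n : ℕ) (s : ℝ) (x : ℤ) (t : ℝ) (y : ℤ) :
    dualKernelN b (n + 1) s x t y = (if x = y then stayProb b x t s else 0) +
      jumpOp b t (fun q z => dualKernelN b n q z t y) s x := rfl

theorem dualKernelN_zero (b : ℝ → ℤ → ℝ) (s : ℝ) (x : ℤ) (t : ℝ) (y : ℤ) :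
    dualKernelN b 0 s x t y = 0 := rfl

namespace IsConductanceField

variable {Ω : Type*} [MeasurableSpace Ω] {b : Ω → ℝ → ℤ → ℝ}

theorem isConductance (hb : IsConductanceField b) (ω : Ω) : IsConductance (b ω) :=
  ⟨hb.pos ω, fun x => (hb.measurable x).comp (measurable_id.prodMk measurable_const),
    hb.locallyIntegrable ω⟩

theorem measurable_cumRate (hb : IsConductanceField b) (x : ℤ) :
    Measurable (fun p : ℝ × Ω => cumRate (b p.2) x p.1) := by
  have hl : ∀ ω, LocallyIntegrable (fun t => 2 * b ω t x) volume := fun ω =>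
    (hb.locallyIntegrable ω x).continuous_mul continuous_const
  refine measurable_uncurry_of_continuous_of_measurable
    (u := fun t ω => cumRate (b ω) x t) (fun ω => ?_) (fun t => ?_)
  · exact (hasWeakDeriv_integral (hl ω) 0).continuous
  · have hm : StronglyMeasurable (fun p : Ω × ℝ => 2 * b p.1 p.2 x) :=
      (((hb.measurable x).comp measurable_swap).const_mul 2).stronglyMeasurable
    simp only [cumRate, intervalIntegral]
    exact (hm.integral_prod_right').measurable.sub (hm.integral_prod_right').measurable

end IsConductanceField

/-- A single configuration is a field over a one-point space, so measurability is proved for fields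
only. -/
theorem IsConductance.isConductanceField {b : ℝ → ℤ → ℝ} (hb : IsConductance b) :
    IsConductanceField (fun _ : Unit => b) :=
  ⟨fun _ => hb.pos, fun x => (hb.measurable x).comp measurable_fst, fun _ => hb.locallyIntegrable⟩

namespace IsConductance

variable {b : ℝ → ℤ → ℝ}

theorem hasWeakDeriv_cumRate (hb : IsConductance b) (x : ℤ) :
    HasWeakDeriv (cumRate b x) (fun t => 2 * b t x) :=
  hasWeakDeriv_integral ((hb.locallyIntegrable x).continuous_mul continuous_const) 0

theorem continuous_cumRate (hb : IsConductance b) (x : ℤ) : Continuous (cumRate b x) :=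
  (hb.hasWeakDeriv_cumRate x).continuous

theorem integral_eq (hb : IsConductance b) (x : ℤ) (r s : ℝ) :
    ∫ u in r..s, 2 * b u x = cumRate b x s - cumRate b x r :=
  ((hb.hasWeakDeriv_cumRate x).2 r s).symm

theorem cumRate_strictMono (hb : IsConductance b) (x : ℤ) : StrictMono (cumRate b x) := by
  intro r s hrs
  rw [← sub_pos, ← hb.integral_eq]
  refine intervalIntegral.intervalIntegral_pos_of_pos
    (intervalIntegrable_of_locallyIntegrable (hb.hasWeakDeriv_cumRate x).1 r s)
    (fun u => ?_) hrs
  have := hb.pos u x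
  positivity

theorem stayProb_eq (hb : IsConductance b) (x : ℤ) (r s : ℝ) :
    stayProb b x r s = ENNReal.ofReal (Real.exp (cumRate b x r - cumRate b x s)) := by
  rw [stayProb, hb.integral_eq, neg_sub]

theorem stayProb_mul (hb : IsConductance b) (x : ℤ) (q r s : ℝ) :
    stayProb b x r s * stayProb b x q r = stayProb b x q s := by
  rw [hb.stayProb_eq, hb.stayProb_eq, hb.stayProb_eq, ← ENNReal.ofReal_mul (Real.exp_pos _).le,
    ← Real.exp_add]
  congr 2; ring

theorem stayProb_pos (x : ℤ) (r s : ℝ) : 0 < stayProb b x r s := by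
  simp [stayProb, Real.exp_pos]

theorem stayProb_ne_top (x : ℤ) (r s : ℝ) : stayProb b x r s ≠ ∞ := ENNReal.ofReal_ne_top

theorem jumpDensity_eq (x : ℤ) (r s : ℝ) :
    jumpDensity b x r s = stayProb b x r s * ENNReal.ofReal (b r x) := by
  rw [jumpDensity, stayProb, ENNReal.ofReal_mul (Real.exp_pos _).le]

theorem jumpDensity_pos (hb : IsConductance b) (x : ℤ) (r s : ℝ) : 0 < jumpDensity b x r s := by
  rw [jumpDensity, ENNReal.ofReal_pos]
  exact mul_pos (Real.exp_pos _) (hb.pos _ _)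

theorem jumpDensity_split (hb : IsConductance b) (x : ℤ) (q r s : ℝ) :
    jumpDensity b x q s = stayProb b x r s * jumpDensity b x q r := by
  rw [jumpDensity_eq, jumpDensity_eq, ← mul_assoc, hb.stayProb_mul]

end IsConductance

namespace IsConductanceField

variable {Ω : Type*} [MeasurableSpace Ω] {b : Ω → ℝ → ℤ → ℝ}

theorem measurable_stayProb (hb : IsConductanceField b) (x : ℤ) :
    Measurable (fun p : ℝ × ℝ × Ω => stayProb (b p.2.2) x p.1 p.2.1) := by
  have h : ∀ p : ℝ × ℝ × Ω, stayProb (b p.2.2) x p.1 p.2.1 = ENNReal.ofReal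
      (Real.exp (cumRate (b p.2.2) x p.1 - cumRate (b p.2.2) x p.2.1)) := fun p =>
    (hb.isConductance p.2.2).stayProb_eq x _ _
  simp only [h]
  have h1 : Measurable (fun p : ℝ × ℝ × Ω => cumRate (b p.2.2) x p.1) :=
    (hb.measurable_cumRate x).comp (measurable_fst.prodMk measurable_snd.snd)
  have h2 : Measurable (fun p : ℝ × ℝ × Ω => cumRate (b p.2.2) x p.2.1) :=
    (hb.measurable_cumRate x).comp (measurable_snd.fst.prodMk measurable_snd.snd)
  exact (h1.sub h2).exp.ennreal_ofReal

theorem measurable_stayProb_comp (hb : IsConductanceField b) (x : ℤ) {α : Type*}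
    [MeasurableSpace α] {r s : α → ℝ} {w : α → Ω} (hr : Measurable r) (hs : Measurable s)
    (hw : Measurable w) : Measurable (fun a => stayProb (b (w a)) x (r a) (s a)) := by
  have h : Measurable (fun a => (r a, s a, w a)) := hr.prodMk (hs.prodMk hw)
  exact (hb.measurable_stayProb x).comp h

theorem measurable_jumpDensity_comp (hb : IsConductanceField b) (x : ℤ) {α : Type*}
    [MeasurableSpace α] {r s : α → ℝ} {w : α → Ω} (hr : Measurable r) (hs : Measurable s)
    (hw : Measurable w) : Measurable (fun a => jumpDensity (b (w a)) x (r a) (s a)) := by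
  have h : Measurable (fun a => b (w a) (r a) x) := (hb.measurable x).comp (hr.prodMk hw)
  simp only [IsConductance.jumpDensity_eq]
  exact (hb.measurable_stayProb_comp x hr hs hw).mul h.ennreal_ofReal

theorem measurable_dualKernelN (hb : IsConductanceField b) (n : ℕ) (x y : ℤ) {α : Type*}
    [MeasurableSpace α] {s t : α → ℝ} {w : α → Ω} (hs : Measurable s) (ht : Measurable t)
    (hw : Measurable w) : Measurable (fun a => dualKernelN (b (w a)) n (s a) x (t a) y) := by
  suffices H : Measurable (fun p : ℝ × ℝ × Ω => dualKernelN (b p.2.2) n p.1 x p.2.1 y) by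
    have h : Measurable (fun a => (s a, t a, w a)) := hs.prodMk (ht.prodMk hw)
    exact H.comp h
  clear hs ht hw
  induction n generalizing x with
  | zero => simp only [dualKernelN_zero]; exact measurable_const
  | succ n ih =>
    simp only [dualKernelN_succ, jumpOp]
    refine Measurable.add ?_ ?_
    · by_cases hxy : x = y
      · simp only [hxy, if_true]
        exact hb.measurable_stayProb_comp y (by fun_prop) (by fun_prop) (by fun_prop)
      · simp only [hxy, if_false]; exact measurable_const
    · have h : ∀ p : ℝ × ℝ × Ω, ∫⁻ q in Set.Ioc p.2.1 p.1, jumpDensity (b p.2.2) x q p.1 *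
            (dualKernelN (b p.2.2) n q (x + 1) p.2.1 y +
              dualKernelN (b p.2.2) n q (x - 1) p.2.1 y) =
          ∫⁻ q, {z : (ℝ × ℝ × Ω) × ℝ | z.1.2.1 < z.2 ∧ z.2 ≤ z.1.1}.indicator
            (fun z => jumpDensity (b z.1.2.2) x z.2 z.1.1 *
            (dualKernelN (b z.1.2.2) n z.2 (x + 1) z.1.2.1 y +
              dualKernelN (b z.1.2.2) n z.2 (x - 1) z.1.2.1 y)) (p, q) := by
        intro p
        rw [← lintegral_indicator measurableSet_Ioc]
        rfl
      simp only [h]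
      refine Measurable.lintegral_prod_right' (f := fun z : (ℝ × ℝ × Ω) × ℝ => _) ?_
      have hz : Measurable fun z : (ℝ × ℝ × Ω) × ℝ => (z.2, z.1.2.1, z.1.2.2) := by fun_prop
      refine Measurable.indicator ?_ ?_
      · refine Measurable.mul ?_ (Measurable.add ?_ ?_)
        · exact hb.measurable_jumpDensity_comp x (by fun_prop) (by fun_prop) (by fun_prop)
        · exact (ih (x + 1)).comp hz
        · exact (ih (x - 1)).comp hz
      · exact (measurableSet_lt measurable_fst.snd.fst measurable_snd).inter
          (measurableSet_le measurable_snd measurable_fst.fst)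

theorem measurable_dualKernel (hb : IsConductanceField b) (x y : ℤ) {α : Type*}
    [MeasurableSpace α] {s t : α → ℝ} {w : α → Ω} (hs : Measurable s) (ht : Measurable t)
    (hw : Measurable w) : Measurable (fun a => dualKernel (b (w a)) (s a) x (t a) y) :=
  Measurable.iSup (fun n => hb.measurable_dualKernelN n x y hs ht hw)

end IsConductanceField

namespace IsConductance

variable {b : ℝ → ℤ → ℝ}

section

variable {α : Type*} [MeasurableSpace α] {r s : α → ℝ}

theorem measurable_stayProb (hb : IsConductance b) (x : ℤ) (hr : Measurable r)
    (hs : Measurable s) : Measurable (fun a => stayProb b x (r a) (s a)) :=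
  hb.isConductanceField.measurable_stayProb_comp x hr hs (measurable_const (a := ()))

theorem measurable_jumpDensity (hb : IsConductance b) (x : ℤ) (hr : Measurable r)
    (hs : Measurable s) : Measurable (fun a => jumpDensity b x (r a) (s a)) :=
  hb.isConductanceField.measurable_jumpDensity_comp x hr hs (measurable_const (a := ()))

theorem measurable_dualKernelN (hb : IsConductance b) (n : ℕ) (x y : ℤ) (hr : Measurable r)
    (hs : Measurable s) : Measurable (fun a => dualKernelN b n (r a) x (s a) y) :=
  hb.isConductanceField.measurable_dualKernelN n x y hr hs (measurable_const (a := ()))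

theorem measurable_dualKernel (hb : IsConductance b) (x y : ℤ) (hr : Measurable r)
    (hs : Measurable s) : Measurable (fun a => dualKernel b (r a) x (s a) y) :=
  hb.isConductanceField.measurable_dualKernel x y hr hs (measurable_const (a := ()))

end

theorem measurable_jumpDensity_left (hb : IsConductance b) (x : ℤ) (s : ℝ) :
    Measurable (fun q => jumpDensity b x q s) :=
  hb.measurable_jumpDensity x measurable_id measurable_const

end IsConductance

/-! ### First step analysis -/

section JumpOp

variable {b : ℝ → ℤ → ℝ}

theorem jumpOp_mono {t : ℝ} {v w : ℝ → ℤ → ℝ≥0∞} {s : ℝ} {x : ℤ}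
    (h : ∀ q ∈ Set.Ioc t s, ∀ z, v q z ≤ w q z) : jumpOp b t v s x ≤ jumpOp b t w s x := by
  refine setLIntegral_mono' measurableSet_Ioc (fun q hq => ?_)
  gcongr <;> exact h q hq _

theorem jumpOp_add (hb : IsConductance b) {t : ℝ} {v w : ℝ → ℤ → ℝ≥0∞} {s : ℝ} {x : ℤ}
    (hv : ∀ z, Measurable (fun q => v q z)) :
    jumpOp b t (fun q z => v q z + w q z) s x = jumpOp b t v s x + jumpOp b t w s x := by
  rw [jumpOp, jumpOp, jumpOp, ← lintegral_add_left]
  · congr 1; funext q; ring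
  · exact (hb.measurable_jumpDensity_left x s).mul ((hv _).add (hv _))

theorem jumpOp_const_mul {t : ℝ} {v : ℝ → ℤ → ℝ≥0∞} {s : ℝ} {x : ℤ} {c : ℝ≥0∞} (hc : c ≠ ∞) :
    jumpOp b t (fun q z => c * v q z) s x = c * jumpOp b t v s x := by
  rw [jumpOp, jumpOp, ← lintegral_const_mul' _ _ hc]
  congr 1; funext q; ring

theorem jumpOp_tsum (hb : IsConductance b) {t : ℝ} {ι : Type*} [Countable ι]
    {v : ι → ℝ → ℤ → ℝ≥0∞} {s : ℝ} {x : ℤ}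
    (hv : ∀ i z, Measurable (fun q => v i q z)) :
    jumpOp b t (fun q z => ∑' i, v i q z) s x = ∑' i, jumpOp b t (v i) s x := by
  simp only [jumpOp]
  rw [← lintegral_tsum]
  · congr 1; funext q; rw [ENNReal.tsum_mul_left, ENNReal.tsum_add]
  · exact fun i => ((hb.measurable_jumpDensity_left x s).mul ((hv i _).add (hv i _))).aemeasurable

theorem jumpOp_iSup (hb : IsConductance b) {t : ℝ} {v : ℕ → ℝ → ℤ → ℝ≥0∞} {s : ℝ} {x : ℤ}
    (hv : ∀ i z, Measurable (fun q => v i q z)) (hmono : ∀ q z, Monotone (fun i => v i q z)) :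
    jumpOp b t (fun q z => ⨆ i, v i q z) s x = ⨆ i, jumpOp b t (v i) s x := by
  simp only [jumpOp]
  rw [← lintegral_iSup]
  · congr 1; funext q
    rw [ENNReal.iSup_add_iSup_of_monotone (hmono q _) (hmono q _), ENNReal.mul_iSup]
  · exact fun i => (hb.measurable_jumpDensity_left x s).mul ((hv i _).add (hv i _))
  · intro i j hij q
    dsimp only
    gcongr <;> exact hmono q _ hij

/-- The first jump occurs either before the backward-running walk reaches time `r`, or after it has
stayed at `x` down to `r` and restarts there. -/
theorem jumpOp_split (hb : IsConductance b) {t r s : ℝ} (htr : t ≤ r) (hrs : r ≤ s)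
    (v : ℝ → ℤ → ℝ≥0∞) (x : ℤ) :
    jumpOp b t v s x = stayProb b x r s * jumpOp b t v r x + jumpOp b r v s x := by
  rw [jumpOp, jumpOp, jumpOp, ← Set.Ioc_union_Ioc_eq_Ioc htr hrs,
    lintegral_union measurableSet_Ioc (Set.Ioc_disjoint_Ioc_of_le le_rfl),
    ← lintegral_const_mul' _ _ (IsConductance.stayProb_ne_top x r s)]
  congr 2; funext q
  rw [hb.jumpDensity_split x q r s, mul_assoc]

end JumpOp

end DynCond

namespace DynCond

theorem HasWeakDeriv.lintegral_ofReal {F f : ℝ → ℝ} (hF : HasWeakDeriv F f) (hf : ∀ t, 0 ≤ f t)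
    {a c : ℝ} (hac : a ≤ c) :
    ∫⁻ q in Set.Ioc a c, ENNReal.ofReal (f q) = ENNReal.ofReal (F c - F a) := by
  rw [hF.2, intervalIntegral.integral_of_le hac, ofReal_integral_eq_lintegral_ofReal]
  · exact (intervalIntegrable_iff_integrableOn_Ioc_of_le hac).1
      (intervalIntegrable_of_locallyIntegrable hF.1 a c)
  · exact Eventually.of_forall hf

/-! ### Maximum principle for the backward equation with unbounded rates. -/

section MaximumPrinciple

variable {b : ℝ → ℤ → ℝ}

/-- Both directions together have the density `2 b_q(x) exp(C(q) - C(s))` with `C = cumRate b x`,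
which is the derivative in `q` of `exp(C(q) - C(s))`. -/
theorem jumpOp_one (hb : IsConductance b) {t s : ℝ} (hts : t ≤ s) (x : ℤ) :
    jumpOp b t (fun _ _ => 1) s x =
      ENNReal.ofReal (1 - Real.exp (cumRate b x t - cumRate b x s)) := by
  have h := ((hb.hasWeakDeriv_cumRate x).sub (HasWeakDeriv.const (cumRate b x s))).exp
  have h2 := h.lintegral_ofReal (fun q => by
    have := hb.pos q x
    have := Real.exp_pos (cumRate b x q - cumRate b x s)
    simp only [sub_zero]; positivity) hts
  simp only [sub_self, Real.exp_zero] at h2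
  rw [← h2, jumpOp]
  congr 1; funext q
  rw [jumpDensity, hb.integral_eq, neg_sub, one_add_one_eq_two, ← ENNReal.ofReal_ofNat,
    ← ENNReal.ofReal_mul (by have := hb.pos q x; positivity)]
  congr 1; simp only [sub_zero]; ring

theorem stayProb_add_jumpOp_one (hb : IsConductance b) {t s : ℝ} (hts : t ≤ s) (x : ℤ) :
    stayProb b x t s + jumpOp b t (fun _ _ => 1) s x = 1 := by
  rw [jumpOp_one hb hts, hb.stayProb_eq, ← ENNReal.ofReal_add (Real.exp_pos _).le]
  · simp
  · rw [sub_nonneg, Real.exp_le_one_iff, sub_nonpos]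
    exact (hb.cumRate_strictMono x).monotone hts

theorem jumpOp_one_le (hb : IsConductance b) {t s : ℝ} (hts : t ≤ s) (x : ℤ) :
    jumpOp b t (fun _ _ => 1) s x ≤ 1 :=
  le_of_le_of_eq le_add_self (stayProb_add_jumpOp_one hb hts x)

/-- The strict inequality supplies the contraction factor of the maximum principle: the walk has a
positive chance not to jump at all. -/
theorem jumpOp_one_lt (hb : IsConductance b) {t s : ℝ} (hts : t ≤ s) (x : ℤ) :
    jumpOp b t (fun _ _ => 1) s x < 1 := by
  rw [jumpOp_one hb hts, ← ENNReal.ofReal_one, ENNReal.ofReal_lt_ofReal_iff one_pos]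
  have := Real.exp_pos (cumRate b x t - cumRate b x s)
  linarith

theorem jumpOp_one_mono (hb : IsConductance b) {t s S : ℝ} (hts : t ≤ s) (hsS : s ≤ S) (x : ℤ) :
    jumpOp b t (fun _ _ => 1) s x ≤ jumpOp b t (fun _ _ => 1) S x := by
  rw [jumpOp_one hb hts, jumpOp_one hb (hts.trans hsS)]
  have := (hb.cumRate_strictMono x).monotone hsS
  gcongr

/-- A supersolution of the backward equation that grows linearly in space. -/
noncomputable def linearBarrier (b : ℝ → ℤ → ℝ) (r ε s : ℝ) (x : ℤ) : ℝ :=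
  ε * (|(x : ℝ)| + (cumRate b 0 s - cumRate b 0 r))

theorem linearBarrier_nonneg (hb : IsConductance b) {r ε s : ℝ} (hε : 0 ≤ ε) (hrs : r ≤ s)
    (x : ℤ) : 0 ≤ linearBarrier b r ε s x := by
  have := (hb.cumRate_strictMono 0).monotone hrs
  have := abs_nonneg (x : ℝ)
  unfold linearBarrier
  exact mul_nonneg hε (by linarith)

theorem measurable_linearBarrier (hb : IsConductance b) (r ε : ℝ) (x : ℤ) :
    Measurable (fun s => linearBarrier b r ε s x) := by
  have := (hb.continuous_cumRate 0).measurable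
  unfold linearBarrier
  fun_prop

theorem jumpOp_linearBarrier_le (hb : IsConductance b) {r ε s : ℝ} (hε : 0 ≤ ε) (hrs : r ≤ s)
    (x : ℤ) :
    jumpOp b r (fun q z => ENNReal.ofReal (linearBarrier b r ε q z)) s x ≤
      ENNReal.ofReal (linearBarrier b r ε s x) := by
  have hmono := (hb.cumRate_strictMono 0).monotone
  -- At the origin there is equality. With `C = cumRate b 0`, the neighbouring value `1` of `|x|`
  -- contributes `2 b_q(0)`, which is the derivative of `C`, so the integrand is `ε` times the
  -- derivative of `(C(q) - C(r)) exp(C(q) - C(s))`.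
  by_cases hx : x = 0
  · subst hx
    have h1 := (hb.hasWeakDeriv_cumRate 0).sub (HasWeakDeriv.const (cumRate b 0 s))
    have h2 := (hb.hasWeakDeriv_cumRate 0).sub (HasWeakDeriv.const (cumRate b 0 r))
    have h3 := (h2.mul h1.exp).const_mul ε
    have h4 := h3.2 r s
    refine le_of_eq ?_
    simp only [sub_self, zero_mul, mul_zero, sub_zero, Real.exp_zero, mul_one] at h4
    have h5 : linearBarrier b r ε s 0 = ∫ q in r..s,
        ε * (2 * b q 0 * Real.exp (cumRate b 0 q - cumRate b 0 s) +
          (cumRate b 0 q - cumRate b 0 r) * (Real.exp (cumRate b 0 q - cumRate b 0 s) *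
            (2 * b q 0))) := by
      rw [← h4]; simp [linearBarrier]
    rw [h5, intervalIntegral.integral_of_le hrs, ofReal_integral_eq_lintegral_ofReal]
    · refine setLIntegral_congr_fun measurableSet_Ioc (fun q hq => ?_)
      have hC : 0 ≤ cumRate b 0 q - cumRate b 0 r := sub_nonneg.2 (hmono hq.1.le)
      have hbq := hb.pos q 0
      dsimp only
      rw [jumpDensity, hb.integral_eq, neg_sub, ← ENNReal.ofReal_add
        (linearBarrier_nonneg hb hε hq.1.le _) (linearBarrier_nonneg hb hε hq.1.le _),
        ← ENNReal.ofReal_mul (by positivity)]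
      congr 1
      simp only [linearBarrier]
      norm_num
      ring
    · refine (intervalIntegrable_iff_integrableOn_Ioc_of_le hrs).1 ?_
      simpa only [sub_zero] using intervalIntegrable_of_locallyIntegrable h3.1 r s
    · refine (ae_restrict_iff' measurableSet_Ioc).2 (Eventually.of_forall fun q hq => ?_)
      have hC : 0 ≤ cumRate b 0 q - cumRate b 0 r := sub_nonneg.2 (hmono hq.1.le)
      have hbq := hb.pos q 0
      have := Real.exp_pos (cumRate b 0 q - cumRate b 0 s)
      dsimp only [Pi.zero_apply]
      positivity
  -- Away from the origin `|x|` is discrete harmonic and the additional term increases with time.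
  -- The mean of the barrier over the two neighbours at `q ≤ s` is therefore at most its value at
  -- `(s, x)`.
  · have habs : |((x + 1 : ℤ) : ℝ)| + |((x - 1 : ℤ) : ℝ)| = 2 * |(x : ℝ)| := by
      rcases lt_or_gt_of_ne hx with h | h
      · have h' : (x : ℝ) ≤ -1 := by exact_mod_cast (by omega : x ≤ -1)
        push_cast
        rw [abs_of_nonpos (by linarith), abs_of_nonpos (by linarith), abs_of_nonpos (by linarith)]
        ring
      · have h' : (1 : ℝ) ≤ x := by exact_mod_cast (by omega : 1 ≤ x)
        push_cast
        rw [abs_of_nonneg (by linarith), abs_of_nonneg (by linarith), abs_of_nonneg (by linarith)]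
        ring
    calc jumpOp b r (fun q z => ENNReal.ofReal (linearBarrier b r ε q z)) s x
        ≤ jumpOp b r (fun _ _ => ENNReal.ofReal (linearBarrier b r ε s x) * 1) s x := by
          refine setLIntegral_mono' measurableSet_Ioc (fun q hq => ?_)
          have hn := linearBarrier_nonneg hb hε hrs x
          rw [mul_one, ← ENNReal.ofReal_add (linearBarrier_nonneg hb hε hq.1.le _)
            (linearBarrier_nonneg hb hε hq.1.le _), ← ENNReal.ofReal_add hn hn]
          gcongr jumpDensity b x q s * ENNReal.ofReal ?_
          have hC := hmono hq.2
          have : ε * cumRate b 0 q ≤ ε * cumRate b 0 s := by gcongr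
          unfold linearBarrier
          linear_combination ε * habs + 2 * this
      _ ≤ _ := by
          rw [jumpOp_const_mul ENNReal.ofReal_ne_top]
          exact mul_le_of_le_one_right' (jumpOp_one_le hb hrs x)

/-- Uniqueness of bounded solutions of the backward equation. -/
theorem eq_zero_of_le_jumpOp (hb : IsConductance b) {r : ℝ} {v : ℝ → ℤ → ℝ≥0∞}
    (hv1 : ∀ s, r ≤ s → ∀ x, v s x ≤ 1) (hv : ∀ s, r ≤ s → ∀ x, v s x ≤ jumpOp b r v s x)
    {S : ℝ} (hrS : r ≤ S) (x : ℤ) : v S x = 0 := by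
  -- The excess of `v` over a barrier of slope `1/N` is shown to vanish; then `N → ∞`. Truncated
  -- subtraction of a supersolution from a subsolution leaves a subsolution `z`, which vanishes
  -- outside `[-N, N]` because the barrier is at least `1 ≥ v` there.
  have key : ∀ N : ℕ, 0 < N → v S x ≤ ENNReal.ofReal (linearBarrier b r (1 / N) S x) := by
    intro N hN
    have hε : (0 : ℝ) ≤ 1 / N := by positivity
    set w : ℝ → ℤ → ℝ≥0∞ := fun q z => ENNReal.ofReal (linearBarrier b r (1 / N) q z) with hw
    set z : ℝ → ℤ → ℝ≥0∞ := fun q y => v q y - w q y with hz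
    have hz1 : ∀ q, r ≤ q → ∀ y, z q y ≤ jumpOp b r z q y := by
      intro q hq y
      rw [hz]
      refine tsub_le_iff_left.2 ?_
      calc v q y ≤ jumpOp b r v q y := hv q hq y
        _ ≤ jumpOp b r (fun p y => w p y + z p y) q y :=
            jumpOp_mono fun p _ y => le_add_tsub
        _ = jumpOp b r w q y + jumpOp b r z q y :=
            jumpOp_add hb fun y => (measurable_linearBarrier hb _ _ y).ennreal_ofReal
        _ ≤ _ := by gcongr; exact jumpOp_linearBarrier_le hb hε hq y
    have hz0 : ∀ q, r ≤ q → ∀ y : ℤ, y ∉ Finset.Icc (-(N : ℤ)) N → z q y = 0 := by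
      intro q hq y hy
      rw [hz]
      refine tsub_eq_zero_of_le ((hv1 q hq y).trans ?_)
      rw [hw, ← ENNReal.ofReal_one]
      refine ENNReal.ofReal_le_ofReal ?_
      have h1 : (N : ℝ) ≤ |(y : ℝ)| := by
        have : (N : ℤ) ≤ |y| := by
          by_contra hlt
          rw [not_le, abs_lt] at hlt
          exact hy (Finset.mem_Icc.2 ⟨hlt.1.le, hlt.2.le⟩)
        exact_mod_cast this
      have h2 := (hb.cumRate_strictMono 0).monotone hq
      have hN' : (0 : ℝ) < N := by exact_mod_cast hN
      unfold linearBarrier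
      rw [one_div, inv_mul_eq_div, le_div_iff₀ hN']
      linarith
    -- Only finitely many sites remain, so the total jump masses up to time `S` have a maximum `θ <
    -- 1`, although the rates are unbounded over all sites.
    set θ : ℝ≥0∞ := (Finset.Icc (-(N : ℤ)) N).sup fun y => jumpOp b r (fun _ _ => 1) S y
    have hθ : θ < 1 := (Finset.sup_lt_iff (by simp)).2 fun y _ => jumpOp_one_lt hb hrS y
    set M : ℝ≥0∞ := ⨆ q ∈ Set.Icc r S, ⨆ y, z q y with hM
    have hzM : ∀ q ∈ Set.Icc r S, ∀ y, z q y ≤ M := fun q hq y =>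
      (le_iSup (z q) y).trans (le_iSup₂ (f := fun q (_ : q ∈ Set.Icc r S) => ⨆ y, z q y) q hq)
    have hM1 : M ≤ 1 := iSup₂_le fun q hq => iSup_le fun y => tsub_le_self.trans (hv1 q hq.1 y)
    -- The supremum `M` of `z` is reproduced with the factor `θ < 1`; being finite, it must vanish.
    have hM2 : M ≤ M * θ := by
      refine iSup₂_le fun q hq => iSup_le fun y => ?_
      by_cases hy : y ∈ Finset.Icc (-(N : ℤ)) N
      · calc z q y ≤ jumpOp b r z q y := hz1 q hq.1 y
          _ ≤ jumpOp b r (fun _ _ => M * 1) q y := jumpOp_mono fun p hp y => by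
              rw [mul_one]; exact hzM p ⟨hp.1.le, hp.2.trans hq.2⟩ y
          _ = M * jumpOp b r (fun _ _ => 1) q y :=
              jumpOp_const_mul (ne_top_of_le_ne_top ENNReal.one_ne_top hM1)
          _ ≤ M * θ := by
              gcongr
              exact (jumpOp_one_mono hb hq.1 hq.2 y).trans
                (Finset.le_sup (f := fun y => jumpOp b r (fun _ _ => 1) S y) hy)
      · rw [hz0 q hq.1 y hy]; exact zero_le
    have hM0 : M = 0 := by
      by_contra hne
      have h3 : M * 1 ≤ M * θ := by rwa [mul_one]
      exact absurd ((ENNReal.mul_le_mul_iff_right hne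
        (ne_top_of_le_ne_top ENNReal.one_ne_top hM1)).1 h3) (not_le.2 hθ)
    have h4 := hzM S ⟨hrS, le_rfl⟩ x
    rw [hM0, le_zero_iff] at h4
    exact tsub_eq_zero_iff_le.1 h4
  have hlim : Tendsto (fun N : ℕ => ENNReal.ofReal (linearBarrier b r (1 / N) S x)) atTop
      (𝓝 0) := by
    rw [← ENNReal.ofReal_zero]
    refine ENNReal.tendsto_ofReal ?_
    unfold linearBarrier
    simpa using (tendsto_one_div_atTop_nhds_zero_nat (𝕜 := ℝ)).mul_const
      (|(x : ℝ)| + (cumRate b 0 S - cumRate b 0 r))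
  refine le_zero_iff.1 (ge_of_tendsto hlim ?_)
  filter_upwards [eventually_gt_atTop 0] with N hN using key N hN

end MaximumPrinciple

end DynCond

namespace DynCond

/-! ### The transition function of the dual walk -/

section Kernel

variable {b : ℝ → ℤ → ℝ}

theorem IsConductance.measurable_dualKernelN_left (hb : IsConductance b) (n : ℕ) (x y : ℤ)
    (t : ℝ) : Measurable (fun s => dualKernelN b n s x t y) :=
  hb.measurable_dualKernelN n x y measurable_id measurable_const

theorem IsConductance.measurable_dualKernel_left (hb : IsConductance b) (x y : ℤ) (t : ℝ) :
    Measurable (fun s => dualKernel b s x t y) :=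
  hb.measurable_dualKernel x y measurable_id measurable_const

theorem dualKernelN_le_succ (b : ℝ → ℤ → ℝ) (n : ℕ) (s : ℝ) (x : ℤ) (t : ℝ) (y : ℤ) :
    dualKernelN b n s x t y ≤ dualKernelN b (n + 1) s x t y := by
  induction n generalizing s x with
  | zero => exact zero_le
  | succ n ih =>
    rw [dualKernelN_succ, dualKernelN_succ]
    gcongr
    exact jumpOp_mono fun q _ z => ih q z

theorem dualKernelN_mono (b : ℝ → ℤ → ℝ) (s : ℝ) (x : ℤ) (t : ℝ) (y : ℤ) :
    Monotone (fun n => dualKernelN b n s x t y) :=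
  monotone_nat_of_le_succ fun n => dualKernelN_le_succ b n s x t y

theorem dualKernel_eq_iSup_succ (b : ℝ → ℤ → ℝ) (s : ℝ) (x : ℤ) (t : ℝ) (y : ℤ) :
    dualKernel b s x t y = ⨆ n, dualKernelN b (n + 1) s x t y :=
  ((dualKernelN_mono b s x t y).iSup_nat_add 1).symm

/-- The Kolmogorov backward equation. -/
theorem dualKernel_backward (hb : IsConductance b) (s : ℝ) (x : ℤ) (t : ℝ) (y : ℤ) :
    dualKernel b s x t y = (if x = y then stayProb b x t s else 0) +
      jumpOp b t (fun q z => dualKernel b q z t y) s x := by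
  rw [dualKernel_eq_iSup_succ]
  simp only [dualKernelN_succ]
  rw [← ENNReal.add_iSup]
  congr 1
  exact (jumpOp_iSup hb
    (fun i z => hb.measurable_dualKernelN i z y measurable_id measurable_const)
    (fun q z => dualKernelN_mono b q z t y)).symm

theorem dualKernel_backward_split (hb : IsConductance b) {t r s : ℝ} (htr : t ≤ r) (hrs : r ≤ s)
    (x y : ℤ) : dualKernel b s x t y = stayProb b x r s * dualKernel b r x t y +
      jumpOp b r (fun q z => dualKernel b q z t y) s x := by
  rw [dualKernel_backward hb s, jumpOp_split hb htr hrs, dualKernel_backward hb r, mul_add,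
    ← add_assoc]
  congr 2
  split_ifs
  · rw [hb.stayProb_mul]
  · rw [mul_zero]

theorem tsum_stayProb_ite (s : ℝ) (x : ℤ) (t : ℝ) :
    ∑' y, (if x = y then stayProb b x t s else 0) = stayProb b x t s := by
  rw [tsum_eq_single x (fun y hy => if_neg hy.symm), if_pos rfl]

theorem tsum_dualKernelN_le_one (hb : IsConductance b) (n : ℕ) {t s : ℝ} (hts : t ≤ s) (x : ℤ) :
    ∑' y, dualKernelN b n s x t y ≤ 1 := by
  induction n generalizing s x with
  | zero => simp [dualKernelN_zero]
  | succ n ih =>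
    simp only [dualKernelN_succ]
    rw [ENNReal.tsum_add, tsum_stayProb_ite,
      ← jumpOp_tsum hb (fun y z => hb.measurable_dualKernelN_left n z y t),
      ← stayProb_add_jumpOp_one hb hts x]
    gcongr
    exact jumpOp_mono fun q hq z => ih hq.1.le z

theorem tsum_dualKernel_le_one (hb : IsConductance b) {t s : ℝ} (hts : t ≤ s) (x : ℤ) :
    ∑' y, dualKernel b s x t y ≤ 1 := by
  rw [ENNReal.tsum_eq_iSup_sum]
  refine iSup_le fun S => ?_
  simp only [dualKernel]
  rw [ENNReal.finsetSum_iSup_of_monotone (fun y => dualKernelN_mono b s x t y)]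
  exact iSup_le fun n => (ENNReal.sum_le_tsum S).trans (tsum_dualKernelN_le_one hb n hts x)

theorem dualKernel_le_one (hb : IsConductance b) {t s : ℝ} (hts : t ≤ s) (x y : ℤ) :
    dualKernel b s x t y ≤ 1 :=
  (ENNReal.le_tsum y).trans (tsum_dualKernel_le_one hb hts x)

/-- Comparison of bounded solutions of the backward equation with the same data. -/
theorem le_of_backward_equation (hb : IsConductance b) {r : ℝ} {f g h : ℝ → ℤ → ℝ≥0∞}
    (hfm : ∀ z, Measurable (fun q => g q z)) (hf1 : ∀ s, r ≤ s → ∀ x, f s x ≤ 1)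
    (hf : ∀ s, r ≤ s → ∀ x, f s x = h s x + jumpOp b r f s x)
    (hg : ∀ s, r ≤ s → ∀ x, g s x = h s x + jumpOp b r g s x) {s : ℝ} (hrs : r ≤ s) (x : ℤ) :
    f s x ≤ g s x := by
  have h0 : f s x - g s x = 0 := by
    -- The common source `h` cancels, so the positive part of `f - g` is a bounded subsolution
    -- without source. Only `f` has to be bounded.
    refine eq_zero_of_le_jumpOp hb (v := fun s x => f s x - g s x)
      (fun s hs x => tsub_le_self.trans (hf1 s hs x)) (fun s hs x => ?_) hrs x
    refine tsub_le_iff_left.2 ?_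
    calc f s x = h s x + jumpOp b r f s x := hf s hs x
      _ ≤ h s x + jumpOp b r (fun q z => g q z + (f q z - g q z)) s x := by
          gcongr; exact jumpOp_mono fun q _ z => le_add_tsub
      _ = g s x + jumpOp b r (fun q z => f q z - g q z) s x := by
          rw [jumpOp_add hb hfm, ← add_assoc, ← hg s hs]
  exact tsub_eq_zero_iff_le.1 h0

theorem measurable_tsum_dualKernel_left (hb : IsConductance b) (t : ℝ) (z : ℤ) :
    Measurable (fun q => ∑' y, dualKernel b q z t y) :=
  Measurable.tsum fun y => hb.measurable_dualKernel z y measurable_id measurable_const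

/-- The dual walk does not explode. -/
theorem tsum_dualKernel_eq_one (hb : IsConductance b) {t s : ℝ} (hts : t ≤ s) (x : ℤ) :
    ∑' y, dualKernel b s x t y = 1 := by
  refine le_antisymm (tsum_dualKernel_le_one hb hts x) ?_
  -- The constant `1` and the total mass solve the same equation, whose source is the probability of
  -- not jumping.
  refine le_of_backward_equation hb (f := fun _ _ => 1) (r := t)
    (g := fun s x => ∑' y, dualKernel b s x t y)
    (h := fun s x => stayProb b x t s) (measurable_tsum_dualKernel_left hb t)
    (fun _ _ _ => le_rfl) (fun s hs x => (stayProb_add_jumpOp_one hb hs x).symm)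
    (fun s hs x => ?_) hts x
  have h : ∀ y, dualKernel b s x t y = _ := fun y => dualKernel_backward hb s x t y
  simp only [h]
  rw [ENNReal.tsum_add, tsum_stayProb_ite,
    ← jumpOp_tsum hb (fun y z => hb.measurable_dualKernel_left z y t)]

/-- The Chapman-Kolmogorov equation. -/
theorem tsum_dualKernel_mul (hb : IsConductance b) {t r s : ℝ} (htr : t ≤ r) (hrs : r ≤ s)
    (x y : ℤ) :
    ∑' z, dualKernel b s x r z * dualKernel b r z t y = dualKernel b s x t y := by
  have hm1 : ∀ z, Measurable fun q => dualKernel b q z t y := fun z =>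
    hb.measurable_dualKernel z y measurable_id measurable_const
  have hm2 : ∀ z w, Measurable fun q => dualKernel b q z r w := fun z w =>
    hb.measurable_dualKernel z w measurable_id measurable_const
  have hm3 : ∀ x, Measurable fun q => ∑' z, dualKernel b q x r z * dualKernel b r z t y := fun x =>
    Measurable.tsum fun z => (hm2 x z).mul_const _
  -- As functions of `(s, x)` with `s ≥ r`, both sides are bounded solutions of the backward
  -- equation started at time `r` from `K(r, x; t, y)`; the comparison is applied in both
  -- directions.
  have e1 : ∀ s, r ≤ s → ∀ x, ∑' z, dualKernel b s x r z * dualKernel b r z t y =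
      stayProb b x r s * dualKernel b r x t y + jumpOp b r
        (fun q w => ∑' z, dualKernel b q w r z * dualKernel b r z t y) s x := by
    intro s hs x
    have h : ∀ z, dualKernel b s x r z = _ := fun z => dualKernel_backward hb s x r z
    simp only [h, add_mul]
    rw [ENNReal.tsum_add, jumpOp_tsum hb (fun z w => (hm2 w z).mul_const _),
      tsum_eq_single x (fun z hz => by rw [if_neg hz.symm, zero_mul]), if_pos rfl]
    congr 2; funext z
    simp only [mul_comm _ (dualKernel b r z t y)]
    exact (jumpOp_const_mul (ne_top_of_le_ne_top ENNReal.one_ne_top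
      (dualKernel_le_one hb htr z y))).symm
  have e2 : ∀ s, r ≤ s → ∀ x, dualKernel b s x t y = stayProb b x r s * dualKernel b r x t y +
      jumpOp b r (fun q w => dualKernel b q w t y) s x := fun s hs x =>
    dualKernel_backward_split hb htr hs x y
  refine le_antisymm ?_ ?_
  · refine le_of_backward_equation hb hm1 (fun s hs x => ?_) e1 e2 hrs x
    calc _ ≤ ∑' z, dualKernel b s x r z * 1 := by
          gcongr with z; exact dualKernel_le_one hb htr z y
      _ ≤ 1 := by simpa using tsum_dualKernel_le_one hb hs x
  · exact le_of_backward_equation hb hm3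
      (fun s hs x => dualKernel_le_one hb (htr.trans hs) x y) e2 e1 hrs x

theorem jumpOp_pos (hb : IsConductance b) {t s : ℝ} (hts : t < s) (x : ℤ) {v : ℝ → ℤ → ℝ≥0∞}
    (hvm : ∀ z, Measurable fun q => v q z)
    (hv : ∀ q, t < q → 0 < v q (x + 1) + v q (x - 1)) : 0 < jumpOp b t v s x := by
  have hm : Measurable fun q => jumpDensity b x q s * (v q (x + 1) + v q (x - 1)) :=
    (hb.measurable_jumpDensity_left x s).mul ((hvm _).add (hvm _))
  rw [jumpOp, setLIntegral_pos_iff hm]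
  refine lt_of_lt_of_le ?_ (measure_mono (s := Set.Ioc t s) fun q hq => ⟨?_, hq⟩)
  · simp [hts]
  · exact (ENNReal.mul_pos (hb.jumpDensity_pos x q s).ne' (hv q hq.1).ne').ne'

/-- Induction on the distance to `y`: a jump towards `y` has positive density at every time in `(t,
s)` and leaves a positive amount of time for the rest of the path. -/
theorem dualKernel_pos (hb : IsConductance b) {t s : ℝ} (hts : t < s) (x y : ℤ) :
    0 < dualKernel b s x t y := by
  obtain ⟨n, hn⟩ : ∃ n : ℕ, (x - y).natAbs = n := ⟨_, rfl⟩
  induction n generalizing s x with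
  | zero =>
    have hxy : x = y := by omega
    rw [dualKernel_backward hb, if_pos hxy]
    exact lt_of_lt_of_le (IsConductance.stayProb_pos x t s) le_self_add
  | succ n ih =>
    rw [dualKernel_backward hb]
    refine lt_of_lt_of_le (jumpOp_pos hb hts x
      (fun z => hb.measurable_dualKernel_left z y t) ?_) le_add_self
    intro q hq
    rcases lt_or_ge x y with h | h
    · exact lt_of_lt_of_le (ih hq (x + 1) (by omega)) le_self_add
    · exact lt_of_lt_of_le (ih hq (x - 1) (by omega)) le_add_self

/-- The iterates are defined by conditioning on the first jump. Splitting off the last jump instead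
gives the same sum over paths; in the induction step a path with at least two jumps is cut at both
ends. -/
theorem dualKernelN_forward (hb : IsConductance b) (n : ℕ) (s : ℝ) (x : ℤ) (t : ℝ) (y : ℤ) :
    dualKernelN b (n + 1) s x t y = (if x = y then stayProb b y t s else 0) +
      ∫⁻ q in Set.Ioc t s, (dualKernelN b n s x q (y + 1) * ENNReal.ofReal (b q (y + 1)) +
        dualKernelN b n s x q (y - 1) * ENNReal.ofReal (b q (y - 1))) * stayProb b y t q := by
  induction n generalizing s x with
  | zero =>
    rw [dualKernelN_succ]
    simp only [jumpOp, dualKernelN_zero]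
    congr 1
    · split_ifs with h
      · rw [h]
      · rfl
    · simp
  | succ n ih =>
    have hbm : ∀ z, Measurable fun q => ENNReal.ofReal (b q z) := fun z =>
      (hb.measurable z).ennreal_ofReal
    have hst : Measurable fun q => stayProb b y t q :=
      hb.measurable_stayProb y measurable_const measurable_id
    have hjd := hb.measurable_jumpDensity_left x s
    rw [dualKernelN_succ]
    have hL : jumpOp b t (fun q z => dualKernelN b (n + 1) q z t y) s x =
        (∫⁻ r in Set.Ioc t s, jumpDensity b x r s * ((if x + 1 = y then stayProb b y t r else 0) +
          (if x - 1 = y then stayProb b y t r else 0))) +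
        ∫⁻ r in Set.Ioc t s, ∫⁻ q in Set.Ioc t r, jumpDensity b x r s *
          (((dualKernelN b n r (x + 1) q (y + 1) + dualKernelN b n r (x - 1) q (y + 1)) *
              ENNReal.ofReal (b q (y + 1)) +
            (dualKernelN b n r (x + 1) q (y - 1) + dualKernelN b n r (x - 1) q (y - 1)) *
              ENNReal.ofReal (b q (y - 1))) * stayProb b y t q) := by
      rw [jumpOp, ← lintegral_add_left]
      · congr 1; funext r
        have hk : ∀ z w, Measurable fun q => dualKernelN b n r z q w := fun z w =>
          hb.measurable_dualKernelN n z w measurable_const measurable_id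
        rw [ih, ih, lintegral_const_mul, add_add_add_comm, mul_add, ← lintegral_add_left]
        · congr 3; funext q; ring
        · exact (((hk _ _).mul (hbm _)).add ((hk _ _).mul (hbm _))).mul hst
        · exact ((((hk _ _).add (hk _ _)).mul (hbm _)).add
            (((hk _ _).add (hk _ _)).mul (hbm _))).mul hst
      · refine hjd.mul (Measurable.add ?_ ?_)
        · split_ifs; exacts [hst, measurable_const]
        · split_ifs; exacts [hst, measurable_const]
    have hR : ∫⁻ q in Set.Ioc t s,
          (dualKernelN b (n + 1) s x q (y + 1) * ENNReal.ofReal (b q (y + 1)) +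
          dualKernelN b (n + 1) s x q (y - 1) * ENNReal.ofReal (b q (y - 1))) * stayProb b y t q =
        (∫⁻ q in Set.Ioc t s, ((if x = y + 1 then stayProb b x q s else 0) *
            ENNReal.ofReal (b q (y + 1)) + (if x = y - 1 then stayProb b x q s else 0) *
            ENNReal.ofReal (b q (y - 1))) * stayProb b y t q) +
        ∫⁻ q in Set.Ioc t s, ∫⁻ r in Set.Ioc q s, jumpDensity b x r s *
          (((dualKernelN b n r (x + 1) q (y + 1) + dualKernelN b n r (x - 1) q (y + 1)) *
              ENNReal.ofReal (b q (y + 1)) +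
            (dualKernelN b n r (x + 1) q (y - 1) + dualKernelN b n r (x - 1) q (y - 1)) *
              ENNReal.ofReal (b q (y - 1))) * stayProb b y t q) := by
      have hsx : Measurable fun q => stayProb b x q s :=
        hb.measurable_stayProb x measurable_id measurable_const
      rw [← lintegral_add_left]
      · congr 1; funext q
        have hk : ∀ z w, Measurable fun r => dualKernelN b n r z q w := fun z w =>
          hb.measurable_dualKernelN n z w measurable_id measurable_const
        simp only [dualKernelN_succ, jumpOp, add_mul]
        rw [← lintegral_mul_const, ← lintegral_mul_const, ← lintegral_mul_const,
          ← lintegral_mul_const, add_add_add_comm, ← lintegral_add_left]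
        · congr 2; funext r; ring
        · exact (((hjd.mul ((hk _ _).add (hk _ _)))).mul_const _).mul_const _
        · exact ((hjd.mul ((hk _ _).add (hk _ _)))).mul_const _
        · exact (hjd.mul ((hk _ _).add (hk _ _)))
        · exact ((hjd.mul ((hk _ _).add (hk _ _)))).mul_const _
        · exact (hjd.mul ((hk _ _).add (hk _ _)))
      · refine Measurable.mul (Measurable.add (Measurable.mul ?_ (hbm _))
          (Measurable.mul ?_ (hbm _))) hst
        · split_ifs; exacts [hsx, measurable_const]
        · split_ifs; exacts [hsx, measurable_const]
    -- The double integrals agree: `r` is the time of the first jump and `q < r` that of the last,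
    -- and only the order of integration differs.
    rw [hL, hR, lintegral_triangle_swap]
    · congr 1
      · split_ifs with h
        · rw [h]
        · rfl
      · congr 1
        congr 1; funext q
        rw [IsConductance.jumpDensity_eq]
        -- These are the paths with one jump, which is both first and last; it leads from `x` to
        -- `y`, so at most one of the two directions contributes.
        by_cases h1 : x = y + 1
        · have h2 : ¬ x = y - 1 := by omega
          have h3 : ¬ x + 1 = y := by omega
          have h4 : x - 1 = y := by omega
          rw [if_neg h3, if_pos h4, if_pos h1, if_neg h2, h1]
          ring
        · by_cases h2 : x = y - 1
          · have h3 : x + 1 = y := by omega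
            have h4 : ¬ x - 1 = y := by omega
            rw [if_pos h3, if_neg h4, if_neg h1, if_pos h2, h2]
            ring
          · have h3 : ¬ x + 1 = y := by omega
            have h4 : ¬ x - 1 = y := by omega
            simp [h1, h2, h3, h4]
    · have hk : ∀ z w, Measurable fun p : ℝ × ℝ => dualKernelN b n p.1 z p.2 w := fun z w =>
        hb.measurable_dualKernelN n z w measurable_fst measurable_snd
      have hbm' : ∀ z, Measurable fun p : ℝ × ℝ => ENNReal.ofReal (b p.2 z) := fun z =>
        (hbm z).comp measurable_snd
      exact (hjd.comp measurable_fst).mul (((((hk _ _).add (hk _ _)).mul (hbm' _)).add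
        (((hk _ _).add (hk _ _)).mul (hbm' _))).mul (hst.comp measurable_snd))

/-- The Kolmogorov forward equation. -/
theorem dualKernel_forward (hb : IsConductance b) (s : ℝ) (x : ℤ) (t : ℝ) (y : ℤ) :
    dualKernel b s x t y = (if x = y then stayProb b y t s else 0) +
      ∫⁻ q in Set.Ioc t s, (dualKernel b s x q (y + 1) * ENNReal.ofReal (b q (y + 1)) +
        dualKernel b s x q (y - 1) * ENNReal.ofReal (b q (y - 1))) * stayProb b y t q := by
  have hbm : ∀ z, Measurable fun q => ENNReal.ofReal (b q z) := fun z =>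
    (hb.measurable z).ennreal_ofReal
  have hst : Measurable fun q => stayProb b y t q :=
    hb.measurable_stayProb y measurable_const measurable_id
  have hk : ∀ n z, Measurable fun q => dualKernelN b n s x q z := fun n z =>
    hb.measurable_dualKernelN n x z measurable_const measurable_id
  rw [dualKernel_eq_iSup_succ]
  simp only [dualKernelN_forward hb]
  rw [← ENNReal.add_iSup, ← lintegral_iSup]
  · congr 2; funext q
    rw [← ENNReal.iSup_mul, ← ENNReal.iSup_add_iSup_of_monotone, ← ENNReal.iSup_mul,
      ← ENNReal.iSup_mul]
    · rfl
    · intro i j hij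
      dsimp only
      gcongr
      exact dualKernelN_mono _ _ _ _ _ hij
    · intro i j hij
      dsimp only
      gcongr
      exact dualKernelN_mono _ _ _ _ _ hij
  · exact fun n => (((hk _ _).mul (hbm _)).add ((hk _ _).mul (hbm _))).mul hst
  · intro i j hij q
    dsimp only
    gcongr
    · exact dualKernelN_mono _ _ _ _ _ hij
    · exact dualKernelN_mono _ _ _ _ _ hij

end Kernel

end DynCond

namespace DynCond

/-! ### Space-time shifts -/

theorem setLIntegral_Ioc_comp_add_right (f : ℝ → ℝ≥0∞) (t s r : ℝ) :
    ∫⁻ q in Set.Ioc t s, f (q + r) = ∫⁻ q in Set.Ioc (t + r) (s + r), f q := by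
  rw [← lintegral_indicator measurableSet_Ioc, ← lintegral_indicator measurableSet_Ioc,
    ← lintegral_add_right_eq_self ((Set.Ioc (t + r) (s + r)).indicator f) r]
  congr 1; funext q
  simp [Set.indicator]

theorem jumpDensity_shift (b : ℝ → ℤ → ℝ) (r : ℝ) (z x : ℤ) (q s : ℝ) :
    jumpDensity (fun t x => b (t + r) (x + z)) x q s = jumpDensity b (x + z) (q + r) (s + r) := by
  rw [jumpDensity, jumpDensity,
    intervalIntegral.integral_comp_add_right (fun u => 2 * b u (x + z)) r]

theorem stayProb_shift (b : ℝ → ℤ → ℝ) (r : ℝ) (z x : ℤ) (q s : ℝ) :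
    stayProb (fun t x => b (t + r) (x + z)) x q s = stayProb b (x + z) (q + r) (s + r) := by
  rw [stayProb, stayProb,
    intervalIntegral.integral_comp_add_right (fun u => 2 * b u (x + z)) r]

theorem dualKernelN_shift (b : ℝ → ℤ → ℝ) (r : ℝ) (z : ℤ) (n : ℕ) (s : ℝ) (x : ℤ) (t : ℝ)
    (y : ℤ) : dualKernelN (fun t x => b (t + r) (x + z)) n s x t y =
      dualKernelN b n (s + r) (x + z) (t + r) (y + z) := by
  induction n generalizing s x with
  | zero => rfl
  | succ n ih =>
    rw [dualKernelN_succ, dualKernelN_succ, stayProb_shift, jumpOp, jumpOp,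
      ← setLIntegral_Ioc_comp_add_right]
    congr 1
    · simp
    · congr 1; funext q
      rw [jumpDensity_shift, ih, ih]
      congr 3 <;> ring

theorem dualKernel_shift (b : ℝ → ℤ → ℝ) (r : ℝ) (z : ℤ) (s : ℝ) (x : ℤ) (t : ℝ)
    (y : ℤ) : dualKernel (fun t x => b (t + r) (x + z)) s x t y =
      dualKernel b (s + r) (x + z) (t + r) (y + z) := by
  simp only [dualKernel, dualKernelN_shift]

/-! ### Measurability along orbits -/

section Orbit

variable {Ω : Type*} [MeasurableSpace Ω]

/-- The function `(t, ω) ↦ f (τ_{t,x} ω)` is jointly measurable for each `x`. -/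
def OrbitMeasurable {β : Type*} [MeasurableSpace β] (τ : ℝ → ℤ → Ω → Ω) (f : Ω → β) : Prop :=
  ∀ x, Measurable (fun p : ℝ × Ω => f (τ p.1 x p.2))

/-- The events whose indicator functions are measurable along orbits. -/
@[reducible] def orbitSigmaAlgebra (τ : ℝ → ℤ → Ω → Ω) : MeasurableSpace Ω where
  MeasurableSet' A := ∀ x, MeasurableSet {p : ℝ × Ω | τ p.1 x p.2 ∈ A}
  measurableSet_empty x := by simp
  measurableSet_compl A hA x := (hA x).compl
  measurableSet_iUnion A hA x := by
    have : {p : ℝ × Ω | τ p.1 x p.2 ∈ ⋃ i, A i} = ⋃ i, {p : ℝ × Ω | τ p.1 x p.2 ∈ A i} := by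
      ext p; simp
    rw [this]
    exact MeasurableSet.iUnion fun i => hA i x

/-- As measurability with respect to a single σ-algebra, the property defines a closed subspace of
the weighted space and so passes to weak limits. -/
theorem orbitMeasurable_iff {β : Type*} [MeasurableSpace β] {τ : ℝ → ℤ → Ω → Ω} {f : Ω → β} :
    OrbitMeasurable τ f ↔ Measurable[orbitSigmaAlgebra τ] f :=
  ⟨fun h _ hB x => h x hB, fun h x _ hB => h hB x⟩

theorem OrbitMeasurable.comp_measurable {β : Type*} [MeasurableSpace β] {τ : ℝ → ℤ → Ω → Ω}
    {f : Ω → β} (hf : OrbitMeasurable τ f) (x : ℤ) {α : Type*} [MeasurableSpace α]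
    {r : α → ℝ} {w : α → Ω} (hr : Measurable r) (hw : Measurable w) :
    Measurable (fun a => f (τ (r a) x (w a))) :=
  (hf x).comp (hr.prodMk hw)

end Orbit

/-! ### The semigroup of the environment process and its duality with densities. -/

/-- The transition operator of the environment seen from the dual walk, on functions. -/
noncomputable def dualSemigroup {Ω : Type*} (b : Ω → ℝ → ℤ → ℝ) (τ : ℝ → ℤ → Ω → Ω)
    (t : ℝ) (f : Ω → ℝ≥0∞) (ω : Ω) : ℝ≥0∞ :=
  ∑' y : ℤ, dualKernel (b ω) 0 0 (-t) y * f (τ (-t) y ω)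

theorem dualSemigroup_mono {Ω : Type*} {b : Ω → ℝ → ℤ → ℝ} {τ : ℝ → ℤ → Ω → Ω} {t : ℝ}
    {f g : Ω → ℝ≥0∞} (hfg : ∀ ω, f ω ≤ g ω)
    (ω : Ω) : dualSemigroup b τ t f ω ≤ dualSemigroup b τ t g ω :=
  ENNReal.tsum_le_tsum fun y => by gcongr; exact hfg _

namespace IsErgodicEnvironment

variable {Ω : Type*} [MeasurableSpace Ω] {P : Measure Ω} {b : Ω → ℝ → ℤ → ℝ}
  {τ : ℝ → ℤ → Ω → Ω}

theorem isConductanceField (henv : IsErgodicEnvironment P b τ) : IsConductanceField b :=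
  ⟨henv.pos, henv.measurable, henv.locallyIntegrable⟩

theorem isConductance (henv : IsErgodicEnvironment P b τ) (ω : Ω) : IsConductance (b ω) :=
  henv.isConductanceField.isConductance ω

theorem dualKernel_comp_shift (henv : IsErgodicEnvironment P b τ) (r : ℝ) (z : ℤ) (ω : Ω)
    (s : ℝ) (x : ℤ) (t : ℝ) (y : ℤ) : dualKernel (b (τ r z ω)) s x t y =
      dualKernel (b ω) (s + r) (x + z) (t + r) (y + z) := by
  rw [← dualKernel_shift]
  congr 1
  funext t x
  exact henv.covariant t x r z ω

theorem shift_measurable (henv : IsErgodicEnvironment P b τ) (t : ℝ) (x : ℤ) :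
    Measurable (τ t x) := (henv.invariant t x).measurable

theorem shift_neg (henv : IsErgodicEnvironment P b τ) (t : ℝ) (x : ℤ) (ω : Ω) :
    τ t x (τ (-t) (-x) ω) = ω := by
  rw [henv.shift_add, add_neg_cancel, add_neg_cancel, henv.shift_zero]

theorem neg_shift (henv : IsErgodicEnvironment P b τ) (t : ℝ) (x : ℤ) (ω : Ω) :
    τ (-t) (-x) (τ t x ω) = ω := by
  rw [henv.shift_add, neg_add_cancel, neg_add_cancel, henv.shift_zero]

theorem orbitSigmaAlgebra_le (henv : IsErgodicEnvironment P b τ) :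
    orbitSigmaAlgebra τ ≤ ‹MeasurableSpace Ω› := by
  intro A hA
  have h := measurable_prodMk_left (x := (0 : ℝ)) (hA 0)
  have h2 : (Prod.mk (0 : ℝ) ⁻¹' {p : ℝ × Ω | τ p.1 0 p.2 ∈ A}) = A := by
    ext ω; simp [henv.shift_zero]
  rwa [h2] at h

theorem _root_.DynCond.OrbitMeasurable.measurable {β : Type*} [MeasurableSpace β] {f : Ω → β}
    (hf : OrbitMeasurable τ f) (henv : IsErgodicEnvironment P b τ) : Measurable f :=
  (orbitMeasurable_iff.1 hf).mono henv.orbitSigmaAlgebra_le le_rfl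

theorem measurable_conductance (henv : IsErgodicEnvironment P b τ) (t : ℝ) (x : ℤ) :
    Measurable (fun ω => b ω t x) :=
  (henv.measurable x).comp (measurable_const.prodMk measurable_id)

theorem orbitMeasurable_conductance (henv : IsErgodicEnvironment P b τ) (t : ℝ) (x : ℤ) :
    OrbitMeasurable τ (fun ω => b ω t x) := by
  intro y
  simp only [henv.covariant]
  exact (henv.measurable (x + y)).comp
    ((measurable_const.add measurable_fst).prodMk measurable_snd)

theorem measurable_dualKernel (henv : IsErgodicEnvironment P b τ) (s : ℝ) (x : ℤ) (t : ℝ)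
    (y : ℤ) : Measurable (fun ω => dualKernel (b ω) s x t y) :=
  henv.isConductanceField.measurable_dualKernel x y measurable_const measurable_const
    measurable_id

theorem orbitMeasurable_approxDensity (henv : IsErgodicEnvironment P b τ) (ε : ℝ) :
    OrbitMeasurable τ (approxDensity b ε) := by
  intro x
  simp only [approxDensity, henv.dualKernel_comp_shift]
  refine Measurable.const_mul ?_ _
  refine Measurable.lintegral_prod_right' (ν := volume.restrict (Set.Ioi 0))
    (f := fun z : (ℝ × Ω) × ℝ => ENNReal.ofReal (Real.exp (-(ε * z.2))) *
      ∑' y : ℤ, dualKernel (b z.1.2) (z.2 + z.1.1) (y + x) (0 + z.1.1) (0 + x)) ?_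
  refine Measurable.mul (by fun_prop) (Measurable.tsum fun y => ?_)
  exact henv.isConductanceField.measurable_dualKernel (y + x) (0 + x) (by fun_prop) (by fun_prop)
    (by fun_prop)

theorem measurable_approxDensity (henv : IsErgodicEnvironment P b τ) (ε : ℝ) :
    Measurable (approxDensity b ε) :=
  (henv.orbitMeasurable_approxDensity ε).measurable henv

theorem measurable_dualSemigroup (henv : IsErgodicEnvironment P b τ) (t : ℝ) {f : Ω → ℝ≥0∞}
    (hf : Measurable f) : Measurable (dualSemigroup b τ t f) :=
  Measurable.tsum fun y => (henv.measurable_dualKernel 0 0 (-t) y).mul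
    (hf.comp (henv.shift_measurable _ _))

theorem dualSemigroup_const (henv : IsErgodicEnvironment P b τ) {t : ℝ} (ht : 0 ≤ t) (c : ℝ≥0∞)
    (ω : Ω) : dualSemigroup b τ t (fun _ => c) ω = c := by
  rw [dualSemigroup, ENNReal.tsum_mul_right,
    tsum_dualKernel_eq_one (henv.isConductance ω) (by linarith), one_mul]

theorem dualSemigroup_le (henv : IsErgodicEnvironment P b τ) {t : ℝ} (ht : 0 ≤ t) {c : ℝ≥0∞}
    {f : Ω → ℝ≥0∞} (hf : ∀ ω, f ω ≤ c) (ω : Ω) : dualSemigroup b τ t f ω ≤ c :=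
  (dualSemigroup_mono hf ω).trans_eq (henv.dualSemigroup_const ht c ω)

theorem dualSemigroup_dualSemigroup (henv : IsErgodicEnvironment P b τ) {s t : ℝ} (hs : 0 ≤ s)
    (ht : 0 ≤ t) (f : Ω → ℝ≥0∞) (ω : Ω) :
    dualSemigroup b τ s (dualSemigroup b τ t f) ω = dualSemigroup b τ (s + t) f ω := by
  simp only [dualSemigroup, henv.dualKernel_comp_shift, henv.shift_add]
  have h1 : ∀ y : ℤ, ∑' z, dualKernel (b ω) (0 + -s) (0 + y) (-t + -s) (z + y) *
      f (τ (-t + -s) (z + y) ω) = ∑' z, dualKernel (b ω) (-s) y (-(s + t)) z *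
      f (τ (-(s + t)) z ω) := by
    intro y
    rw [← (Equiv.addRight y).tsum_eq (fun z => dualKernel (b ω) (-s) y (-(s + t)) z *
      f (τ (-(s + t)) z ω))]
    simp [neg_add_rev]
  simp only [h1, ← ENNReal.tsum_mul_left]
  rw [ENNReal.tsum_comm]
  congr 1; funext z
  simp only [← mul_assoc]
  rw [ENNReal.tsum_mul_right, tsum_dualKernel_mul (henv.isConductance ω) (by linarith)
    (by linarith)]

/-- Duality of the environment process with the evolution of densities. -/
theorem lintegral_tsum_dualKernel_mul (henv : IsErgodicEnvironment P b τ) (s : ℝ)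
    {f : Ω → ℝ≥0∞} (hf : Measurable f) :
    ∫⁻ ω, (∑' y, dualKernel (b ω) s y 0 0) * f ω ∂P = ∫⁻ ω, dualSemigroup b τ s f ω ∂P := by
  simp only [dualSemigroup, ← ENNReal.tsum_mul_right]
  have hm1 : ∀ y, AEMeasurable (fun ω => dualKernel (b ω) s y 0 0 * f ω) P := fun y =>
    ((henv.measurable_dualKernel s y 0 0).mul hf).aemeasurable
  have hm2 : ∀ y, AEMeasurable (fun ω => dualKernel (b ω) 0 0 (-s) y * f (τ (-s) y ω)) P :=
    fun y => ((henv.measurable_dualKernel 0 0 (-s) y).mul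
      (hf.comp (henv.shift_measurable _ _))).aemeasurable
  rw [lintegral_tsum hm1, lintegral_tsum hm2, ← (Equiv.neg ℤ).tsum_eq]
  congr 1; funext y
  -- Under the shift by `(-s, y)`, the kernel from `(s, -y)` to `(0, 0)` becomes the kernel from
  -- `(0, 0)` to `(-s, y)`; hence the reflection of the summation index.
  have h := (henv.invariant (-s) y).lintegral_comp
    ((henv.measurable_dualKernel s (-y) 0 0).mul hf)
  refine h.symm.trans ?_
  congr 1; funext ω
  simp only [Pi.mul_apply, henv.dualKernel_comp_shift]
  simp

theorem lintegral_approxDensity_mul (henv : IsErgodicEnvironment P b τ) [SFinite P] (ε : ℝ)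
    {f : Ω → ℝ≥0∞} (hf : Measurable f) :
    ∫⁻ ω, approxDensity b ε ω * f ω ∂P = ENNReal.ofReal ε * ∫⁻ t in Set.Ioi (0 : ℝ),
      ENNReal.ofReal (Real.exp (-(ε * t))) * ∫⁻ ω, dualSemigroup b τ t f ω ∂P := by
  have hm : Measurable fun p : Ω × ℝ => ∑' y, dualKernel (b p.1) p.2 y 0 0 :=
    Measurable.tsum fun y => henv.isConductanceField.measurable_dualKernel y 0
      measurable_snd measurable_const measurable_fst
  simp only [approxDensity, mul_assoc]
  rw [lintegral_const_mul' _ _ ENNReal.ofReal_ne_top]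
  congr 1
  have h1 : ∀ ω, (∫⁻ t in Set.Ioi (0 : ℝ), ENNReal.ofReal (Real.exp (-(ε * t))) *
      ∑' y : ℤ, dualKernel (b ω) t y 0 0) * f ω = ∫⁻ t in Set.Ioi (0 : ℝ),
      ENNReal.ofReal (Real.exp (-(ε * t))) * ((∑' y : ℤ, dualKernel (b ω) t y 0 0) * f ω) := by
    intro ω
    rw [← lintegral_mul_const]
    · simp only [mul_assoc]
    · exact Measurable.mul (by fun_prop) (hm.comp measurable_prodMk_left)
  simp only [h1]
  rw [lintegral_lintegral_swap]
  · congr 1; funext t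
    rw [lintegral_const_mul' _ _ ENNReal.ofReal_ne_top, henv.lintegral_tsum_dualKernel_mul t hf]
  · refine Measurable.aemeasurable ?_
    exact Measurable.mul (by fun_prop) (hm.mul (hf.comp measurable_fst))

theorem lintegral_exp_neg_mul {ε : ℝ} (hε : 0 < ε) (a : ℝ) :
    ENNReal.ofReal ε * ∫⁻ t in Set.Ioi a, ENNReal.ofReal (Real.exp (-(ε * t))) =
      ENNReal.ofReal (Real.exp (-(ε * a))) := by
  have hi : IntegrableOn (fun t : ℝ => Real.exp (-(ε * t))) (Set.Ioi a) := by
    simpa only [neg_mul] using integrableOn_exp_mul_Ioi (neg_lt_zero.2 hε) a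
  rw [← ofReal_integral_eq_lintegral_ofReal hi (Eventually.of_forall fun t => (Real.exp_pos _).le),
    ← ENNReal.ofReal_mul hε.le]
  congr 1
  have h := integral_exp_mul_Ioi (neg_lt_zero.2 hε) a
  simp only [neg_mul] at h
  rw [h]; field_simp

theorem lintegral_approxDensity (henv : IsErgodicEnvironment P b τ) [IsProbabilityMeasure P]
    {ε : ℝ} (hε : 0 < ε) : ∫⁻ ω, approxDensity b ε ω ∂P = 1 := by
  have h := henv.lintegral_approxDensity_mul ε (measurable_const (a := (1 : ℝ≥0∞)))
  simp only [mul_one] at h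
  rw [h]
  have h2 : ∀ t ∈ Set.Ioi (0 : ℝ), ENNReal.ofReal (Real.exp (-(ε * t))) *
      ∫⁻ ω, dualSemigroup b τ t (fun _ => 1) ω ∂P = ENNReal.ofReal (Real.exp (-(ε * t))) := by
    intro t ht
    simp [henv.dualSemigroup_const (le_of_lt ht)]
  rw [setLIntegral_congr_fun measurableSet_Ioi h2, lintegral_exp_neg_mul hε]
  simp

/-! ### Ergodicity -/

/-- Shifts preserve `P`, so an event and its preimage have the same finite measure and an almost
sure inclusion is an equality. -/
theorem ae_eq_of_ae_subset_shift (henv : IsErgodicEnvironment P b τ) [IsFiniteMeasure P]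
    {A : Set Ω} (hA : MeasurableSet A) {t : ℝ} {x : ℤ} (h : A ≤ᵐ[P] τ t x ⁻¹' A) :
    τ t x ⁻¹' A =ᵐ[P] A :=
  (ae_eq_of_ae_subset_of_measure_ge h
    ((henv.invariant t x).measure_preimage hA.nullMeasurableSet).le hA.nullMeasurableSet
    (measure_ne_top _ _)).symm

theorem ae_eq_neg_shift (henv : IsErgodicEnvironment P b τ)
    {A : Set Ω} {t : ℝ} {x : ℤ} (h : τ t x ⁻¹' A =ᵐ[P] A) : τ (-t) (-x) ⁻¹' A =ᵐ[P] A := by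
  have h2 := (henv.invariant (-t) (-x)).quasiMeasurePreserving.preimage_ae_eq h
  rw [← Set.preimage_comp] at h2
  have h3 : τ t x ∘ τ (-t) (-x) = id := funext (henv.shift_neg t x)
  rw [h3, Set.preimage_id] at h2
  exact h2.symm

/-- An event that is almost surely mapped into itself by the forward shifts is trivial. -/
theorem measure_eq_zero_or_one_of_forward (henv : IsErgodicEnvironment P b τ) [IsFiniteMeasure P]
    {A : Set Ω} (hA : MeasurableSet A) (h : ∀ t, 0 < t → ∀ x, A ≤ᵐ[P] τ t x ⁻¹' A) :
    P A = 0 ∨ P A = 1 := by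
  have hpos : ∀ t, 0 < t → ∀ x, τ t x ⁻¹' A =ᵐ[P] A := fun t ht x =>
    henv.ae_eq_of_ae_subset_shift hA (h t ht x)
  have hneg : ∀ t, t < 0 → ∀ x, τ t x ⁻¹' A =ᵐ[P] A := fun t ht x => by
    simpa using henv.ae_eq_neg_shift (hpos (-t) (neg_pos.2 ht) (-x))
  refine henv.ergodic A hA fun t x => ?_
  rcases lt_trichotomy t 0 with ht | ht | ht
  · exact hneg t ht x
  -- A purely spatial shift is the composition of a shift by `(-1, 0)` and a shift by `(1, x)`.
  · subst ht
    have h2 := (henv.invariant (-1) 0).quasiMeasurePreserving.preimage_ae_eq (hpos 1 one_pos x)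
    rw [← Set.preimage_comp] at h2
    have h3 : τ 1 x ∘ τ (-1) 0 = τ 0 x := funext fun ω => by
      simp [henv.shift_add]
    rw [h3] at h2
    exact h2.trans (hneg (-1) (by norm_num) 0)
  · exact hpos t ht x

/-- An event that is almost surely mapped into itself by the backward shifts is trivial. -/
theorem measure_eq_zero_or_one_of_backward (henv : IsErgodicEnvironment P b τ)
    [IsFiniteMeasure P] {A : Set Ω} (hA : MeasurableSet A)
    (h : ∀ t, 0 < t → ∀ x, A ≤ᵐ[P] τ (-t) x ⁻¹' A) : P A = 0 ∨ P A = 1 := by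
  refine henv.measure_eq_zero_or_one_of_forward hA fun t ht x => ?_
  have h1 := henv.ae_eq_neg_shift (henv.ae_eq_of_ae_subset_shift hA (h t ht (-x)))
  rw [neg_neg, neg_neg] at h1
  exact h1.symm.le

end IsErgodicEnvironment

end DynCond

namespace DynCond

/-! ### The resolvent of the dual walk -/

theorem lintegral_Iio_Ioc_swap {f : ℝ → ℝ → ℝ≥0∞} (hf : Measurable (Function.uncurry f)) (s : ℝ) :
    ∫⁻ r in Set.Iio s, ∫⁻ q in Set.Ioc r s, f r q =
      ∫⁻ q in Set.Iic s, ∫⁻ r in Set.Iio q, f r q := by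
  have hm : MeasurableSet {p : ℝ × ℝ | p.1 < p.2 ∧ p.2 ≤ s} :=
    (measurableSet_lt measurable_fst measurable_snd).inter
      (measurableSet_le measurable_snd measurable_const)
  have hF : Measurable ({p : ℝ × ℝ | p.1 < p.2 ∧ p.2 ≤ s}.indicator (Function.uncurry f)) :=
    hf.indicator hm
  calc _ = ∫⁻ r, ∫⁻ q, {p : ℝ × ℝ | p.1 < p.2 ∧ p.2 ≤ s}.indicator
        (Function.uncurry f) (r, q) := by
        rw [← lintegral_indicator measurableSet_Iio]
        congr 1; funext r
        rw [Set.indicator_apply]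
        split_ifs with hr
        · rw [← lintegral_indicator measurableSet_Ioc]
          rfl
        · symm
          rw [lintegral_eq_zero_of_ae_eq_zero]
          refine Eventually.of_forall fun q => ?_
          refine Set.indicator_of_notMem ?_ _
          rintro ⟨h1, h2⟩
          exact hr (lt_of_lt_of_le h1 h2)
    _ = ∫⁻ q, ∫⁻ r, {p : ℝ × ℝ | p.1 < p.2 ∧ p.2 ≤ s}.indicator
        (Function.uncurry f) (r, q) := lintegral_lintegral_swap hF.aemeasurable
    _ = _ := by
        rw [← lintegral_indicator measurableSet_Iic]
        congr 1; funext q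
        rw [Set.indicator_apply]
        split_ifs with hq
        · rw [← lintegral_indicator measurableSet_Iio]
          congr 1; funext r
          have hq' : q ≤ s := hq
          simp only [Set.indicator, Set.mem_Iio, Set.mem_ofPred_eq, Function.uncurry]
          simp only [hq', and_true]
        · rw [lintegral_eq_zero_of_ae_eq_zero]
          refine Eventually.of_forall fun r => ?_
          refine Set.indicator_of_notMem ?_ _
          rintro ⟨h1, h2⟩
          exact hq h2

/-- The resolvent `ε ∫₀^∞ e^{-εt} E f(s - t, Y_{s-t}) dt` of the dual walk from `x` at time `s`. -/
noncomputable def dualResolvent (b : ℝ → ℤ → ℝ) (ε : ℝ) (F : ℝ → ℤ → ℝ≥0∞) (s : ℝ) (x : ℤ) :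
    ℝ≥0∞ :=
  ENNReal.ofReal ε * ∫⁻ r in Set.Iio s, ENNReal.ofReal (Real.exp (-(ε * (s - r)))) *
    ∑' y, dualKernel b s x r y * F r y

theorem setLIntegral_Iio_comp_add_right (f : ℝ → ℝ≥0∞) (s r : ℝ) :
    ∫⁻ q in Set.Iio s, f (q + r) = ∫⁻ q in Set.Iio (s + r), f q := by
  rw [← lintegral_indicator measurableSet_Iio, ← lintegral_indicator measurableSet_Iio,
    ← lintegral_add_right_eq_self ((Set.Iio (s + r)).indicator f) r]
  congr 1; funext q
  simp [Set.indicator]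

theorem setLIntegral_Ioi_comp_neg (f : ℝ → ℝ≥0∞) :
    ∫⁻ q in Set.Ioi (0 : ℝ), f (-q) = ∫⁻ q in Set.Iio 0, f q := by
  rw [← lintegral_indicator measurableSet_Ioi, ← lintegral_indicator measurableSet_Iio,
    ← lintegral_neg_eq_self ((Set.Iio (0 : ℝ)).indicator f)]
  congr 1; funext q
  simp [Set.indicator]

theorem dualResolvent_shift (b : ℝ → ℤ → ℝ) (ε : ℝ) (F : ℝ → ℤ → ℝ≥0∞) (r : ℝ) (z : ℤ) (s : ℝ)
    (x : ℤ) : dualResolvent (fun t x => b (t + r) (x + z)) ε (fun t x => F (t + r) (x + z)) s x =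
      dualResolvent b ε F (s + r) (x + z) := by
  rw [dualResolvent, dualResolvent, ← setLIntegral_Iio_comp_add_right]
  congr 2; funext q
  simp only [dualKernel_shift]
  rw [← (Equiv.addRight z).tsum_eq (fun y => dualKernel b (s + r) (x + z) (q + r) y * F (q + r) y)]
  congr 3; congr 1; ring

section Resolvent

variable {b : ℝ → ℤ → ℝ} {F : ℝ → ℤ → ℝ≥0∞}

theorem tsum_dualKernel_mul_le (hb : IsConductance b) {N : ℝ≥0∞} (hN : ∀ r y, F r y ≤ N)
    {s r : ℝ} (hrs : r ≤ s) (x : ℤ) : ∑' y, dualKernel b s x r y * F r y ≤ N := by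
  calc _ ≤ ∑' y, dualKernel b s x r y * N := by gcongr with y; exact hN r y
    _ = N := by rw [ENNReal.tsum_mul_right, tsum_dualKernel_eq_one hb hrs, one_mul]

theorem lintegral_Iio_exp {ε : ℝ} (hε : 0 < ε) (s : ℝ) :
    ENNReal.ofReal ε * ∫⁻ r in Set.Iio s, ENNReal.ofReal (Real.exp (-(ε * (s - r)))) = 1 := by
  have h1 := setLIntegral_Iio_comp_add_right
    (fun r => ENNReal.ofReal (Real.exp (-(ε * (s - r))))) 0 s
  rw [zero_add] at h1
  rw [← h1, ← setLIntegral_Ioi_comp_neg]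
  have h2 := IsErgodicEnvironment.lintegral_exp_neg_mul hε 0
  simp only [mul_zero, neg_zero, Real.exp_zero, ENNReal.ofReal_one] at h2
  rw [← h2]
  congr 2; funext t
  congr 3; ring

theorem dualResolvent_le (hb : IsConductance b) {ε : ℝ} (hε : 0 < ε) {N : ℝ≥0∞}
    (hN : ∀ r y, F r y ≤ N) (s : ℝ) (x : ℤ) : dualResolvent b ε F s x ≤ N := by
  calc dualResolvent b ε F s x
      ≤ ENNReal.ofReal ε * ∫⁻ r in Set.Iio s, ENNReal.ofReal (Real.exp (-(ε * (s - r)))) * N := by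
        unfold dualResolvent
        gcongr ENNReal.ofReal ε * ?_
        refine setLIntegral_mono' measurableSet_Iio fun r hr => ?_
        gcongr
        exact tsum_dualKernel_mul_le hb hN (le_of_lt hr) x
    _ = N := by
        rw [lintegral_mul_const _ (by fun_prop), ← mul_assoc, lintegral_Iio_exp hε, one_mul]

theorem tsum_dualKernel_mul_backward (hb : IsConductance b) (hF : ∀ r y, F r y ≠ ∞)
    (s r : ℝ) (x : ℤ) : ∑' y, dualKernel b s x r y * F r y = stayProb b x r s * F r x +
      jumpOp b r (fun q z => ∑' y, dualKernel b q z r y * F r y) s x := by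
  have h : ∀ y, dualKernel b s x r y = _ := fun y => dualKernel_backward hb s x r y
  have hm : ∀ y z, Measurable fun q => dualKernel b q z r y * F r y := fun y z =>
    (hb.measurable_dualKernel_left z y r).mul_const _
  rw [jumpOp_tsum hb hm]
  simp only [h, add_mul]
  rw [ENNReal.tsum_add, tsum_eq_single x (fun z hz => by rw [if_neg hz.symm, zero_mul]), if_pos rfl]
  congr 2; funext y
  simp only [mul_comm _ (F r y)]
  rw [← jumpOp_const_mul (hF r y)]

/-- The kernel is decomposed at the first jump, and the jump time `q` is exchanged with the time `r`
at which `F` is evaluated. The exponential on the left is the integrating factor for the killing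
rate `ε` and the jump rate `2 b`. -/
theorem dualResolvent_mild (hb : IsConductance b) {ε : ℝ}
    (hFm : ∀ y, Measurable fun r => F r y) (hF : ∀ r y, F r y ≠ ∞) (s : ℝ) (x : ℤ) :
    ENNReal.ofReal (Real.exp (ε * s + cumRate b x s)) * dualResolvent b ε F s x =
      ∫⁻ q in Set.Iic s, ENNReal.ofReal (Real.exp (ε * q + cumRate b x q)) *
        (ENNReal.ofReal ε * F q x + ENNReal.ofReal (b q x) *
          (dualResolvent b ε F q (x + 1) + dualResolvent b ε F q (x - 1))) := by
  set A : ℝ → ℝ → ℤ → ℝ≥0∞ := fun q r z => ∑' y, dualKernel b q z r y * F r y with hA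
  have hAm : ∀ z, Measurable fun p : ℝ × ℝ => A p.2 p.1 z := fun z =>
    Measurable.tsum fun y => (hb.measurable_dualKernel z y measurable_snd measurable_fst).mul
      ((hFm y).comp measurable_fst)
  have hAr : ∀ q z, Measurable fun r => A q r z := fun q z =>
    (hAm z).comp (measurable_id.prodMk measurable_const)
  have hc := (hb.continuous_cumRate x).measurable
  have hbm : Measurable fun q => ENNReal.ofReal (b q x) := (hb.measurable x).ennreal_ofReal
  have hst : ∀ r, ENNReal.ofReal (Real.exp (ε * s + cumRate b x s)) *
      (ENNReal.ofReal (Real.exp (-(ε * (s - r)))) * stayProb b x r s) =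
      ENNReal.ofReal (Real.exp (ε * r + cumRate b x r)) := by
    intro r
    rw [hb.stayProb_eq, ← ENNReal.ofReal_mul (Real.exp_pos _).le, ← Real.exp_add,
      ← ENNReal.ofReal_mul (Real.exp_pos _).le, ← Real.exp_add]
    congr 2; ring
  have hjd : ∀ r q, ENNReal.ofReal (Real.exp (ε * s + cumRate b x s)) *
      (ENNReal.ofReal (Real.exp (-(ε * (s - r)))) * jumpDensity b x q s) =
      ENNReal.ofReal (Real.exp (ε * q + cumRate b x q)) * ENNReal.ofReal (b q x) *
        ENNReal.ofReal (Real.exp (-(ε * (q - r)))) := by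
    intro r q
    have e : ENNReal.ofReal (Real.exp (ε * s + cumRate b x s)) *
        (ENNReal.ofReal (Real.exp (-(ε * (s - r)))) *
          ENNReal.ofReal (Real.exp (cumRate b x q - cumRate b x s))) =
        ENNReal.ofReal (Real.exp (ε * q + cumRate b x q)) *
          ENNReal.ofReal (Real.exp (-(ε * (q - r)))) := by
      rw [← ENNReal.ofReal_mul (Real.exp_pos _).le, ← Real.exp_add,
        ← ENNReal.ofReal_mul (Real.exp_pos _).le, ← Real.exp_add,
        ← ENNReal.ofReal_mul (Real.exp_pos _).le, ← Real.exp_add]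
      congr 2; ring
    rw [IsConductance.jumpDensity_eq, hb.stayProb_eq, mul_right_comm, ← e]
    ring
  have h1 : ∀ r, ENNReal.ofReal (Real.exp (ε * s + cumRate b x s)) *
      (ENNReal.ofReal (Real.exp (-(ε * (s - r)))) * A s r x) =
      ENNReal.ofReal (Real.exp (ε * r + cumRate b x r)) * F r x +
      ∫⁻ q in Set.Ioc r s, ENNReal.ofReal (Real.exp (ε * q + cumRate b x q)) *
        ENNReal.ofReal (b q x) * ENNReal.ofReal (Real.exp (-(ε * (q - r)))) *
        (A q r (x + 1) + A q r (x - 1)) := by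
    intro r
    simp only [hA]
    rw [tsum_dualKernel_mul_backward hb hF s r x, mul_add, mul_add, ← mul_assoc _ _ (F r x),
      ← mul_assoc _ _ (F r x), hst, jumpOp, ← lintegral_const_mul' _ _ ENNReal.ofReal_ne_top,
      ← lintegral_const_mul' _ _ ENNReal.ofReal_ne_top]
    congr 2; funext q
    rw [← hjd]; ring
  have hmF : Measurable fun r => ENNReal.ofReal (Real.exp (ε * r + cumRate b x r)) * F r x :=
    Measurable.mul (by fun_prop) (hFm x)
  rw [dualResolvent, mul_left_comm, ← lintegral_const_mul' _ _ ENNReal.ofReal_ne_top]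
  have h2 := lintegral_Iio_Ioc_swap (f := fun r q =>
    ENNReal.ofReal (Real.exp (ε * q + cumRate b x q)) *
        ENNReal.ofReal (b q x) * ENNReal.ofReal (Real.exp (-(ε * (q - r)))) *
        (A q r (x + 1) + A q r (x - 1))) (by
      have hm : Measurable fun p : ℝ × ℝ => ENNReal.ofReal (b p.2 x) := hbm.comp measurable_snd
      exact ((Measurable.mul (by fun_prop) hm).mul (by fun_prop)).mul
        ((hAm (x + 1)).add (hAm (x - 1)))) s
  calc _ = ENNReal.ofReal ε * ∫⁻ r in Set.Iio s,
        (ENNReal.ofReal (Real.exp (ε * r + cumRate b x r)) * F r x +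
        ∫⁻ q in Set.Ioc r s, ENNReal.ofReal (Real.exp (ε * q + cumRate b x q)) *
        ENNReal.ofReal (b q x) * ENNReal.ofReal (Real.exp (-(ε * (q - r)))) *
        (A q r (x + 1) + A q r (x - 1))) := by congr 2; funext r; exact h1 r
    _ = _ := by
        rw [lintegral_add_left hmF, h2, setLIntegral_congr Iio_ae_eq_Iic,
          ← lintegral_add_left hmF, ← lintegral_const_mul' _ _ ENNReal.ofReal_ne_top]
        congr 1; funext q
        rw [dualResolvent, dualResolvent, mul_add, mul_add]
        congr 1
        · ring
        · have hm : Measurable fun r => ENNReal.ofReal (Real.exp (-(ε * (q - r)))) *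
              ∑' y, dualKernel b q (x + 1) r y * F r y :=
            Measurable.mul (by fun_prop) (hAr q (x + 1))
          rw [← mul_add, ← lintegral_add_left hm]
          simp only [mul_assoc]
          rw [lintegral_const_mul' _ _ ENNReal.ofReal_ne_top,
            lintegral_const_mul' _ _ ENNReal.ofReal_ne_top]
          simp only [mul_add, hA]
          ring

theorem measurable_dualResolvent (hb : IsConductance b) (ε : ℝ)
    (hFm : ∀ y, Measurable fun r => F r y) (x : ℤ) :
    Measurable fun s => dualResolvent b ε F s x := by
  unfold dualResolvent
  refine Measurable.const_mul ?_ _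
  have h : ∀ s : ℝ, ∫⁻ r in Set.Iio s, ENNReal.ofReal (Real.exp (-(ε * (s - r)))) *
      ∑' y, dualKernel b s x r y * F r y = ∫⁻ r, {p : ℝ × ℝ | p.2 < p.1}.indicator
        (fun p => ENNReal.ofReal (Real.exp (-(ε * (p.1 - p.2)))) *
      ∑' y, dualKernel b p.1 x p.2 y * F p.2 y) (s, r) := fun s => by
    rw [← lintegral_indicator measurableSet_Iio]; rfl
  simp only [h]
  refine Measurable.lintegral_prod_right' (f := fun p : ℝ × ℝ => _)
    (Measurable.indicator (Measurable.mul (by fun_prop) (Measurable.tsum fun y => ?_))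
      (measurableSet_lt measurable_snd measurable_fst))
  exact (hb.measurable_dualKernel x y measurable_fst measurable_snd).mul
    ((hFm y).comp measurable_snd)

/-- The resolvent solves the resolvent equation. -/
theorem hasWeakDeriv_dualResolvent (hb : IsConductance b) {ε : ℝ} (hε : 0 < ε) {F : ℝ → ℤ → ℝ}
    {N : ℝ} (hFm : ∀ y, Measurable fun r => F r y) (hF0 : ∀ r y, 0 ≤ F r y)
    (hFN : ∀ r y, F r y ≤ N) {U : ℝ → ℤ → ℝ}
    (hU : ∀ s x, U s x = (dualResolvent b ε (fun r y => ENNReal.ofReal (F r y)) s x).toReal)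
    (x : ℤ) : HasWeakDeriv (fun s => U s x) (fun s => ε * F s x - ε * U s x +
      b s x * (U s (x + 1) + U s (x - 1) - 2 * U s x)) := by
  have hle : ∀ s x, dualResolvent b ε (fun r y => ENNReal.ofReal (F r y)) s x ≤
      ENNReal.ofReal N := dualResolvent_le hb hε fun r y => ENNReal.ofReal_le_ofReal (hFN r y)
  have hUof : ∀ s x, dualResolvent b ε (fun r y => ENNReal.ofReal (F r y)) s x =
      ENNReal.ofReal (U s x) := fun s x => by
    rw [hU, ENNReal.ofReal_toReal (ne_top_of_le_ne_top ENNReal.ofReal_ne_top (hle s x))]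
  have hU0 : ∀ s x, 0 ≤ U s x := fun s x => by rw [hU]; exact ENNReal.toReal_nonneg
  have hUm : ∀ x, Measurable fun s => U s x := fun x => by
    simp only [hU]
    exact (measurable_dualResolvent hb ε (fun y => (hFm y).ennreal_ofReal) x).ennreal_toReal
  have hΓ : HasWeakDeriv (fun s => ε * s + cumRate b x s) (fun s => ε + 2 * b s x) := by
    have h1 : HasWeakDeriv (fun s : ℝ => s) (fun _ => 1) :=
      ⟨locallyIntegrable_const 1, fun s t => by simp⟩
    exact ((h1.const_mul ε).add (hb.hasWeakDeriv_cumRate x)).congr_right fun t => by ring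
  set J : ℝ → ℝ := fun q => ε * F q x + b q x * (U q (x + 1) + U q (x - 1)) with hJ
  have hJ0 : ∀ q, 0 ≤ J q := fun q => by
    have := hF0 q x; have := (hb.pos q x).le; have := hU0 q (x + 1); have := hU0 q (x - 1)
    positivity
  have hJm : Measurable J :=
    ((hFm x).const_mul ε).add ((hb.measurable x).mul ((hUm _).add (hUm _)))
  set j : ℝ → ℝ := fun q => Real.exp (ε * q + cumRate b x q) * J q with hj
  have hj0 : ∀ q, 0 ≤ j q := fun q => mul_nonneg (Real.exp_pos _).le (hJ0 q)
  have hjm : Measurable j := by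
    have := (hb.continuous_cumRate x).measurable
    exact Measurable.mul (by fun_prop) hJm
  have hmild : ∀ s, ∫⁻ q in Set.Iic s, ENNReal.ofReal (j q) =
      ENNReal.ofReal (Real.exp (ε * s + cumRate b x s) * U s x) := by
    intro s
    rw [ENNReal.ofReal_mul (Real.exp_pos _).le, ← hUof, dualResolvent_mild hb
      (fun y => (hFm y).ennreal_ofReal) (fun _ _ => ENNReal.ofReal_ne_top)]
    congr 1; funext q
    have := hF0 q x; have := (hb.pos q x).le; have := hU0 q (x + 1); have := hU0 q (x - 1)
    rw [hj, ENNReal.ofReal_mul (Real.exp_pos _).le, hJ, ENNReal.ofReal_add (by positivity)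
      (by positivity), ENNReal.ofReal_mul hε.le, ENNReal.ofReal_mul (hb.pos q x).le,
      ENNReal.ofReal_add (by positivity) (by positivity), hUof, hUof]
  -- Integrability on the whole half-line is read off from the identity in `ℝ≥0∞`, whose other side
  -- is finite.
  have hji : ∀ s, IntegrableOn j (Set.Iic s) := fun s => by
    refine ⟨hjm.aestronglyMeasurable, ?_⟩
    rw [hasFiniteIntegral_iff_ofReal (Eventually.of_forall hj0), hmild]
    exact ENNReal.ofReal_lt_top
  have hG : HasWeakDeriv (fun s => Real.exp (ε * s + cumRate b x s) * U s x) j := by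
    have h1 : ∀ s, Real.exp (ε * s + cumRate b x s) * U s x = ∫ q in Set.Iic s, j q := fun s => by
      rw [integral_eq_lintegral_of_nonneg_ae (Eventually.of_forall hj0)
        hjm.aestronglyMeasurable, hmild, ENNReal.toReal_ofReal]
      exact mul_nonneg (Real.exp_pos _).le (hU0 s x)
    refine ⟨fun s => ⟨Set.Iic (s + 1), Iic_mem_nhds (by linarith), hji _⟩, fun s t => ?_⟩
    simp only [h1]
    exact intervalIntegral.integral_Iic_sub_Iic (hji s) (hji t)
  refine (hΓ.of_mild hG).congr_right fun t => ?_
  simp only [hJ]; ring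

end Resolvent

end DynCond

namespace DynCond

/-! ### The energy estimate -/

/-- The resolvent of the environment seen from the dual walk. -/
noncomputable def envResolvent {Ω : Type*} (b : Ω → ℝ → ℤ → ℝ) (τ : ℝ → ℤ → Ω → Ω) (ε : ℝ)
    (f : Ω → ℝ) (ω : Ω) : ℝ :=
  (dualResolvent (b ω) ε (fun r y => ENNReal.ofReal (f (τ r y ω))) 0 0).toReal

theorem envResolvent_nonneg {Ω : Type*} {b : Ω → ℝ → ℤ → ℝ} {τ : ℝ → ℤ → Ω → Ω} {ε : ℝ}
    {f : Ω → ℝ} (ω : Ω) : 0 ≤ envResolvent b τ ε f ω := ENNReal.toReal_nonneg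

namespace IsErgodicEnvironment

variable {Ω : Type*} [MeasurableSpace Ω] {P : Measure Ω} {b : Ω → ℝ → ℤ → ℝ}
  {τ : ℝ → ℤ → Ω → Ω}

theorem _root_.DynCond.OrbitMeasurable.comp_shift {β : Type*} [MeasurableSpace β] {f : Ω → β}
    (hf : OrbitMeasurable τ f) (henv : IsErgodicEnvironment P b τ) (t : ℝ) (x : ℤ) :
    OrbitMeasurable τ (fun ω => f (τ t x ω)) := by
  intro y
  simp only [henv.shift_add]
  exact hf.comp_measurable _ (by fun_prop) measurable_snd

theorem integral_comp_shift (henv : IsErgodicEnvironment P b τ) {f : Ω → ℝ} (hf : Measurable f)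
    (t : ℝ) (x : ℤ) : ∫ ω, f (τ t x ω) ∂P = ∫ ω, f ω ∂P := by
  have h := (henv.invariant t x)
  conv_rhs => rw [← h.map_eq]
  exact (integral_map h.measurable.aemeasurable hf.aestronglyMeasurable).symm

theorem integrable_comp_shift (henv : IsErgodicEnvironment P b τ) {f : Ω → ℝ}
    (hf : Integrable f P) (t : ℝ) (x : ℤ) : Integrable (fun ω => f (τ t x ω)) P :=
  (henv.invariant t x).integrable_comp_of_integrable hf

/-- Derivatives along the time shift have mean zero. -/
theorem integral_eq_zero_of_hasWeakDeriv [IsFiniteMeasure P]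
    (henv : IsErgodicEnvironment P b τ) {g h : Ω → ℝ}
    (hg : Integrable g P) (hgm : Measurable g) (hh : Integrable h P) (hhm : OrbitMeasurable τ h)
    (hgh : ∀ ω, HasWeakDeriv (fun s => g (τ s 0 ω)) (fun s => h (τ s 0 ω))) :
    ∫ ω, h ω ∂P = 0 := by
  have hhm' := hhm.measurable henv
  have h1 : ∀ ω, g (τ 1 0 ω) - g ω = ∫ s in Set.Ioc (0 : ℝ) 1, h (τ s 0 ω) := by
    intro ω
    have := (hgh ω).2 0 1
    rw [intervalIntegral.integral_of_le zero_le_one] at this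
    simpa only [henv.shift_zero] using this
  -- The increment of `g` over unit time has mean zero by stationarity. By Fubini its mean is also
  -- the integral over `[0, 1]` of the constant `E(h)`.
  have h2 : ∫ ω, (g (τ 1 0 ω) - g ω) ∂P = 0 := by
    rw [integral_sub (henv.integrable_comp_shift hg 1 0) hg, henv.integral_comp_shift hgm, sub_self]
  have hm : Measurable (Function.uncurry fun (ω : Ω) (s : ℝ) => h (τ s 0 ω)) :=
    hhm.comp_measurable 0 measurable_snd measurable_fst
  have h3 : Integrable (Function.uncurry fun (ω : Ω) (s : ℝ) => h (τ s 0 ω))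
      (P.prod (volume.restrict (Set.Ioc (0 : ℝ) 1))) := by
    rw [integrable_prod_iff' hm.aestronglyMeasurable]
    refine ⟨Eventually.of_forall fun s => henv.integrable_comp_shift hh s 0, ?_⟩
    have : ∀ s, ∫ ω, ‖Function.uncurry (fun (ω : Ω) (s : ℝ) => h (τ s 0 ω)) (ω, s)‖ ∂P =
        ∫ ω, ‖h ω‖ ∂P := fun s => henv.integral_comp_shift hhm'.norm s 0
    simp only [this]
    exact integrable_const _
  simp only [h1] at h2
  rw [integral_integral_swap h3] at h2
  simp only [henv.integral_comp_shift hhm'] at h2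
  simpa using h2

section EnvResolvent

variable {ε N : ℝ} {f : Ω → ℝ}

/-- Along the orbit of a fixed `ω`, the resolvent of the environment is a resolvent in one fixed
configuration and therefore satisfies the resolvent equation in time. -/
theorem envResolvent_shift (henv : IsErgodicEnvironment P b τ) (s : ℝ) (x : ℤ) (ω : Ω) :
    envResolvent b τ ε f (τ s x ω) =
      (dualResolvent (b ω) ε (fun r y => ENNReal.ofReal (f (τ r y ω))) s x).toReal := by
  have h := dualResolvent_shift (b ω) ε (fun r y => ENNReal.ofReal (f (τ r y ω))) s x 0 0
  rw [zero_add, zero_add] at h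
  rw [envResolvent, ← h]
  simp only [henv.shift_add]
  congr 2
  funext t y
  exact henv.covariant t y s x ω

theorem envResolvent_le (henv : IsErgodicEnvironment P b τ) (hε : 0 < ε) (hN : 0 ≤ N)
    (hfN : ∀ ω, f ω ≤ N) (ω : Ω) : envResolvent b τ ε f ω ≤ N :=
  ENNReal.toReal_le_of_le_ofReal hN (dualResolvent_le (henv.isConductance ω) hε
    (fun _ _ => ENNReal.ofReal_le_ofReal (hfN _)) 0 0)

theorem orbitMeasurable_envResolvent (henv : IsErgodicEnvironment P b τ)
    (hf : OrbitMeasurable τ f) : OrbitMeasurable τ (envResolvent b τ ε f) := by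
  intro x
  simp only [henv.envResolvent_shift]
  refine Measurable.ennreal_toReal ?_
  unfold dualResolvent
  refine Measurable.const_mul ?_ _
  have h : ∀ q : ℝ × Ω, ∫⁻ r in Set.Iio q.1, ENNReal.ofReal (Real.exp (-(ε * (q.1 - r)))) *
      ∑' y, dualKernel (b q.2) q.1 x r y * ENNReal.ofReal (f (τ r y q.2)) =
      ∫⁻ r, {p : (ℝ × Ω) × ℝ | p.2 < p.1.1}.indicator
        (fun p => ENNReal.ofReal (Real.exp (-(ε * (p.1.1 - p.2)))) *
      ∑' y, dualKernel (b p.1.2) p.1.1 x p.2 y * ENNReal.ofReal (f (τ p.2 y p.1.2))) (q, r) :=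
    fun q => by rw [← lintegral_indicator measurableSet_Iio]; rfl
  simp only [h]
  refine Measurable.lintegral_prod_right' (f := fun p : (ℝ × Ω) × ℝ => _)
    (Measurable.indicator (Measurable.mul (by fun_prop) (Measurable.tsum fun y => ?_))
      (measurableSet_lt measurable_snd measurable_fst.fst))
  exact (henv.isConductanceField.measurable_dualKernel x y measurable_fst.fst measurable_snd
    measurable_fst.snd).mul (hf.comp_measurable y measurable_snd measurable_fst.snd).ennreal_ofReal

theorem hasWeakDeriv_envResolvent (henv : IsErgodicEnvironment P b τ) (hε : 0 < ε)
    (hf : OrbitMeasurable τ f) (hf0 : ∀ ω, 0 ≤ f ω) (hfN : ∀ ω, f ω ≤ N) (x : ℤ) (ω : Ω) :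
    HasWeakDeriv (fun s => envResolvent b τ ε f (τ s x ω))
      (fun s => ε * f (τ s x ω) - ε * envResolvent b τ ε f (τ s x ω) +
        b ω s x * (envResolvent b τ ε f (τ s (x + 1) ω) + envResolvent b τ ε f (τ s (x - 1) ω) -
          2 * envResolvent b τ ε f (τ s x ω))) :=
  hasWeakDeriv_dualResolvent (henv.isConductance ω) hε (F := fun s x => f (τ s x ω))
    (U := fun s x => envResolvent b τ ε f (τ s x ω))
    (fun y => hf.comp_measurable y measurable_id measurable_const)
    (fun _ _ => hf0 _) (fun _ _ => hfN _) (fun s x => henv.envResolvent_shift s x ω) x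

/-- This converts the functional under study into the mean of a solution of the resolvent equation,
to which the energy method applies. -/
theorem lintegral_envResolvent (henv : IsErgodicEnvironment P b τ) [SFinite P] (hε : 0 < ε)
    (hf : OrbitMeasurable τ f) (hfN : ∀ ω, f ω ≤ N) :
    ∫⁻ ω, ENNReal.ofReal (envResolvent b τ ε f ω) ∂P =
      ∫⁻ ω, approxDensity b ε ω * ENNReal.ofReal (f ω) ∂P := by
  have h1 : ∀ ω, ENNReal.ofReal (envResolvent b τ ε f ω) = ENNReal.ofReal ε *
      ∫⁻ t in Set.Ioi (0 : ℝ), ENNReal.ofReal (Real.exp (-(ε * t))) *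
        dualSemigroup b τ t (fun ω => ENNReal.ofReal (f ω)) ω := by
    intro ω
    rw [envResolvent, ENNReal.ofReal_toReal, dualResolvent, ← setLIntegral_Ioi_comp_neg]
    · simp [dualSemigroup]
    · exact ne_top_of_le_ne_top ENNReal.ofReal_ne_top (dualResolvent_le (henv.isConductance ω) hε
        (fun _ _ => ENNReal.ofReal_le_ofReal (hfN _)) 0 0)
  have hm : Measurable fun p : Ω × ℝ => dualSemigroup b τ p.2 (fun ω => ENNReal.ofReal (f ω)) p.1 :=
    Measurable.tsum fun y => (henv.isConductanceField.measurable_dualKernel 0 y measurable_const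
      measurable_snd.neg measurable_fst).mul
        (hf.comp_measurable y measurable_snd.neg measurable_fst).ennreal_ofReal
  rw [henv.lintegral_approxDensity_mul ε (hf.measurable henv).ennreal_ofReal]
  simp only [h1]
  rw [lintegral_const_mul' _ _ ENNReal.ofReal_ne_top, lintegral_lintegral_swap]
  · congr 2; funext t
    rw [lintegral_const_mul' _ _ ENNReal.ofReal_ne_top]
  · exact (Measurable.mul (by fun_prop) hm).aemeasurable

/-- The uniform bound. Stationarity makes the mean time derivatives of `u` and of its squared
gradient vanish; together these say that passing from `f` to `v`, which has the same mean as `u`,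
does not increase the weighted norm. -/
theorem sq_integral_envResolvent_le (henv : IsErgodicEnvironment P b τ) [IsProbabilityMeasure P]
    (hmom : Integrable (fun ω => b ω 0 0) P) (hmom_inv : Integrable (fun ω => (b ω 0 0)⁻¹) P)
    (hε : 0 < ε) (hf : OrbitMeasurable τ f) (hf0 : ∀ ω, 0 ≤ f ω) (hfN : ∀ ω, f ω ≤ N) :
    (∫ ω, envResolvent b τ ε f ω ∂P) ^ 2 ≤
      (∫ ω, b ω 0 0 ∂P) * ∫ ω, (b ω 0 0)⁻¹ * f ω ^ 2 ∂P := by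
  obtain ⟨ω₀⟩ : Nonempty Ω := P.nonempty_of_neZero
  have hN : 0 ≤ N := (hf0 ω₀).trans (hfN ω₀)
  set u := envResolvent b τ ε f with hu
  have hum : OrbitMeasurable τ u := henv.orbitMeasurable_envResolvent hf
  have hu0 : ∀ ω, 0 ≤ u ω := envResolvent_nonneg
  have huN : ∀ ω, u ω ≤ N := henv.envResolvent_le hε hN hfN
  set β : Ω → ℝ := fun ω => b ω 0 0 with hβ
  have hβm : OrbitMeasurable τ β := henv.orbitMeasurable_conductance 0 0
  have hβ0 : ∀ ω, 0 < β ω := fun ω => henv.pos ω 0 0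
  set D : Ω → ℝ := fun ω => u (τ 0 1 ω) - u ω with hD
  set L : Ω → ℝ := fun ω => u (τ 0 1 ω) + u (τ 0 (-1) ω) - 2 * u ω with hL
  set V : Ω → ℝ := fun ω => ε * f ω - ε * u ω + β ω * L ω with hV
  have hDm : OrbitMeasurable τ D := fun x => (hum.comp_shift henv 0 1 x).sub (hum x)
  have hLm : OrbitMeasurable τ L := fun x =>
    ((hum.comp_shift henv 0 1 x).add (hum.comp_shift henv 0 (-1) x)).sub ((hum x).const_mul 2)
  have hVm : OrbitMeasurable τ V := fun x =>
    (((hf x).const_mul ε).sub ((hum x).const_mul ε)).add ((hβm x).mul (hLm x))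
  have hDN : ∀ ω, ‖D ω‖ ≤ N := fun ω => by
    have := hu0 ω; have := huN ω; have := hu0 (τ 0 1 ω); have := huN (τ 0 1 ω)
    rw [Real.norm_eq_abs, abs_le]
    constructor <;> simp only [hD] <;> linarith
  have hLN : ∀ ω, ‖L ω‖ ≤ 2 * N := fun ω => by
    have := hu0 ω; have := huN ω; have := hu0 (τ 0 1 ω); have := huN (τ 0 1 ω)
    have := hu0 (τ 0 (-1) ω); have := huN (τ 0 (-1) ω)
    rw [Real.norm_eq_abs, abs_le]
    constructor <;> simp only [hL] <;> linarith
  have hfB : ∀ ω, ‖f ω‖ ≤ N := fun ω => by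
    rw [Real.norm_eq_abs, abs_of_nonneg (hf0 ω)]; exact hfN ω
  have huB : ∀ ω, ‖u ω‖ ≤ N := fun ω => by
    rw [Real.norm_eq_abs, abs_of_nonneg (hu0 ω)]; exact huN ω
  have mf := hf.measurable henv
  have mu := hum.measurable henv
  have mD := hDm.measurable henv
  have mL := hLm.measurable henv
  have mV := hVm.measurable henv
  have mβ := hβm.measurable henv
  have bdd : ∀ {g h : Ω → ℝ} {C : ℝ}, Integrable h P → Measurable g → (∀ ω, ‖g ω‖ ≤ C) →
      Integrable (fun ω => g ω * h ω) P := fun hh hg hC =>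
    hh.bdd_mul hg.aestronglyMeasurable (Eventually.of_forall hC)
  have i1 : Integrable (fun _ : Ω => (1 : ℝ)) P := integrable_const 1
  have iu : Integrable u P := by simpa using bdd i1 mu huB
  have iF : Integrable f P := by simpa using bdd i1 mf hfB
  have iD : Integrable D P := by simpa using bdd i1 mD hDN
  have iβL : Integrable (fun ω => β ω * L ω) P := by
    simpa only [mul_comm] using bdd hmom mL hLN
  have iV : Integrable V P := ((iF.const_mul ε).sub (iu.const_mul ε)).add iβL
  have hwd : ∀ (x : ℤ) ω, HasWeakDeriv (fun s => u (τ s x ω)) (fun s => V (τ s x ω)) := by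
    intro x ω
    refine (henv.hasWeakDeriv_envResolvent hε hf hf0 hfN x ω).congr_right fun s => ?_
    simp only [hV, hL, hβ, henv.shift_add, henv.covariant]
    simp only [zero_add, add_comm 1 x, neg_add_eq_sub, hu]
  have hEV : ∫ ω, V ω ∂P = 0 :=
    henv.integral_eq_zero_of_hasWeakDeriv iu mu iV hVm (hwd 0)
  have iDV : Integrable (fun ω => D ω * V ω) P := bdd iV mD hDN
  have iDV1 : Integrable (fun ω => D ω * V (τ 0 1 ω)) P :=
    bdd (henv.integrable_comp_shift iV 0 1) mD hDN
  -- The time derivative of `D²` has mean zero, where `D` is the spatial gradient of `u`.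
  have hEDV : ∫ ω, 2 * (D ω * (V (τ 0 1 ω) - V ω)) ∂P = 0 := by
    refine henv.integral_eq_zero_of_hasWeakDeriv (g := fun ω => D ω * D ω)
      (bdd iD mD hDN) (mD.mul mD) ?_ ?_ ?_
    · simp only [mul_sub]
      exact (iDV1.const_mul 2).sub (iDV.const_mul 2)
    · exact fun x => ((hDm x).mul ((hVm.comp_shift henv 0 1 x).sub (hVm x))).const_mul 2
    · intro ω
      have h1 := (hwd 1 ω).sub (hwd 0 ω)
      have h2 : (fun s => u (τ s 1 ω) - u (τ s 0 ω)) = fun s => D (τ s 0 ω) := by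
        funext s; simp only [hD, henv.shift_add, zero_add, add_zero]
      rw [h2] at h1
      refine (h1.mul h1).congr_right fun s => ?_
      simp only [henv.shift_add, zero_add, add_zero]
      ring
  -- Summation by parts: the shift is moved from `g` to the gradient by the invariance of `P`.
  have shiftDV : ∀ {g : Ω → ℝ}, Measurable g →
      ∫ ω, D ω * g (τ 0 1 ω) ∂P = ∫ ω, (u ω - u (τ 0 (-1) ω)) * g ω ∂P := by
    intro g hg
    have hm : Measurable fun ω => (u ω - u (τ 0 (-1) ω)) * g ω :=
      (mu.sub (mu.comp (henv.shift_measurable 0 (-1)))).mul hg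
    rw [← henv.integral_comp_shift hm 0 1]
    congr 1; funext ω
    simp [hD, henv.shift_add, henv.shift_zero]
  have iuV : Integrable (fun ω => (u ω - u (τ 0 (-1) ω)) * V ω) P := by
    refine bdd (C := N) iV (mu.sub (mu.comp (henv.shift_measurable 0 (-1)))) fun ω => ?_
    have := hu0 ω; have := huN ω; have := hu0 (τ 0 (-1) ω); have := huN (τ 0 (-1) ω)
    rw [Real.norm_eq_abs, abs_le]
    constructor <;> linarith
  -- `L` is the forward gradient minus the backward gradient; the latter pairs with `V` as `D` pairs
  -- with the shifted `V`.
  have hELV : ∫ ω, L ω * V ω ∂P = 0 := by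
    have e1 : ∀ ω, L ω * V ω = D ω * V ω - (u ω - u (τ 0 (-1) ω)) * V ω := fun ω => by
      simp only [hL, hD]; ring
    simp only [e1]
    rw [integral_sub iDV iuV, ← shiftDV mV]
    rw [integral_const_mul] at hEDV
    simp only [mul_sub] at hEDV
    rw [integral_sub iDV1 iDV] at hEDV
    linarith
  have iuL : Integrable (fun ω => u ω * L ω) P := by
    simpa only [mul_comm] using bdd iu mL hLN
  have iuD : Integrable (fun ω => D ω * u ω) P := bdd iu mD hDN
  have iuD1 : Integrable (fun ω => D ω * u (τ 0 1 ω)) P :=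
    bdd (henv.integrable_comp_shift iu 0 1) mD hDN
  have iuD' : Integrable (fun ω => (u ω - u (τ 0 (-1) ω)) * u ω) P := by
    simpa only [mul_comm, Pi.sub_apply] using bdd (iu.sub (henv.integrable_comp_shift iu 0 (-1))) mu
      huB
  have hEuL : ∫ ω, u ω * L ω ∂P ≤ 0 := by
    have e1 : ∀ ω, u ω * L ω = D ω * u ω - (u ω - u (τ 0 (-1) ω)) * u ω := fun ω => by
      simp only [hL, hD]; ring
    simp only [e1]
    rw [integral_sub iuD iuD', ← shiftDV mu, ← integral_sub iuD iuD1]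
    refine integral_nonpos fun ω => ?_
    have : D ω * u ω - D ω * u (τ 0 1 ω) = -(D ω) ^ 2 := by simp only [hD]; ring
    simp only [this, Pi.zero_apply]
    nlinarith [sq_nonneg (D ω)]
  have ifL : Integrable (fun ω => f ω * L ω) P := by
    simpa only [mul_comm] using bdd iF mL hLN
  have iβLL : Integrable (fun ω => β ω * L ω ^ 2) P := by
    have h := bdd iβL mL hLN
    refine h.congr (Eventually.of_forall fun ω => ?_)
    dsimp only; ring
  have hEfL : ε * ∫ ω, f ω * L ω ∂P = ε * ∫ ω, u ω * L ω ∂P - ∫ ω, β ω * L ω ^ 2 ∂P := by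
    have e1 : ∀ ω, L ω * V ω = (ε * (f ω * L ω) - ε * (u ω * L ω)) + β ω * L ω ^ 2 := fun ω => by
      simp only [hV]; ring
    simp only [e1] at hELV
    have := integral_add ((ifL.const_mul ε).sub (iuL.const_mul ε)) iβLL
    simp only [Pi.sub_apply] at this
    rw [this, integral_sub (ifL.const_mul ε) (iuL.const_mul ε), integral_const_mul,
      integral_const_mul] at hELV
    linarith
  have iff' : Integrable (fun ω => (β ω)⁻¹ * f ω ^ 2) P := by
    have h := bdd (C := N ^ 2) hmom_inv (mf.pow_const 2) fun ω => by
      rw [norm_pow]; gcongr; exact hfB ω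
    simpa only [mul_comm] using h
  have hEβLL : 0 ≤ ∫ ω, β ω * L ω ^ 2 ∂P :=
    integral_nonneg fun ω => mul_nonneg (hβ0 ω).le (sq_nonneg _)
  -- Since `V = ε (v - u)`, the vanishing mean of `V` gives `u` and `v` the same mean.
  set v : Ω → ℝ := fun ω => f ω + ε⁻¹ * (β ω * L ω) with hv
  have iv : Integrable v P := iF.add (iβL.const_mul _)
  have hEu : ∫ ω, u ω ∂P = ∫ ω, v ω ∂P := by
    have e1 : ∀ ω, V ω = ε * (v ω - u ω) := fun ω => by
      simp only [hV, hv]; field_simp; ring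
    simp only [e1] at hEV
    rw [integral_const_mul, integral_sub iv iu] at hEV
    rcases mul_eq_zero.1 hEV with h | h
    · exact absurd h hε.ne'
    · linarith
  have hvv : ∀ ω, (β ω)⁻¹ * v ω ^ 2 = (β ω)⁻¹ * f ω ^ 2 + (2 * ε⁻¹) * (f ω * L ω) +
      ε⁻¹ ^ 2 * (β ω * L ω ^ 2) := fun ω => by
    have := (hβ0 ω).ne'
    simp only [hv]; field_simp; ring
  have ivv : Integrable (fun ω => (β ω)⁻¹ * v ω ^ 2) P := by
    simp only [hvv]
    exact (iff'.add (ifL.const_mul _)).add (iβLL.const_mul _)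
  have hEvv : ∫ ω, (β ω)⁻¹ * v ω ^ 2 ∂P ≤ ∫ ω, (β ω)⁻¹ * f ω ^ 2 ∂P := by
    simp only [hvv]
    have h1 := integral_add (iff'.add (ifL.const_mul (2 * ε⁻¹))) (iβLL.const_mul (ε⁻¹ ^ 2))
    have h2 := integral_add iff' (ifL.const_mul (2 * ε⁻¹))
    simp only [Pi.add_apply] at h1
    rw [h1, h2, integral_const_mul, integral_const_mul]
    have h3 : ∫ ω, f ω * L ω ∂P = ∫ ω, u ω * L ω ∂P - ε⁻¹ * ∫ ω, β ω * L ω ^ 2 ∂P := by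
      field_simp
      linarith
    rw [h3]
    have hε' : 0 < ε⁻¹ := inv_pos.2 hε
    have h4 : 2 * ε⁻¹ * ∫ ω, u ω * L ω ∂P ≤ 0 :=
      mul_nonpos_of_nonneg_of_nonpos (by positivity) hEuL
    have h5 : 0 ≤ ε⁻¹ ^ 2 * ∫ ω, β ω * L ω ^ 2 ∂P := by positivity
    nlinarith
  have hEβ : 0 < ∫ ω, β ω ∂P := by
    refine (integral_pos_iff_support_of_nonneg (fun ω => (hβ0 ω).le) hmom).2 ?_
    have : Function.support β = Set.univ := Set.eq_univ_of_forall fun ω => (hβ0 ω).ne'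
    rw [this]; simp
  rw [hEu]
  -- Cauchy-Schwarz by hand: this `c` minimizes `E(β⁻¹ (v - c β)²)`, and nonnegativity of the
  -- minimum is the inequality.
  set c : ℝ := (∫ ω, v ω ∂P) / ∫ ω, β ω ∂P with hc
  have hCS : 0 ≤ ∫ ω, ((β ω)⁻¹ * v ω ^ 2 - 2 * c * v ω + c ^ 2 * β ω) ∂P := by
    refine integral_nonneg fun ω => ?_
    have h1 : (β ω)⁻¹ * v ω ^ 2 - 2 * c * v ω + c ^ 2 * β ω = (β ω)⁻¹ * (v ω - c * β ω) ^ 2 := by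
      have := (hβ0 ω).ne'
      field_simp; ring
    have := hβ0 ω
    simp only [h1, Pi.zero_apply]
    positivity
  have h1 := integral_add (ivv.sub (iv.const_mul (2 * c))) (hmom.const_mul (c ^ 2))
  simp only [Pi.sub_apply] at h1
  rw [h1, integral_sub ivv (iv.const_mul (2 * c)), integral_const_mul, integral_const_mul] at hCS
  have h2 : c * ∫ ω, β ω ∂P = ∫ ω, v ω ∂P := by rw [hc]; field_simp
  have h3 : c * ∫ ω, v ω ∂P ≤ ∫ ω, (β ω)⁻¹ * f ω ^ 2 ∂P := by
    have h4 : c ^ 2 * ∫ ω, b ω 0 0 ∂P = c * ∫ ω, v ω ∂P := by rw [← h2]; ring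
    rw [h4] at hCS
    linarith
  calc (∫ ω, v ω ∂P) ^ 2 = (∫ ω, β ω ∂P) * (c * ∫ ω, v ω ∂P) := by rw [← h2]; ring
    _ ≤ _ := by gcongr

end EnvResolvent

end IsErgodicEnvironment

end DynCond

namespace DynCond

/-! ### The weighted Hilbert space -/

/-- Bounded sequences in a Hilbert space have weakly convergent subsequences. -/
theorem exists_subseq_tendsto_inner {H : Type*} [NormedAddCommGroup H] [InnerProductSpace ℝ H]
    [CompleteSpace H] (v : ℕ → H) {C : ℝ} (hC : ∀ k, ‖v k‖ ≤ C) :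
    ∃ (σ : ℕ → ℕ) (ℓ : StrongDual ℝ H), StrictMono σ ∧
      ∀ f : H, Tendsto (fun k => inner ℝ (v (σ k)) f) atTop (𝓝 (ℓ f)) := by
  -- Sequential compactness of balls in the weak-* topology needs separability, which `H` may lack.
  -- The closed span of the sequence is separable, and the pairings with `f` only see the projection
  -- of `f` onto it.
  set K : Submodule ℝ H := (Submodule.span ℝ (Set.range v)).topologicalClosure with hK
  have hsep : TopologicalSpace.IsSeparable (K : Set H) := by
    rw [hK, Submodule.topologicalClosure_coe]
    exact (Set.countable_range v).isSeparable.span.closure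
  have : TopologicalSpace.SeparableSpace K := hsep.separableSpace
  have : CompleteSpace K := (Submodule.isClosed_topologicalClosure _).completeSpace_coe
  have hmem : ∀ k, v k ∈ K := fun k =>
    Submodule.le_topologicalClosure _ (Submodule.subset_span ⟨k, rfl⟩)
  set w : ℕ → K := fun k => ⟨v k, hmem k⟩ with hw
  obtain ⟨ℓ, -, σ, hσ, hlim⟩ := WeakDual.isSeqCompact_closedBall ℝ K 0 C
    (x := fun k => StrongDual.toWeakDual (innerSL ℝ (w k))) (fun k => by
      simp only [Set.mem_preimage, mem_closedBall_zero_iff]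
      exact (innerSL_apply_norm ℝ (w k)).trans_le (hC k))
  refine ⟨σ, (WeakDual.toStrongDual ℓ).comp K.orthogonalProjectionOnto, hσ, fun f => ?_⟩
  have h1 := (WeakDual.eval_continuous (K.orthogonalProjectionOnto f)).continuousAt.tendsto.comp
    hlim
  refine h1.congr fun k => ?_
  have h2 := K.starProjection_inner_eq_zero f (v (σ k)) (hmem _)
  rw [inner_sub_left, sub_eq_zero, real_inner_comm] at h2
  rw [h2, real_inner_comm]
  rfl

namespace IsErgodicEnvironment

variable {Ω : Type*} [MeasurableSpace Ω] {P : Measure Ω} {b : Ω → ℝ → ℤ → ℝ}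
  {τ : ℝ → ℤ → Ω → Ω}

theorem measurable_weight (henv : IsErgodicEnvironment P b τ) :
    Measurable (fun ω => ENNReal.ofReal (b ω 0 0)⁻¹) :=
  (henv.measurable_conductance 0 0).inv.ennreal_ofReal

theorem weightedMeasure_absolutelyContinuous : weightedMeasure P b ≪ P :=
  withDensity_absolutelyContinuous _ _

theorem absolutelyContinuous_weightedMeasure (henv : IsErgodicEnvironment P b τ) :
    P ≪ weightedMeasure P b :=
  withDensity_absolutelyContinuous' henv.measurable_weight.aemeasurable
    (Eventually.of_forall fun ω => (ENNReal.ofReal_pos.2 (inv_pos.2 (henv.pos ω 0 0))).ne')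

theorem isFiniteMeasure_weightedMeasure (hmom_inv : Integrable (fun ω => (b ω 0 0)⁻¹) P) :
    IsFiniteMeasure (weightedMeasure P b) :=
  isFiniteMeasure_withDensity_ofReal hmom_inv.2

theorem integrable_weightedMeasure_iff (henv : IsErgodicEnvironment P b τ) {g : Ω → ℝ} :
    Integrable g (weightedMeasure P b) ↔ Integrable (fun ω => (b ω 0 0)⁻¹ * g ω) P := by
  rw [weightedMeasure, integrable_withDensity_iff_integrable_smul' henv.measurable_weight
    (Eventually.of_forall fun ω => ENNReal.ofReal_lt_top)]
  refine integrable_congr (Eventually.of_forall fun ω => ?_)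
  dsimp only
  rw [ENNReal.toReal_ofReal (inv_pos.2 (henv.pos ω 0 0)).le, smul_eq_mul]

theorem integral_weightedMeasure (henv : IsErgodicEnvironment P b τ) (g : Ω → ℝ) :
    ∫ ω, g ω ∂(weightedMeasure P b) = ∫ ω, (b ω 0 0)⁻¹ * g ω ∂P := by
  rw [weightedMeasure, integral_withDensity_eq_integral_toReal_smul henv.measurable_weight
    (Eventually.of_forall fun ω => ENNReal.ofReal_lt_top)]
  congr 1; funext ω
  rw [ENNReal.toReal_ofReal (inv_pos.2 (henv.pos ω 0 0)).le, smul_eq_mul]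

/-- The inner product of the weighted space, expressed through the measure `P`. -/
theorem inner_weighted (henv : IsErgodicEnvironment P b τ) (g f : WeightedL2 P b) :
    Integrable (fun ω => (b ω 0 0)⁻¹ * g ω * f ω) P ∧
      inner ℝ g f = ∫ ω, (b ω 0 0)⁻¹ * g ω * f ω ∂P := by
  have h1 : ∀ ω, inner ℝ (g ω) (f ω) = g ω * f ω := fun ω => by
    rw [real_inner_eq_re_inner]; simp [mul_comm]
  have h2 := L2.integrable_inner (𝕜 := ℝ) g f
  rw [L2.inner_def]
  simp only [h1] at h2 ⊢
  rw [henv.integrable_weightedMeasure_iff] at h2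
  rw [henv.integral_weightedMeasure]
  simp only [← mul_assoc] at h2 ⊢
  exact ⟨h2, trivial⟩

/-- The inner product with a multiple of the conductance. -/
theorem inner_toLp_mul (henv : IsErgodicEnvironment P b τ) {φ : Ω → ℝ}
    (h : MemLp (fun ω => b ω 0 0 * φ ω) 2 (weightedMeasure P b)) (f : WeightedL2 P b) :
    Integrable (fun ω => φ ω * f ω) P ∧ inner ℝ (h.toLp _) f = ∫ ω, φ ω * f ω ∂P := by
  have h1 := henv.inner_weighted (h.toLp _) f
  have h2 : (fun ω => (b ω 0 0)⁻¹ * h.toLp _ ω * f ω) =ᵐ[P] fun ω => φ ω * f ω := by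
    filter_upwards [henv.absolutelyContinuous_weightedMeasure.ae_le h.coeFn_toLp] with ω hω
    rw [hω, ← mul_assoc, inv_mul_cancel₀ (henv.pos ω 0 0).ne', one_mul]
  rw [integrable_congr h2, integral_congr_ae h2] at h1
  exact h1

theorem memLp_of_memLp_top (hmom_inv : Integrable (fun ω => (b ω 0 0)⁻¹) P) {f : Ω → ℝ}
    (hf : MemLp f ∞ P) : MemLp f 2 (weightedMeasure P b) := by
  have := isFiniteMeasure_weightedMeasure hmom_inv
  refine MemLp.of_bound (hf.1.mono_ac weightedMeasure_absolutelyContinuous)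
    (eLpNorm f ∞ P).toReal ?_
  refine weightedMeasure_absolutelyContinuous.ae_le ?_
  filter_upwards [ae_le_eLpNormEssSup (f := f) (μ := P)] with ω hω
  rw [eLpNorm_exponent_top, ← toReal_enorm]
  exact ENNReal.toReal_mono (by rw [← eLpNorm_exponent_top]; exact hf.2.ne) hω

theorem memLp_mul_of_integrable (henv : IsErgodicEnvironment P b τ) {φ : Ω → ℝ}
    (hφm : Measurable φ) (hφ : Integrable (fun ω => b ω 0 0 * φ ω ^ 2) P) :
    MemLp (fun ω => b ω 0 0 * φ ω) 2 (weightedMeasure P b) := by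
  have hm : Measurable fun ω => b ω 0 0 * φ ω := (henv.measurable_conductance 0 0).mul hφm
  rw [memLp_two_iff_integrable_sq hm.aestronglyMeasurable, henv.integrable_weightedMeasure_iff]
  refine hφ.congr (Eventually.of_forall fun ω => ?_)
  have := (henv.pos ω 0 0).ne'
  dsimp only
  field_simp

theorem norm_toLp_mul_sq (henv : IsErgodicEnvironment P b τ) {φ : Ω → ℝ}
    (h : MemLp (fun ω => b ω 0 0 * φ ω) 2 (weightedMeasure P b)) :
    ‖h.toLp _‖ ^ 2 = ∫ ω, b ω 0 0 * φ ω ^ 2 ∂P := by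
  rw [← real_inner_self_eq_norm_sq, (henv.inner_toLp_mul h _).2]
  refine integral_congr_ae ?_
  filter_upwards [henv.absolutelyContinuous_weightedMeasure.ae_le h.coeFn_toLp] with ω hω
  rw [hω]; ring

/-! ### The bound on the approximate densities -/

/-- Self-improvement: with `f = min(β φ_ε, n)` and `X = E(φ_ε f)`, the uniform bound reads `X² ≤
E(β) E(β⁻¹ f²)`. Since `β⁻¹ f ≤ φ_ε`, the last factor is at most `X`, so `X ≤ E(β)`; then `n → ∞`.
-/
theorem lintegral_mul_approxDensity_sq_le (henv : IsErgodicEnvironment P b τ)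
    [IsProbabilityMeasure P] (hmom : Integrable (fun ω => b ω 0 0) P)
    (hmom_inv : Integrable (fun ω => (b ω 0 0)⁻¹) P) {ε : ℝ} (hε : 0 < ε) :
    ∫⁻ ω, ENNReal.ofReal (b ω 0 0) * approxDensity b ε ω ^ 2 ∂P ≤
      ENNReal.ofReal (∫ ω, b ω 0 0 ∂P) := by
  set φ := approxDensity b ε with hφ
  have hφm : Measurable φ := henv.measurable_approxDensity ε
  have hβm := (henv.measurable_conductance 0 0).ennreal_ofReal
  have hEβ : 0 ≤ ∫ ω, b ω 0 0 ∂P := integral_nonneg fun ω => (henv.pos ω 0 0).le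
  have key : ∀ n : ℕ, ∫⁻ ω, φ ω * min (ENNReal.ofReal (b ω 0 0) * φ ω) n ∂P ≤
      ENNReal.ofReal (∫ ω, b ω 0 0 ∂P) := by
    intro n
    -- The truncation makes `f` bounded, as the energy estimate requires, and `X` finite, so that
    -- one factor `X` can be cancelled.
    set f : Ω → ℝ := fun ω => (min (ENNReal.ofReal (b ω 0 0) * φ ω) n).toReal with hf
    have hfof : ∀ ω, ENNReal.ofReal (f ω) = min (ENNReal.ofReal (b ω 0 0) * φ ω) n := fun ω =>
      ENNReal.ofReal_toReal (ne_top_of_le_ne_top (ENNReal.natCast_ne_top n) (min_le_right _ _))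
    have hfm : OrbitMeasurable τ f := fun x =>
      ((((henv.orbitMeasurable_conductance 0 0 x).ennreal_ofReal).mul
        (henv.orbitMeasurable_approxDensity ε x)).min measurable_const).ennreal_toReal
    have hf0 : ∀ ω, 0 ≤ f ω := fun ω => ENNReal.toReal_nonneg
    have hfN : ∀ ω, f ω ≤ n := fun ω =>
      ENNReal.toReal_le_of_le_ofReal (Nat.cast_nonneg n) (by simp)
    set X := ∫⁻ ω, φ ω * min (ENNReal.ofReal (b ω 0 0) * φ ω) n ∂P with hX
    have hXu : ∫⁻ ω, ENNReal.ofReal (envResolvent b τ ε f ω) ∂P = X := by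
      rw [henv.lintegral_envResolvent hε hfm hfN]
      simp only [hfof, hX, hφ]
    have hum := (henv.orbitMeasurable_envResolvent (ε := ε) hfm).measurable henv
    have hui : Integrable (envResolvent b τ ε f) P :=
      Integrable.of_bound hum.aestronglyMeasurable n (Eventually.of_forall fun ω => by
        rw [Real.norm_eq_abs, abs_of_nonneg (envResolvent_nonneg ω)]
        exact henv.envResolvent_le hε (Nat.cast_nonneg n) hfN ω)
    have hXeq : ENNReal.ofReal (∫ ω, envResolvent b τ ε f ω ∂P) = X := by
      rw [ofReal_integral_eq_lintegral_ofReal hui (Eventually.of_forall envResolvent_nonneg), hXu]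
    have hE0 : 0 ≤ ∫ ω, envResolvent b τ ε f ω ∂P := integral_nonneg envResolvent_nonneg
    have h1 := henv.sq_integral_envResolvent_le hmom hmom_inv hε hfm hf0 hfN
    have hi : Integrable (fun ω => (b ω 0 0)⁻¹ * f ω ^ 2) P := by
      have h := hmom_inv.bdd_mul (c := (n : ℝ) ^ 2)
        ((hfm.measurable henv).pow_const 2).aestronglyMeasurable (Eventually.of_forall fun ω => by
          rw [norm_pow, Real.norm_eq_abs, abs_of_nonneg (hf0 ω)]
          gcongr
          exact hfN ω)
      simpa only [mul_comm] using h
    have h2 : ENNReal.ofReal (∫ ω, (b ω 0 0)⁻¹ * f ω ^ 2 ∂P) ≤ X := by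
      rw [ofReal_integral_eq_lintegral_ofReal hi (Eventually.of_forall fun ω =>
        mul_nonneg (inv_pos.2 (henv.pos ω 0 0)).le (sq_nonneg _)), hX]
      refine lintegral_mono fun ω => ?_
      have hb := henv.pos ω 0 0
      dsimp only
      rw [← hfof, ENNReal.ofReal_mul (inv_pos.2 hb).le, pow_two, ENNReal.ofReal_mul (hf0 ω),
        ← mul_assoc]
      gcongr ?_ * ENNReal.ofReal (f ω)
      calc ENNReal.ofReal (b ω 0 0)⁻¹ * ENNReal.ofReal (f ω)
          ≤ ENNReal.ofReal (b ω 0 0)⁻¹ * (ENNReal.ofReal (b ω 0 0) * φ ω) := by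
            gcongr; rw [hfof]; exact min_le_left _ _
        _ = φ ω := by
            rw [← mul_assoc, ← ENNReal.ofReal_mul (inv_pos.2 hb).le, inv_mul_cancel₀ hb.ne',
              ENNReal.ofReal_one, one_mul]
    rw [← hXeq] at h2 ⊢
    rw [ENNReal.ofReal_le_ofReal_iff hE0] at h2
    refine ENNReal.ofReal_le_ofReal ?_
    rcases hE0.eq_or_lt with h0 | hpos
    · rw [← h0]; exact hEβ
    · have h3 : (∫ ω, envResolvent b τ ε f ω ∂P) * (∫ ω, envResolvent b τ ε f ω ∂P) ≤
          (∫ ω, b ω 0 0 ∂P) * ∫ ω, envResolvent b τ ε f ω ∂P := by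
        rw [← pow_two]
        exact h1.trans (by gcongr)
      exact le_of_mul_le_mul_right h3 hpos
  have hsup : ∀ ω, ENNReal.ofReal (b ω 0 0) * φ ω ^ 2 =
      ⨆ n : ℕ, φ ω * min (ENNReal.ofReal (b ω 0 0) * φ ω) n := by
    intro ω
    rw [← ENNReal.mul_iSup, ← inf_iSup_eq, ENNReal.iSup_natCast, inf_top_eq]
    ring
  simp only [hsup]
  rw [lintegral_iSup]
  · exact iSup_le key
  · exact fun n => hφm.mul ((hβm.mul hφm).min measurable_const)
  · intro m n hmn ω
    dsimp only
    gcongr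

theorem integrable_mul_approxDensity_sq (henv : IsErgodicEnvironment P b τ)
    [IsProbabilityMeasure P] (hmom : Integrable (fun ω => b ω 0 0) P)
    (hmom_inv : Integrable (fun ω => (b ω 0 0)⁻¹) P) {ε : ℝ} (hε : 0 < ε) :
    Integrable (fun ω => b ω 0 0 * (approxDensity b ε ω).toReal ^ 2) P ∧
      ∫ ω, b ω 0 0 * (approxDensity b ε ω).toReal ^ 2 ∂P ≤ ∫ ω, b ω 0 0 ∂P := by
  have h1 := henv.lintegral_mul_approxDensity_sq_le hmom hmom_inv hε
  have hm : Measurable fun ω => b ω 0 0 * (approxDensity b ε ω).toReal ^ 2 :=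
    (henv.measurable_conductance 0 0).mul
      ((henv.measurable_approxDensity ε).ennreal_toReal.pow_const 2)
  have h0 : ∀ ω, 0 ≤ b ω 0 0 * (approxDensity b ε ω).toReal ^ 2 := fun ω =>
    mul_nonneg (henv.pos ω 0 0).le (sq_nonneg _)
  have h2 : ∫⁻ ω, ENNReal.ofReal (b ω 0 0 * (approxDensity b ε ω).toReal ^ 2) ∂P ≤
      ENNReal.ofReal (∫ ω, b ω 0 0 ∂P) := by
    refine le_trans (lintegral_mono fun ω => ?_) h1
    rw [ENNReal.ofReal_mul (henv.pos ω 0 0).le, ENNReal.ofReal_pow ENNReal.toReal_nonneg]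
    gcongr
    exact ENNReal.ofReal_toReal_le
  have h3 : Integrable (fun ω => b ω 0 0 * (approxDensity b ε ω).toReal ^ 2) P := by
    refine ⟨hm.aestronglyMeasurable, ?_⟩
    rw [hasFiniteIntegral_iff_ofReal (Eventually.of_forall h0)]
    exact h2.trans_lt ENNReal.ofReal_lt_top
  refine ⟨h3, ?_⟩
  rw [← ofReal_integral_eq_lintegral_ofReal h3 (Eventually.of_forall h0)] at h2
  exact (ENNReal.ofReal_le_ofReal_iff (integral_nonneg fun ω => (henv.pos ω 0 0).le)).1 h2

theorem memLp_mul_approxDensity (henv : IsErgodicEnvironment P b τ)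
    [IsProbabilityMeasure P] (hmom : Integrable (fun ω => b ω 0 0) P)
    (hmom_inv : Integrable (fun ω => (b ω 0 0)⁻¹) P) {ε : ℝ} (hε : 0 < ε) :
    MemLp (fun ω => b ω 0 0 * (approxDensity b ε ω).toReal) 2 (weightedMeasure P b) :=
  henv.memLp_mul_of_integrable (henv.measurable_approxDensity ε).ennreal_toReal
    (henv.integrable_mul_approxDensity_sq hmom hmom_inv hε).1

end IsErgodicEnvironment

/-! ### Representing vectors of the approximate functionals. -/

open Classical in
/-- The element of the weighted space that represents the functional `f ↦ E (φ_ε f)`. -/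
noncomputable def approxVector {Ω : Type*} [MeasurableSpace Ω] (P : Measure Ω)
    (b : Ω → ℝ → ℤ → ℝ) (ε : ℝ) : WeightedL2 P b :=
  if h : MemLp (fun ω => b ω 0 0 * (approxDensity b ε ω).toReal) 2 (weightedMeasure P b)
    then h.toLp _ else 0

namespace IsErgodicEnvironment

variable {Ω : Type*} [MeasurableSpace Ω] {P : Measure Ω} {b : Ω → ℝ → ℤ → ℝ}
  {τ : ℝ → ℤ → Ω → Ω} [IsProbabilityMeasure P]

theorem approxVector_eq (henv : IsErgodicEnvironment P b τ)
    (hmom : Integrable (fun ω => b ω 0 0) P)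
    (hmom_inv : Integrable (fun ω => (b ω 0 0)⁻¹) P) {ε : ℝ} (hε : 0 < ε) :
    approxVector P b ε = (henv.memLp_mul_approxDensity hmom hmom_inv hε).toLp _ := by
  rw [approxVector, dif_pos]

theorem norm_approxVector_le (henv : IsErgodicEnvironment P b τ)
    (hmom : Integrable (fun ω => b ω 0 0) P)
    (hmom_inv : Integrable (fun ω => (b ω 0 0)⁻¹) P) {ε : ℝ} (hε : 0 < ε) :
    ‖approxVector P b ε‖ ≤ √(∫ ω, b ω 0 0 ∂P) := by
  refine Real.le_sqrt_of_sq_le ?_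
  rw [henv.approxVector_eq hmom hmom_inv hε, henv.norm_toLp_mul_sq]
  exact (henv.integrable_mul_approxDensity_sq hmom hmom_inv hε).2

theorem inner_approxVector (henv : IsErgodicEnvironment P b τ)
    (hmom : Integrable (fun ω => b ω 0 0) P)
    (hmom_inv : Integrable (fun ω => (b ω 0 0)⁻¹) P) {ε : ℝ} (hε : 0 < ε) (f : WeightedL2 P b) :
    Integrable (fun ω => (approxDensity b ε ω).toReal * f ω) P ∧
      inner ℝ (approxVector P b ε) f = ∫ ω, (approxDensity b ε ω).toReal * f ω ∂P := by
  rw [henv.approxVector_eq hmom hmom_inv hε]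
  exact henv.inner_toLp_mul _ f

theorem inner_approxVector_toLp (henv : IsErgodicEnvironment P b τ)
    (hmom : Integrable (fun ω => b ω 0 0) P)
    (hmom_inv : Integrable (fun ω => (b ω 0 0)⁻¹) P) {ε : ℝ} (hε : 0 < ε) {f : Ω → ℝ}
    (hf : MemLp f 2 (weightedMeasure P b)) :
    Integrable (fun ω => (approxDensity b ε ω).toReal * f ω) P ∧
      inner ℝ (approxVector P b ε) (hf.toLp f) = ∫ ω, (approxDensity b ε ω).toReal * f ω ∂P := by
  have h1 := henv.inner_approxVector hmom hmom_inv hε (hf.toLp f)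
  have h2 : (fun ω => (approxDensity b ε ω).toReal * hf.toLp f ω) =ᵐ[P]
      fun ω => (approxDensity b ε ω).toReal * f ω := by
    filter_upwards [henv.absolutelyContinuous_weightedMeasure.ae_le hf.coeFn_toLp] with ω hω
    rw [hω]
  rw [integrable_congr h2, integral_congr_ae h2] at h1
  exact h1

end IsErgodicEnvironment

end DynCond

namespace DynCond

/-! ### Weak limits of the approximate densities -/

namespace IsErgodicEnvironment

variable {Ω : Type*} [MeasurableSpace Ω] {P : Measure Ω} {b : Ω → ℝ → ℤ → ℝ}
  {τ : ℝ → ℤ → Ω → Ω}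

/-- Duality of the transition operator with the evolution of densities. -/
theorem lintegral_mul_dualSemigroup (henv : IsErgodicEnvironment P b τ) (t : ℝ)
    {ψ f : Ω → ℝ≥0∞} (hψ : Measurable ψ) (hf : Measurable f) :
    ∫⁻ ω, ψ ω * dualSemigroup b τ t f ω ∂P =
      ∫⁻ ω, (∑' x, ψ (τ t x ω) * dualKernel (b ω) t x 0 0) * f ω ∂P := by
  simp only [dualSemigroup, ← ENNReal.tsum_mul_left, ← ENNReal.tsum_mul_right]
  have hm1 : ∀ y, Measurable fun ω => ψ ω * (dualKernel (b ω) 0 0 (-t) y * f (τ (-t) y ω)) :=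
    fun y => hψ.mul ((henv.measurable_dualKernel 0 0 (-t) y).mul
      (hf.comp (henv.shift_measurable _ _)))
  have hm2 : ∀ y, Measurable fun ω => ψ (τ t y ω) * dualKernel (b ω) t y 0 0 * f ω := fun y =>
    ((hψ.comp (henv.shift_measurable _ _)).mul (henv.measurable_dualKernel t y 0 0)).mul hf
  rw [lintegral_tsum fun y => (hm1 y).aemeasurable, lintegral_tsum fun y => (hm2 y).aemeasurable,
    ← (Equiv.neg ℤ).tsum_eq]
  congr 1; funext y
  refine ((henv.invariant t y).lintegral_comp (hm1 (-y))).symm.trans ?_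
  congr 1; funext ω
  rw [henv.dualKernel_comp_shift, henv.neg_shift]
  simp [mul_assoc]

/-- Write `m(s)` for the mean of the semigroup at time `s` applied to `F`. Then `E(φ_ε F)` is `ε
∫₀^∞ e^{-εs} m(s) ds`, while the discounted integral of the evolved function is the part over `s >
t`. The difference is the part over `(0, t]`, which is at most `ε t` because `m ≤ 1`. -/
theorem lintegral_approxDensity_dualSemigroup_bounds (henv : IsErgodicEnvironment P b τ)
    [IsProbabilityMeasure P] {ε : ℝ} (hε : 0 < ε) {t : ℝ} (ht : 0 ≤ t) {F : Ω → ℝ≥0∞}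
    (hF : Measurable F) (hF1 : ∀ ω, F ω ≤ 1) :
    ENNReal.ofReal (Real.exp (-(ε * t))) *
        ∫⁻ ω, approxDensity b ε ω * dualSemigroup b τ t F ω ∂P ≤
      ∫⁻ ω, approxDensity b ε ω * F ω ∂P ∧
    ∫⁻ ω, approxDensity b ε ω * F ω ∂P ≤ ENNReal.ofReal (Real.exp (-(ε * t))) *
        ∫⁻ ω, approxDensity b ε ω * dualSemigroup b τ t F ω ∂P + ENNReal.ofReal (ε * t) := by
  set m : ℝ → ℝ≥0∞ := fun s => ∫⁻ ω, dualSemigroup b τ s F ω ∂P with hm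
  have hm1 : ∀ s, 0 ≤ s → m s ≤ 1 := fun s hs => by
    calc m s ≤ ∫⁻ _, 1 ∂P := lintegral_mono fun ω => henv.dualSemigroup_le hs hF1 ω
      _ = 1 := by simp
  have hA := henv.lintegral_approxDensity_mul ε hF
  have hB := henv.lintegral_approxDensity_mul ε (henv.measurable_dualSemigroup t hF)
  have hB1 : ∀ s ∈ Set.Ioi (0 : ℝ), ENNReal.ofReal (Real.exp (-(ε * s))) *
      ∫⁻ ω, dualSemigroup b τ s (dualSemigroup b τ t F) ω ∂P =
      ENNReal.ofReal (Real.exp (-(ε * s))) * m (s + t) := fun s hs => by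
    simp only [henv.dualSemigroup_dualSemigroup (le_of_lt hs) ht, hm]
  rw [setLIntegral_congr_fun measurableSet_Ioi hB1] at hB
  have hshift : ENNReal.ofReal (Real.exp (-(ε * t))) * ∫⁻ s in Set.Ioi (0 : ℝ),
      ENNReal.ofReal (Real.exp (-(ε * s))) * m (s + t) =
      ∫⁻ s in Set.Ioi t, ENNReal.ofReal (Real.exp (-(ε * s))) * m s := by
    rw [← lintegral_const_mul' _ _ ENNReal.ofReal_ne_top, ← lintegral_indicator measurableSet_Ioi,
      ← lintegral_indicator measurableSet_Ioi, ← lintegral_add_right_eq_self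
        ((Set.Ioi t).indicator fun s => ENNReal.ofReal (Real.exp (-(ε * s))) * m s) t]
    congr 1; funext s
    simp only [Set.indicator, Set.mem_Ioi, lt_add_iff_pos_left]
    split_ifs
    · rw [← mul_assoc, ← ENNReal.ofReal_mul (Real.exp_pos _).le, ← Real.exp_add]
      congr 3; ring
    · rfl
  have hsplit : ∫⁻ s in Set.Ioi (0 : ℝ), ENNReal.ofReal (Real.exp (-(ε * s))) * m s =
      (∫⁻ s in Set.Ioc (0 : ℝ) t, ENNReal.ofReal (Real.exp (-(ε * s))) * m s) +
      ∫⁻ s in Set.Ioi t, ENNReal.ofReal (Real.exp (-(ε * s))) * m s := by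
    rw [← Set.Ioc_union_Ioi_eq_Ioi ht, lintegral_union measurableSet_Ioi]
    exact Set.disjoint_left.2 fun s h1 h2 => not_lt.2 h1.2 h2
  have hsmall : ∫⁻ s in Set.Ioc (0 : ℝ) t, ENNReal.ofReal (Real.exp (-(ε * s))) * m s ≤
      ENNReal.ofReal t := by
    calc _ ≤ ∫⁻ s in Set.Ioc (0 : ℝ) t, 1 := by
          refine setLIntegral_mono' measurableSet_Ioc fun s hs => ?_
          refine mul_le_one' ?_ (hm1 s hs.1.le)
          rw [ENNReal.ofReal_le_one, Real.exp_le_one_iff, neg_nonpos]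
          exact mul_nonneg hε.le hs.1.le
      _ = ENNReal.ofReal t := by simp
  rw [hA, hB, mul_left_comm, hshift, hsplit, mul_add, ENNReal.ofReal_mul hε.le]
  refine ⟨le_add_self, ?_⟩
  rw [add_comm]
  gcongr

theorem integral_toReal_mul_toReal (henv : IsErgodicEnvironment P b τ) [IsProbabilityMeasure P]
    {ε : ℝ} (hε : 0 < ε) {F : Ω → ℝ≥0∞} (hF : Measurable F) (hF1 : ∀ ω, F ω ≤ 1) :
    ENNReal.ofReal (∫ ω, (approxDensity b ε ω).toReal * (F ω).toReal ∂P) =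
      ∫⁻ ω, approxDensity b ε ω * F ω ∂P := by
  have hle : ∫⁻ ω, approxDensity b ε ω * F ω ∂P ≤ 1 := by
    rw [← henv.lintegral_approxDensity hε]
    exact lintegral_mono fun ω => mul_le_of_le_one_right' (hF1 ω)
  have hm : Measurable fun ω => approxDensity b ε ω * F ω :=
    (henv.measurable_approxDensity ε).mul hF
  have hne := ne_top_of_le_ne_top ENNReal.one_ne_top hle
  simp only [← ENNReal.toReal_mul]
  rw [integral_toReal hm.aemeasurable (ae_lt_top hm hne), ENNReal.ofReal_toReal hne]

theorem memLp_toReal (hmom_inv : Integrable (fun ω => (b ω 0 0)⁻¹) P) {F : Ω → ℝ≥0∞}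
    (hF : Measurable F) (hF1 : ∀ ω, F ω ≤ 1) :
    MemLp (fun ω => (F ω).toReal) 2 (weightedMeasure P b) := by
  have := isFiniteMeasure_weightedMeasure hmom_inv
  refine MemLp.of_bound hF.ennreal_toReal.aestronglyMeasurable 1 (Eventually.of_forall fun ω => ?_)
  rw [Real.norm_eq_abs, abs_of_nonneg ENNReal.toReal_nonneg]
  exact ENNReal.toReal_le_of_le_ofReal zero_le_one (by simpa using hF1 ω)

theorem inner_toLp_mul_toLp (henv : IsErgodicEnvironment P b τ) {φ f : Ω → ℝ}
    (h : MemLp (fun ω => b ω 0 0 * φ ω) 2 (weightedMeasure P b))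
    (hf : MemLp f 2 (weightedMeasure P b)) :
    Integrable (fun ω => φ ω * f ω) P ∧ inner ℝ (h.toLp _) (hf.toLp f) = ∫ ω, φ ω * f ω ∂P := by
  have h1 := henv.inner_toLp_mul h (hf.toLp f)
  have h2 : (fun ω => φ ω * hf.toLp f ω) =ᵐ[P] fun ω => φ ω * f ω := by
    filter_upwards [henv.absolutelyContinuous_weightedMeasure.ae_le hf.coeFn_toLp] with ω hω
    rw [hω]
  rw [integrable_congr h2, integral_congr_ae h2] at h1
  exact h1

theorem _root_.DynCond.OrbitMeasurable.aestronglyMeasurable {f : Ω → ℝ}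
    (hf : OrbitMeasurable τ f) (μ : Measure Ω) : AEStronglyMeasurable[orbitSigmaAlgebra τ] f μ :=
  ⟨f, (orbitMeasurable_iff.1 hf).stronglyMeasurable, ae_eq_refl f⟩

/-- Weak limits of the approximate densities are represented by nonnegative densities that are
measurable along orbits. -/
theorem exists_density (henv : IsErgodicEnvironment P b τ) [IsProbabilityMeasure P]
    (hmom : Integrable (fun ω => b ω 0 0) P) (hmom_inv : Integrable (fun ω => (b ω 0 0)⁻¹) P)
    {ε : ℕ → ℝ} (hε : ∀ k, 0 < ε k) {ℓ : StrongDual ℝ (WeightedL2 P b)}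
    (hℓ : ∀ f, Tendsto (fun k => inner ℝ (approxVector P b (ε k)) f) atTop (𝓝 (ℓ f))) :
    ∃ φ : Ω → ℝ, OrbitMeasurable τ φ ∧ (∀ ω, 0 ≤ φ ω) ∧
      (Integrable (fun ω => b ω 0 0 * φ ω ^ 2) P ∧
        ∫ ω, b ω 0 0 * φ ω ^ 2 ∂P ≤ ∫ ω, b ω 0 0 ∂P) ∧
      ∃ h : MemLp (fun ω => b ω 0 0 * φ ω) 2 (weightedMeasure P b),
        ∀ f, ℓ f = inner ℝ (h.toLp _) f := by
  set g : WeightedL2 P b := (InnerProductSpace.toDual ℝ (WeightedL2 P b)).symm ℓ with hg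
  have hgℓ : ∀ f, inner ℝ g f = ℓ f := fun f => InnerProductSpace.toDual_symm_apply
  have hm := henv.orbitSigmaAlgebra_le
  have : Fact (orbitSigmaAlgebra τ ≤ ‹MeasurableSpace Ω›) := ⟨hm⟩
  -- The closed subspace of classes with a representative measurable along orbits contains all
  -- approximating vectors.
  set K : Submodule ℝ (WeightedL2 P b) :=
    lpMeas ℝ ℝ (orbitSigmaAlgebra τ) 2 (weightedMeasure P b) with hK
  have hKc : IsComplete (K : Set (WeightedL2 P b)) := by
    have : CompleteSpace K := by rw [hK]; infer_instance
    exact completeSpace_coe_iff_isComplete.1 this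
  have : CompleteSpace K := completeSpace_coe_iff_isComplete.2 hKc
  have hvK : ∀ k, approxVector P b (ε k) ∈ K := by
    intro k
    rw [hK, mem_lpMeas_iff_aestronglyMeasurable, henv.approxVector_eq hmom hmom_inv (hε k)]
    refine AEStronglyMeasurable.congr ?_ (MemLp.coeFn_toLp _).symm
    refine OrbitMeasurable.aestronglyMeasurable (fun x => ?_) _
    exact (henv.orbitMeasurable_conductance 0 0 x).mul
      (henv.orbitMeasurable_approxDensity (ε k) x).ennreal_toReal
  have hgK : g ∈ K := by
    -- A weak limit of vectors of `K` is orthogonal to everything orthogonal to `K`, hence lies in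
    -- `K`.
    rw [← Submodule.orthogonal_orthogonal K, Submodule.mem_orthogonal]
    intro f hf
    rw [real_inner_comm, hgℓ]
    refine tendsto_nhds_unique (hℓ f) ?_
    have h0 : ∀ k, inner ℝ (approxVector P b (ε k)) f = 0 := fun k => hf _ (hvK k)
    simp only [h0]
    exact tendsto_const_nhds
  rw [hK, mem_lpMeas_iff_aestronglyMeasurable] at hgK
  obtain ⟨g', hg'm, hg'⟩ := hgK
  have hg'o : OrbitMeasurable τ g' := orbitMeasurable_iff.2 hg'm.measurable
  set φ₀ : Ω → ℝ := fun ω => (b ω 0 0)⁻¹ * g' ω with hφ₀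
  have hbφ₀ : (fun ω => b ω 0 0 * φ₀ ω) = g' := by
    funext ω
    rw [hφ₀]
    exact mul_inv_cancel_left₀ (henv.pos ω 0 0).ne' _
  have hφ₀o : OrbitMeasurable τ φ₀ := fun x =>
    (henv.orbitMeasurable_conductance 0 0 x).inv.mul (hg'o x)
  have hφ₀L : MemLp (fun ω => b ω 0 0 * φ₀ ω) 2 (weightedMeasure P b) := by
    rw [hbφ₀]; exact (Lp.memLp g).ae_eq hg'
  have hφ₀g : hφ₀L.toLp _ = g := by
    refine Lp.ext (hφ₀L.coeFn_toLp.trans ?_)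
    rw [hbφ₀]; exact hg'.symm
  have hpos : ∀ᵐ ω ∂P, 0 ≤ φ₀ ω := by
    have hi : Integrable φ₀ P := by
      have h1 := memLp_toReal (F := fun _ : Ω => 1) hmom_inv measurable_const fun _ => le_rfl
      simpa using (henv.inner_toLp_mul_toLp hφ₀L h1).1
    refine ae_nonneg_of_forall_setIntegral_nonneg hi fun A hA _ => ?_
    have hAm : Measurable (A.indicator (1 : Ω → ℝ≥0∞)) := measurable_one.indicator hA
    have hA1 : ∀ ω, A.indicator (1 : Ω → ℝ≥0∞) ω ≤ 1 := fun ω =>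
      Set.indicator_le_self' (by simp) ω
    have hAL := memLp_toReal hmom_inv hAm hA1
    have h2 := (henv.inner_toLp_mul_toLp hφ₀L hAL).2
    have h3 : ∀ ω, φ₀ ω * (A.indicator (1 : Ω → ℝ≥0∞) ω).toReal = A.indicator φ₀ ω := fun ω => by
      by_cases h : ω ∈ A <;> simp [h]
    simp only [h3] at h2
    rw [integral_indicator hA, hφ₀g, hgℓ] at h2
    rw [← h2]
    refine ge_of_tendsto' (hℓ _) fun k => ?_
    rw [(henv.inner_approxVector_toLp hmom hmom_inv (hε k) hAL).2]
    exact integral_nonneg fun ω => mul_nonneg ENNReal.toReal_nonneg ENNReal.toReal_nonneg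
  -- The positive part is nonnegative everywhere, including along every orbit, so that
  -- `ENNReal.ofReal` loses nothing later.
  set φ : Ω → ℝ := fun ω => max (φ₀ ω) 0 with hφ
  have hφφ₀ : φ =ᵐ[P] φ₀ := by
    filter_upwards [hpos] with ω hω using max_eq_left hω
  have hφae : (fun ω => b ω 0 0 * φ ω) =ᵐ[weightedMeasure P b] fun ω => b ω 0 0 * φ₀ ω :=
    weightedMeasure_absolutelyContinuous.ae_le (by
      filter_upwards [hφφ₀] with ω hω
      rw [hω])
  have hφL : MemLp (fun ω => b ω 0 0 * φ ω) 2 (weightedMeasure P b) := hφ₀L.ae_eq hφae.symm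
  have hφg : hφL.toLp _ = g := by
    rw [← hφ₀g]; exact (MemLp.toLp_eq_toLp_iff _ _).2 hφae
  have hφo : OrbitMeasurable τ φ := fun x => (hφ₀o x).max measurable_const
  -- Weak lower semicontinuity of the norm, by testing the convergence with `g` itself.
  have hgnorm : ‖g‖ ≤ √(∫ ω, b ω 0 0 ∂P) := by
    have h1 := hℓ g
    rw [← hgℓ g, real_inner_self_eq_norm_sq] at h1
    have h2 : ‖g‖ ^ 2 ≤ √(∫ ω, b ω 0 0 ∂P) * ‖g‖ := by
      refine le_of_tendsto' h1 fun k => ?_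
      refine (real_inner_le_norm _ _).trans ?_
      gcongr
      exact henv.norm_approxVector_le hmom hmom_inv (hε k)
    rcases (norm_nonneg g).eq_or_lt with h0 | h0
    · rw [← h0]; exact Real.sqrt_nonneg _
    · rw [pow_two] at h2; exact le_of_mul_le_mul_right h2 h0
  have hsq := henv.norm_toLp_mul_sq hφL
  rw [hφg] at hsq
  refine ⟨φ, hφo, fun ω => le_max_right _ _, ⟨?_, ?_⟩, hφL, fun f => ?_⟩
  · have h1 := (memLp_two_iff_integrable_sq hφL.1).1 hφL
    rw [henv.integrable_weightedMeasure_iff] at h1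
    refine h1.congr (Eventually.of_forall fun ω => ?_)
    have := (henv.pos ω 0 0).ne'
    dsimp only
    field_simp
  · rw [← hsq]
    calc ‖g‖ ^ 2 ≤ √(∫ ω, b ω 0 0 ∂P) ^ 2 := by gcongr
      _ = _ := Real.sq_sqrt (integral_nonneg fun ω => (henv.pos ω 0 0).le)
  · rw [hφg, hgℓ]

section Limit

variable [IsProbabilityMeasure P] {ε : ℕ → ℝ} {ℓ : StrongDual ℝ (WeightedL2 P b)} {φ : Ω → ℝ}

theorem tendsto_lintegral_approxDensity (henv : IsErgodicEnvironment P b τ)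
    (hmom : Integrable (fun ω => b ω 0 0) P) (hmom_inv : Integrable (fun ω => (b ω 0 0)⁻¹) P)
    (hε : ∀ k, 0 < ε k)
    (hℓ : ∀ f, Tendsto (fun k => inner ℝ (approxVector P b (ε k)) f) atTop (𝓝 (ℓ f)))
    (hφ0 : ∀ ω, 0 ≤ φ ω) (hφL : MemLp (fun ω => b ω 0 0 * φ ω) 2 (weightedMeasure P b))
    (hφℓ : ∀ f, ℓ f = inner ℝ (hφL.toLp _) f) {F : Ω → ℝ≥0∞} (hF : Measurable F)
    (hF1 : ∀ ω, F ω ≤ 1) :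
    Tendsto (fun k => ∫⁻ ω, approxDensity b (ε k) ω * F ω ∂P) atTop
      (𝓝 (∫⁻ ω, ENNReal.ofReal (φ ω) * F ω ∂P)) := by
  have hFL := memLp_toReal hmom_inv hF hF1
  have h1 := hℓ (hFL.toLp _)
  have h2 := henv.inner_toLp_mul_toLp hφL hFL
  rw [hφℓ, h2.2] at h1
  have h3 := ENNReal.tendsto_ofReal h1
  rw [ofReal_integral_eq_lintegral_ofReal h2.1 (Eventually.of_forall fun ω =>
    mul_nonneg (hφ0 ω) ENNReal.toReal_nonneg)] at h3
  have h4 : ∀ ω, ENNReal.ofReal (φ ω * (F ω).toReal) = ENNReal.ofReal (φ ω) * F ω := fun ω => by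
    rw [ENNReal.ofReal_mul (hφ0 ω),
      ENNReal.ofReal_toReal (ne_top_of_le_ne_top ENNReal.one_ne_top (hF1 ω))]
  simp only [h4] at h3
  refine h3.congr fun k => ?_
  rw [(henv.inner_approxVector_toLp hmom hmom_inv (hε k) hFL).2,
    henv.integral_toReal_mul_toReal (hε k) hF hF1]

theorem lintegral_density (henv : IsErgodicEnvironment P b τ)
    (hmom : Integrable (fun ω => b ω 0 0) P) (hmom_inv : Integrable (fun ω => (b ω 0 0)⁻¹) P)
    (hε : ∀ k, 0 < ε k)
    (hℓ : ∀ f, Tendsto (fun k => inner ℝ (approxVector P b (ε k)) f) atTop (𝓝 (ℓ f)))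
    (hφ0 : ∀ ω, 0 ≤ φ ω) (hφL : MemLp (fun ω => b ω 0 0 * φ ω) 2 (weightedMeasure P b))
    (hφℓ : ∀ f, ℓ f = inner ℝ (hφL.toLp _) f) : ∫⁻ ω, ENNReal.ofReal (φ ω) ∂P = 1 := by
  have h := henv.tendsto_lintegral_approxDensity hmom hmom_inv hε hℓ hφ0 hφL hφℓ
    (F := fun _ => 1) measurable_const fun _ => le_rfl
  simp only [mul_one, fun k => henv.lintegral_approxDensity (hε k)] at h
  exact tendsto_nhds_unique h tendsto_const_nhds

theorem lintegral_density_mul_dualSemigroup (henv : IsErgodicEnvironment P b τ)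
    (hmom : Integrable (fun ω => b ω 0 0) P) (hmom_inv : Integrable (fun ω => (b ω 0 0)⁻¹) P)
    (hε : ∀ k, 0 < ε k) (hε0 : Tendsto ε atTop (𝓝 0))
    (hℓ : ∀ f, Tendsto (fun k => inner ℝ (approxVector P b (ε k)) f) atTop (𝓝 (ℓ f)))
    (hφ0 : ∀ ω, 0 ≤ φ ω) (hφL : MemLp (fun ω => b ω 0 0 * φ ω) 2 (weightedMeasure P b))
    (hφℓ : ∀ f, ℓ f = inner ℝ (hφL.toLp _) f) {F : Ω → ℝ≥0∞} (hF : Measurable F)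
    (hF1 : ∀ ω, F ω ≤ 1) {t : ℝ} (ht : 0 ≤ t) :
    ∫⁻ ω, ENNReal.ofReal (φ ω) * dualSemigroup b τ t F ω ∂P =
      ∫⁻ ω, ENNReal.ofReal (φ ω) * F ω ∂P := by
  have hA := henv.tendsto_lintegral_approxDensity hmom hmom_inv hε hℓ hφ0 hφL hφℓ hF hF1
  have hB := henv.tendsto_lintegral_approxDensity hmom hmom_inv hε hℓ hφ0 hφL hφℓ
    (henv.measurable_dualSemigroup t hF) (henv.dualSemigroup_le ht hF1)
  have he : Tendsto (fun k => ENNReal.ofReal (Real.exp (-(ε k * t)))) atTop (𝓝 1) := by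
    rw [← ENNReal.ofReal_one, ← Real.exp_zero]
    refine ENNReal.tendsto_ofReal ((Real.continuous_exp.tendsto 0).comp ?_)
    simpa using (hε0.mul_const t).neg
  have hs : Tendsto (fun k => ENNReal.ofReal (ε k * t)) atTop (𝓝 0) := by
    rw [← ENNReal.ofReal_zero]
    refine ENNReal.tendsto_ofReal ?_
    simpa using hε0.mul_const t
  have heB := ENNReal.Tendsto.mul he (Or.inl one_ne_zero) hB (Or.inr ENNReal.one_ne_top)
  rw [one_mul] at heB
  -- As `ε k → 0` the discount tends to `1` and the error `ε k * t` to `0`, so the two bounds become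
  -- opposite inequalities.
  have hbd := fun k => henv.lintegral_approxDensity_dualSemigroup_bounds (hε k) ht hF hF1
  refine le_antisymm (le_of_tendsto_of_tendsto' heB hA fun k => (hbd k).1) ?_
  have h1 := le_of_tendsto_of_tendsto' hA (heB.add hs) fun k => (hbd k).2
  rwa [add_zero] at h1

end Limit

/-- A density that is invariant in the integrated sense is invariant almost surely. -/
theorem density_eq_tsum (henv : IsErgodicEnvironment P b τ) [IsProbabilityMeasure P]
    {ψ : Ω → ℝ≥0∞} (hψ : Measurable ψ) {t : ℝ}
    (hinv : ∀ A : Set Ω, MeasurableSet A →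
      ∫⁻ ω, ψ ω * dualSemigroup b τ t (A.indicator 1) ω ∂P = ∫⁻ ω, ψ ω * A.indicator 1 ω ∂P) :
    ∀ᵐ ω ∂P, ψ ω = ∑' x, ψ (τ t x ω) * dualKernel (b ω) t x 0 0 := by
  have hm : Measurable fun ω => ∑' x, ψ (τ t x ω) * dualKernel (b ω) t x 0 0 :=
    Measurable.tsum fun x => (hψ.comp (henv.shift_measurable t x)).mul
      (henv.measurable_dualKernel t x 0 0)
  refine ae_eq_of_forall_setLIntegral_eq_of_sigmaFinite hψ hm fun A hA _ => ?_
  have h1 := hinv A hA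
  rw [henv.lintegral_mul_dualSemigroup t hψ (measurable_one.indicator hA)] at h1
  have h2 : ∀ (f : Ω → ℝ≥0∞) ω, f ω * A.indicator 1 ω = A.indicator f ω := fun f ω => by
    by_cases h : ω ∈ A <;> simp [h]
  rw [← lintegral_indicator hA, ← lintegral_indicator hA]
  simp only [h2] at h1
  rw [← h1]
  congr 1; funext ω
  exact h2 (fun ω => ∑' x, ψ (τ t x ω) * dualKernel (b ω) t x 0 0) ω

/-- An invariant density is almost surely positive. -/
theorem density_pos (henv : IsErgodicEnvironment P b τ) [IsProbabilityMeasure P]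
    {ψ : Ω → ℝ≥0∞} (hψ : Measurable ψ) (hψ1 : ∫⁻ ω, ψ ω ∂P ≠ 0)
    (h : ∀ t : ℝ, 0 < t → ∀ᵐ ω ∂P, ψ ω = ∑' x, ψ (τ t x ω) * dualKernel (b ω) t x 0 0) :
    ∀ᵐ ω ∂P, 0 < ψ ω := by
  have hA : MeasurableSet {ω | ψ ω = 0} := hψ (measurableSet_singleton 0)
  -- If the sum of nonnegative terms vanishes at `ω`, then by positivity of the kernel `ψ` vanishes
  -- at every `τ t x ω`. Full measure of the zero set would contradict the nonzero integral.
  rcases henv.measure_eq_zero_or_one_of_forward hA (fun t ht x => by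
    filter_upwards [h t ht] with ω hω h0
    have h0' : ψ ω = 0 := h0
    rw [h0'] at hω
    have h1 := ENNReal.tsum_eq_zero.1 hω.symm x
    exact (mul_eq_zero.1 h1).resolve_right (dualKernel_pos (henv.isConductance ω) ht x 0).ne')
    with h0 | h1
  · have h2 : ∀ᵐ ω ∂P, ¬ ψ ω = 0 := by rw [ae_iff]; simpa using h0
    filter_upwards [h2] with ω hω using pos_iff_ne_zero.2 hω
  · exfalso
    apply hψ1
    rw [lintegral_eq_zero_iff hψ]
    exact (prob_compl_eq_zero_iff hA).2 h1

/-- The environment seen from the dual walk is ergodic under measures equivalent to `P`. -/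
theorem isErgodicForDual (henv : IsErgodicEnvironment P b τ) [IsProbabilityMeasure P]
    {Q : Measure Ω} [IsProbabilityMeasure Q] (hQP : Q ≪ P) (hPQ : P ≪ Q) :
    IsErgodicForDual b τ Q := by
  intro A hA h
  have hsub : ∀ t, 0 < t → ∀ x, A ≤ᵐ[P] τ (-t) x ⁻¹' A := by
    intro t ht x
    filter_upwards [hPQ.ae_le (h t ht)] with ω hω hωA
    by_contra hx
    have h1 := hω hωA
    have hb := henv.isConductance ω
    have h2 := tsum_dualKernel_eq_one hb (neg_nonpos.2 ht.le) 0
    -- Every site is charged, so a single site leading outside `A` makes the probability of ending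
    -- in `A` strictly less than `1`.
    have hlt : envTransition b τ t ω A < ∑' y, dualKernel (b ω) 0 0 (-t) y := by
      refine ENNReal.tsum_lt_tsum (i := x) ?_ ?_ ?_
      · rw [envTransition] at h1; rw [h1]; exact ENNReal.one_ne_top
      · intro y
        exact mul_le_of_le_one_right' (Set.indicator_le_self' (by simp) _)
      · have hx' : τ (-t) x ω ∉ A := hx
        rw [Set.indicator_of_notMem hx', mul_zero]
        exact dualKernel_pos hb (neg_neg_of_pos ht) 0 x
    rw [h1, h2] at hlt
    exact lt_irrefl _ hlt
  rcases henv.measure_eq_zero_or_one_of_backward hA hsub with h0 | h1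
  · exact Or.inl (hQP h0)
  · exact Or.inr ((prob_compl_eq_zero_iff hA).1 (hQP ((prob_compl_eq_zero_iff hA).2 h1)))

end IsErgodicEnvironment

end DynCond

namespace DynCond

/-! ### Solutions of the forward equation -/

/-- The evolution down to time `s` of the mass distribution `ρ` at time `t`. -/
noncomputable def forwardEvolution (b : ℝ → ℤ → ℝ) (t : ℝ) (ρ : ℤ → ℝ≥0∞) (s : ℝ) (x : ℤ) :
    ℝ≥0∞ :=
  ∑' y, ρ y * dualKernel b t y s x

section ForwardEvolution

variable {b : ℝ → ℤ → ℝ}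

theorem measurable_forwardEvolution (hb : IsConductance b) (t : ℝ) (ρ : ℤ → ℝ≥0∞) (x : ℤ) :
    Measurable fun s => forwardEvolution b t ρ s x :=
  Measurable.tsum fun y => (hb.measurable_dualKernel y x measurable_const measurable_id).const_mul _

theorem forwardEvolution_forwardEvolution (hb : IsConductance b) {s r t : ℝ} (hsr : s ≤ r)
    (hrt : r ≤ t) (ρ : ℤ → ℝ≥0∞) (x : ℤ) :
    forwardEvolution b r (forwardEvolution b t ρ r) s x = forwardEvolution b t ρ s x := by
  simp only [forwardEvolution, ← ENNReal.tsum_mul_right]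
  rw [ENNReal.tsum_comm]
  congr 1; funext z
  simp only [mul_assoc]
  rw [ENNReal.tsum_mul_left, tsum_dualKernel_mul hb hsr hrt]

theorem forwardEvolution_mild (hb : IsConductance b) (t : ℝ) (ρ : ℤ → ℝ≥0∞) (s : ℝ) (x : ℤ) :
    forwardEvolution b t ρ s x = ρ x * stayProb b x s t + ∫⁻ q in Set.Ioc s t,
      (forwardEvolution b t ρ q (x + 1) * ENNReal.ofReal (b q (x + 1)) +
        forwardEvolution b t ρ q (x - 1) * ENNReal.ofReal (b q (x - 1))) * stayProb b x s q := by
  have hbm : ∀ z, Measurable fun q => ENNReal.ofReal (b q z) := fun z =>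
    (hb.measurable z).ennreal_ofReal
  have hst : Measurable fun q => stayProb b x s q :=
    hb.measurable_stayProb x measurable_const measurable_id
  have hk : ∀ y z, Measurable fun q => dualKernel b t y q z := fun y z =>
    hb.measurable_dualKernel y z measurable_const measurable_id
  have hm : ∀ y, Measurable fun q => (dualKernel b t y q (x + 1) * ENNReal.ofReal (b q (x + 1)) +
        dualKernel b t y q (x - 1) * ENNReal.ofReal (b q (x - 1))) * stayProb b x s q := fun y =>
    (((hk _ _).mul (hbm _)).add ((hk _ _).mul (hbm _))).mul hst
  have h : ∀ y, dualKernel b t y s x = _ := fun y => dualKernel_forward hb t y s x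
  calc forwardEvolution b t ρ s x = ∑' y, (ρ y * (if y = x then stayProb b x s t else 0) +
        ∫⁻ q in Set.Ioc s t, ρ y * ((dualKernel b t y q (x + 1) * ENNReal.ofReal (b q (x + 1)) +
        dualKernel b t y q (x - 1) * ENNReal.ofReal (b q (x - 1))) * stayProb b x s q)) := by
        rw [forwardEvolution]
        congr 1; funext y
        rw [h y, mul_add, lintegral_const_mul _ (hm y)]
    _ = _ := by
        rw [ENNReal.tsum_add, tsum_eq_single x (fun y hy => by rw [if_neg hy, mul_zero]),
          if_pos rfl, ← lintegral_tsum fun y => ((hm y).const_mul (ρ y)).aemeasurable]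
        congr 2; funext q
        simp only [forwardEvolution, ← ENNReal.tsum_mul_right]
        rw [← ENNReal.tsum_add, ← ENNReal.tsum_mul_right]
        congr 1; funext y
        ring

/-- A finite forward evolution stays finite. -/
theorem forwardEvolution_lt_top (hb : IsConductance b) {t r s : ℝ} (hrs : r ≤ s)
    {ρ : ℤ → ℝ≥0∞} {x : ℤ} (h : forwardEvolution b t ρ r x < ∞) :
    forwardEvolution b t ρ s x < ∞ := by
  -- In the mild equation at `r`, arrivals at `x` in `(r, s]` are dropped; the remaining mass at `x`
  -- at time `s` only has to stay there down to `r`.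
  have hle : stayProb b x r s * forwardEvolution b t ρ s x ≤ forwardEvolution b t ρ r x := by
    rw [forwardEvolution_mild hb t ρ s, forwardEvolution_mild hb t ρ r, mul_add,
      ← lintegral_const_mul' _ _ (IsConductance.stayProb_ne_top x r s)]
    refine add_le_add ?_ ?_
    · rw [mul_left_comm, mul_comm (stayProb b x r s), hb.stayProb_mul]
    · refine le_trans (lintegral_mono fun q => ?_) (lintegral_mono_set
        (Set.Ioc_subset_Ioc_left hrs))
      rw [mul_left_comm, mul_comm (stayProb b x r s), hb.stayProb_mul]
  refine lt_top_iff_ne_top.2 fun htop => ?_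
  rw [htop, ENNReal.mul_top (IsConductance.stayProb_pos x r s).ne'] at hle
  exact absurd h (not_lt.2 hle)

/-- A consistent family of finite mass distributions at the nonnegative integer times is
interpolated by a solution of the forward equation. -/
theorem exists_forward_solution (hb : IsConductance b) {ρ : ℕ → ℤ → ℝ≥0∞}
    (hρ : ∀ (n : ℕ) y, ρ n y = forwardEvolution b ((n + 1 : ℕ) : ℝ) (ρ (n + 1)) n y)
    (hfin : ∀ (n m : ℕ) x, forwardEvolution b n (ρ n) (-(m : ℝ)) x < ∞) :
    ∃ H : ℝ → ℤ → ℝ, (∀ s x, 0 ≤ H s x) ∧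
      (∀ n : ℕ, ∀ s : ℝ, s ≤ n → ∀ x, ENNReal.ofReal (H s x) = forwardEvolution b n (ρ n) s x) ∧
      ∀ x, HasWeakDeriv (fun s => H s x) (fun s =>
        -(b s (x + 1) * H s (x + 1) + b s (x - 1) * H s (x - 1) - 2 * b s x * H s x)) := by
  have hcons1 : ∀ (n : ℕ) (s : ℝ), s ≤ n → ∀ x, forwardEvolution b (n + 1 : ℕ) (ρ (n + 1)) s x =
      forwardEvolution b n (ρ n) s x := by
    intro n s hs x
    rw [← forwardEvolution_forwardEvolution hb hs (by push_cast; linarith) (ρ (n + 1)) x]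
    congr 1; funext y
    exact (hρ n y).symm
  have hcons : ∀ (n k : ℕ) (s : ℝ), s ≤ n → ∀ x, forwardEvolution b (n + k : ℕ) (ρ (n + k)) s x =
      forwardEvolution b n (ρ n) s x := by
    intro n k s hs x
    induction k with
    | zero => rfl
    | succ k ih =>
      rw [← ih]
      exact hcons1 (n + k) s (by push_cast; linarith [Nat.cast_nonneg (α := ℝ) k]) x
  have hcons' : ∀ (n m : ℕ) (s : ℝ), s ≤ n → s ≤ m → ∀ x, forwardEvolution b n (ρ n) s x =
      forwardEvolution b m (ρ m) s x := by
    intro n m s hn hm x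
    rcases le_total n m with h | h
    · obtain ⟨k, rfl⟩ := Nat.exists_eq_add_of_le h
      exact (hcons n k s hn x).symm
    · obtain ⟨k, rfl⟩ := Nat.exists_eq_add_of_le h
      exact hcons m k s hm x
  have hlt : ∀ (n : ℕ) (s : ℝ), s ≤ n → ∀ x, forwardEvolution b n (ρ n) s x < ∞ := by
    intro n s _ x
    obtain ⟨m, hm⟩ := exists_nat_ge (-s)
    exact forwardEvolution_lt_top hb (by linarith) (hfin n m x)
  -- By consistency every integer `n ≥ s` gives the same value. The ceiling is a measurable choice,
  -- equal to `0` for negative `s`.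
  set H : ℝ → ℤ → ℝ := fun s x => (forwardEvolution b (⌈s⌉₊ : ℕ) (ρ ⌈s⌉₊) s x).toReal with hH
  have hH0 : ∀ s x, 0 ≤ H s x := fun s x => ENNReal.toReal_nonneg
  have hHof : ∀ n : ℕ, ∀ s : ℝ, s ≤ n → ∀ x,
      ENNReal.ofReal (H s x) = forwardEvolution b n (ρ n) s x := by
    intro n s hs x
    rw [hH, ENNReal.ofReal_toReal (hlt _ s (Nat.le_ceil s) x).ne]
    exact hcons' _ _ s (Nat.le_ceil s) hs x
  have hHm : ∀ x, Measurable fun s => H s x := by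
    intro x
    have h1 : Measurable fun p : ℕ × ℝ => (forwardEvolution b p.1 (ρ p.1) p.2 x).toReal :=
      measurable_from_prod_countable_right fun n =>
        (measurable_forwardEvolution hb n (ρ n) x).ennreal_toReal
    exact h1.comp ((Nat.measurable_ceil).prodMk measurable_id)
  refine ⟨H, hH0, hHof, fun x => ?_⟩
  set J : ℝ → ℝ := fun q => H q (x + 1) * b q (x + 1) + H q (x - 1) * b q (x - 1) with hJ
  have hJ0 : ∀ q, 0 ≤ J q := fun q =>
    add_nonneg (mul_nonneg (hH0 _ _) (hb.pos _ _).le) (mul_nonneg (hH0 _ _) (hb.pos _ _).le)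
  have hJm : Measurable J :=
    ((hHm _).mul (hb.measurable _)).add ((hHm _).mul (hb.measurable _))
  set j : ℝ → ℝ := fun q => Real.exp (-cumRate b x q) * J q with hj
  have hj0 : ∀ q, 0 ≤ j q := fun q => mul_nonneg (Real.exp_pos _).le (hJ0 q)
  have hjm : Measurable j := (hb.continuous_cumRate x).measurable.neg.exp.mul hJm
  -- Time runs downwards in the forward equation, so the integrating factor is `exp(-C)` for `C =
  -- cumRate b x`, and the source enters with a minus sign in the time derivative.
  have hmild : ∀ (n : ℕ) (s : ℝ), s ≤ n → ENNReal.ofReal (Real.exp (-cumRate b x s) * H s x) =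
      ρ n x * ENNReal.ofReal (Real.exp (-cumRate b x n)) +
        ∫⁻ q in Set.Ioc s n, ENNReal.ofReal (j q) := by
    intro n s hs
    have hstay : ∀ q, ENNReal.ofReal (Real.exp (-cumRate b x s)) * stayProb b x s q =
        ENNReal.ofReal (Real.exp (-cumRate b x q)) := fun q => by
      rw [hb.stayProb_eq, ← ENNReal.ofReal_mul (Real.exp_pos _).le, ← Real.exp_add]
      congr 2; ring
    rw [ENNReal.ofReal_mul (Real.exp_pos _).le, hHof n s hs, forwardEvolution_mild hb, mul_add,
      mul_left_comm, hstay, ← lintegral_const_mul' _ _ ENNReal.ofReal_ne_top]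
    congr 1
    refine setLIntegral_congr_fun measurableSet_Ioc fun q hq => ?_
    rw [mul_left_comm, hstay, ← hHof n q hq.2, ← hHof n q hq.2, mul_comm, hj,
      ENNReal.ofReal_mul (Real.exp_pos _).le, hJ,
      ENNReal.ofReal_add (mul_nonneg (hH0 _ _) (hb.pos _ _).le)
        (mul_nonneg (hH0 _ _) (hb.pos _ _).le), ENNReal.ofReal_mul (hH0 _ _),
      ENNReal.ofReal_mul (hH0 _ _)]
  have hji : ∀ (n : ℕ) (s : ℝ), s ≤ n → IntegrableOn j (Set.Ioc s n) := fun n s hs => by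
    refine ⟨hjm.aestronglyMeasurable, ?_⟩
    rw [hasFiniteIntegral_iff_ofReal (Eventually.of_forall hj0)]
    refine lt_of_le_of_lt ?_ (ENNReal.ofReal_lt_top (r := Real.exp (-cumRate b x s) * H s x))
    rw [hmild n s hs]
    exact le_add_self
  have hρ' : ∀ n : ℕ, ρ n x * ENNReal.ofReal (Real.exp (-cumRate b x n)) ≠ ∞ := fun n => by
    refine ne_top_of_le_ne_top (ENNReal.ofReal_ne_top (r := Real.exp (-cumRate b x n) * H n x)) ?_
    rw [hmild n n le_rfl]
    exact le_self_add
  have hmildR : ∀ (n : ℕ) (s : ℝ), s ≤ n → Real.exp (-cumRate b x s) * H s x =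
      (ρ n x * ENNReal.ofReal (Real.exp (-cumRate b x n))).toReal + ∫ q in s..n, j q := by
    intro n s hs
    rw [intervalIntegral.integral_of_le hs,
      integral_eq_lintegral_of_nonneg_ae (Eventually.of_forall hj0) hjm.aestronglyMeasurable,
      ← ENNReal.toReal_add (hρ' n), ← hmild n s hs, ENNReal.toReal_ofReal]
    · exact mul_nonneg (Real.exp_pos _).le (hH0 _ _)
    · refine ne_top_of_le_ne_top
        (ENNReal.ofReal_ne_top (r := Real.exp (-cumRate b x s) * H s x)) ?_
      rw [hmild n s hs]
      exact le_add_self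
  have hjloc : LocallyIntegrable j volume := fun s => by
    obtain ⟨n, hn⟩ := exists_nat_gt s
    exact ⟨Set.Ioc (s - 1) n, Ioc_mem_nhds (by linarith) hn, hji n (s - 1) (by linarith)⟩
  have hG : HasWeakDeriv (fun s => Real.exp (-cumRate b x s) * H s x)
      (fun s => Real.exp (-cumRate b x s) * -J s) := by
    have hneg : ∀ q, Real.exp (-cumRate b x q) * -J q = -j q := fun q => by rw [hj]; ring
    simp only [hneg]
    refine ⟨hjloc.neg, fun s t => ?_⟩
    obtain ⟨n, hn⟩ := exists_nat_ge (max s t)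
    dsimp only
    rw [hmildR n s ((le_max_left _ _).trans hn), hmildR n t ((le_max_right _ _).trans hn),
      intervalIntegral.integral_neg, add_sub_add_left_eq_sub,
      ← intervalIntegral.integral_add_adjacent_intervals (a := s) (b := t) (c := n)
        (intervalIntegrable_of_locallyIntegrable hjloc _ _)
        (intervalIntegrable_of_locallyIntegrable hjloc _ _)]
    ring
  refine ((hb.hasWeakDeriv_cumRate x).neg.of_mild hG).congr_right fun s => ?_
  simp only [hJ]; ring

end ForwardEvolution

/-! ### Time averages -/

/-- The mean of a continuous function over shrinking intervals to the right of a point. -/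
theorem tendsto_lintegral_average {H : ℝ → ℝ} (hH : Continuous H) (hH0 : ∀ s, 0 ≤ H s) (s : ℝ) :
    Tendsto (fun k : ℕ => ENNReal.ofReal ((k : ℝ) + 1) *
      ∫⁻ u in Set.Ioc 0 (1 / ((k : ℝ) + 1)), ENNReal.ofReal (H (u + s))) atTop
      (𝓝 (ENNReal.ofReal (H s))) := by
  have hd : HasDerivAt (fun t => ∫ u in s..t, H u) (H s) s :=
    intervalIntegral.integral_hasDerivAt_right (hH.intervalIntegrable _ _)
      (hH.stronglyMeasurableAtFilter _ _) hH.continuousAt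
  rw [hasDerivAt_iff_tendsto_slope_zero] at hd
  have hk : Tendsto (fun k : ℕ => 1 / ((k : ℝ) + 1)) atTop (𝓝[≠] 0) := by
    refine tendsto_nhdsWithin_iff.2 ⟨tendsto_one_div_add_atTop_nhds_zero_nat, ?_⟩
    exact Eventually.of_forall fun k => by
      have : (0 : ℝ) < 1 / ((k : ℝ) + 1) := by positivity
      exact this.ne'
  refine (ENNReal.tendsto_ofReal (hd.comp hk)).congr fun k => ?_
  have hpos : (0 : ℝ) < 1 / ((k : ℝ) + 1) := by positivity
  have h1 := setLIntegral_Ioc_comp_add_right (fun u => ENNReal.ofReal (H u)) 0 (1 / ((k : ℝ) + 1)) s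
  rw [zero_add, add_comm _ s] at h1
  rw [h1]
  have hle : s ≤ s + 1 / ((k : ℝ) + 1) := by linarith
  rw [← ofReal_integral_eq_lintegral_ofReal
    ((intervalIntegrable_iff_integrableOn_Ioc_of_le hle).1 (hH.intervalIntegrable _ _))
    (Eventually.of_forall hH0), ← ENNReal.ofReal_mul (by positivity),
    ← intervalIntegral.integral_of_le hle]
  simp

/-! ### A version of the density that is regular along orbits. -/

namespace IsErgodicEnvironment

variable {Ω : Type*} [MeasurableSpace Ω] {P : Measure Ω} {b : Ω → ℝ → ℤ → ℝ}
  {τ : ℝ → ℤ → Ω → Ω}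

/-- The invariance of a density, read along the orbit of the environment. -/
theorem ae_eq_forwardEvolution (henv : IsErgodicEnvironment P b τ) {ψ : Ω → ℝ≥0∞}
    (h : ∀ t : ℝ, 0 < t → ∀ᵐ ω ∂P, ψ ω = ∑' x, ψ (τ t x ω) * dualKernel (b ω) t x 0 0)
    {s t : ℝ} (hst : s < t) (x : ℤ) :
    ∀ᵐ ω ∂P, ψ (τ s x ω) = forwardEvolution (b ω) t (fun y => ψ (τ t y ω)) s x := by
  filter_upwards [(henv.invariant s x).quasiMeasurePreserving.ae (h (t - s) (sub_pos.2 hst))]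
    with ω hω
  rw [hω, forwardEvolution, 
    ← (Equiv.addRight x).tsum_eq (fun y => ψ (τ t y ω) * dualKernel (b ω) t y s x)]
  congr 1; funext y
  rw [henv.shift_add, henv.dualKernel_comp_shift]
  simp

/-- The representative of a density obtained from averages over short time intervals. -/
noncomputable def _root_.DynCond.timeRegularization (τ : ℝ → ℤ → Ω → Ω) (φ : Ω → ℝ) (ω : Ω) : ℝ :=
  (limsup (fun k : ℕ => ENNReal.ofReal ((k : ℝ) + 1) *
    ∫⁻ u in Set.Ioc 0 (1 / ((k : ℝ) + 1)), ENNReal.ofReal (φ (τ u 0 ω))) atTop).toReal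

theorem _root_.DynCond.OrbitMeasurable.measurable_timeRegularization {φ : Ω → ℝ}
    (hφ : OrbitMeasurable τ φ) : Measurable (timeRegularization τ φ) := by
  refine (Measurable.limsup fun k => Measurable.const_mul ?_ _).ennreal_toReal
  exact Measurable.lintegral_prod_right' (f := fun p : Ω × ℝ => ENNReal.ofReal (φ (τ p.2 0 p.1)))
    (hφ.comp_measurable 0 measurable_snd measurable_fst).ennreal_ofReal

/-- An invariant density has a version that solves the forward equation along almost every
orbit. -/
theorem exists_regular_version (henv : IsErgodicEnvironment P b τ) [IsProbabilityMeasure P]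
    {φ : Ω → ℝ} (hφ : OrbitMeasurable τ φ) (hφ0 : ∀ ω, 0 ≤ φ ω)
    (h : ∀ t : ℝ, 0 < t → ∀ᵐ ω ∂P, ENNReal.ofReal (φ ω) =
      ∑' x, ENNReal.ofReal (φ (τ t x ω)) * dualKernel (b ω) t x 0 0) :
    ∃ φ' : Ω → ℝ, Measurable φ' ∧ φ' =ᵐ[P] φ ∧
      ∀ᵐ ω ∂P, ∀ x : ℤ, HasWeakDeriv (fun t => φ' (τ t x ω))
        (fun t => -adjointGen b τ φ' (τ t x ω)) := by
  set ψ : Ω → ℝ≥0∞ := fun ω => ENNReal.ofReal (φ ω) with hψ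
  have hst : ∀ {s t : ℝ}, s < t → ∀ x, ∀ᵐ ω ∂P, ψ (τ s x ω) =
      forwardEvolution (b ω) t (fun y => ψ (τ t y ω)) s x := fun hst x =>
    henv.ae_eq_forwardEvolution h hst x
  have hcons : ∀ᵐ ω ∂P, ∀ (n : ℕ) y, ψ (τ (n : ℝ) y ω) = forwardEvolution (b ω)
      ((n + 1 : ℕ) : ℝ) (fun y => ψ (τ ((n + 1 : ℕ) : ℝ) y ω)) n y := by
    refine ae_all_iff.2 fun n => ae_all_iff.2 fun y => hst ?_ y
    push_cast; linarith
  have hfin : ∀ᵐ ω ∂P, ∀ (n m : ℕ) x, 0 < n → ψ (τ (-(m : ℝ)) x ω) = forwardEvolution (b ω)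
      (n : ℝ) (fun y => ψ (τ (n : ℝ) y ω)) (-(m : ℝ)) x := by
    refine ae_all_iff.2 fun n => ae_all_iff.2 fun m => ae_all_iff.2 fun x => ?_
    rcases Nat.eq_zero_or_pos n with hn | hn
    · exact Eventually.of_forall fun ω h => absurd h (by omega)
    · have h1 : (0 : ℝ) < n := by exact_mod_cast hn
      filter_upwards [hst (s := -(m : ℝ)) (t := n)
        (by linarith [Nat.cast_nonneg (α := ℝ) m]) x] with ω hω _ using hω
  have hae : ∀ᵐ ω ∂P, ∀ᵐ s : ℝ, ∀ (n : ℕ) x, s < n → ψ (τ s x ω) =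
      forwardEvolution (b ω) (n : ℝ) (fun y => ψ (τ (n : ℝ) y ω)) s x := by
    -- For each `s` the exceptional set of environments may be different. Fubini, which needs
    -- measurability along orbits, exchanges this for a null set of times in almost every
    -- environment.
    have h1 : ∀ (n : ℕ) x, ∀ᵐ ω ∂P, ∀ᵐ s : ℝ, s < n → ψ (τ s x ω) =
        forwardEvolution (b ω) (n : ℝ) (fun y => ψ (τ (n : ℝ) y ω)) s x := by
      intro n x
      have hm : MeasurableSet {p : Ω × ℝ | p.2 < n → ψ (τ p.2 x p.1) =
          forwardEvolution (b p.1) (n : ℝ) (fun y => ψ (τ (n : ℝ) y p.1)) p.2 x} := by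
        have hm1 : Measurable fun p : Ω × ℝ => ψ (τ p.2 x p.1) :=
          (hφ.comp_measurable x measurable_snd measurable_fst).ennreal_ofReal
        have hm2 : Measurable fun p : Ω × ℝ =>
            forwardEvolution (b p.1) (n : ℝ) (fun y => ψ (τ (n : ℝ) y p.1)) p.2 x :=
          Measurable.tsum fun y =>
            (hφ.comp_measurable y measurable_const measurable_fst).ennreal_ofReal.mul
              (henv.isConductanceField.measurable_dualKernel y x measurable_const
                measurable_snd measurable_fst)
        have hm3 : MeasurableSet {p : Ω × ℝ | p.2 < n} :=
          measurableSet_lt measurable_snd measurable_const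
        exact hm3.imp (measurableSet_eq_fun hm1 hm2)
      rw [Measure.ae_ae_comm hm]
      refine Eventually.of_forall fun s => ?_
      by_cases hs : s < n
      · filter_upwards [hst hs x] with ω hω _ using hω
      · exact Eventually.of_forall fun ω h => absurd h hs
    have h2 : ∀ᵐ ω ∂P, ∀ (n : ℕ) x, ∀ᵐ s : ℝ, s < n → ψ (τ s x ω) =
        forwardEvolution (b ω) (n : ℝ) (fun y => ψ (τ (n : ℝ) y ω)) s x :=
      ae_all_iff.2 fun n => ae_all_iff.2 fun x => h1 n x
    filter_upwards [h2] with ω hω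
    exact ae_all_iff.2 fun n => ae_all_iff.2 fun x => hω n x
  have key : ∀ᵐ ω ∂P, ∃ H : ℝ → ℤ → ℝ, (∀ s x, timeRegularization τ φ (τ s x ω) = H s x) ∧
      φ ω = H 0 0 ∧ ∀ x, HasWeakDeriv (fun s => H s x) (fun s =>
        -(b ω s (x + 1) * H s (x + 1) + b ω s (x - 1) * H s (x - 1) - 2 * b ω s x * H s x)) := by
    filter_upwards [hcons, hfin, hae] with ω h1 h2 h3
    have hb := henv.isConductance ω
    have hfin' : ∀ (n m : ℕ) x, forwardEvolution (b ω) n (fun y => ψ (τ (n : ℝ) y ω))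
        (-(m : ℝ)) x < ∞ := by
      intro n m x
      -- Starting one step later gives `-m < n + 1` even when `n = m = 0`; consistency then brings
      -- the finiteness back to the starting time `n`.
      have h4 := h2 (n + 1) m x (Nat.succ_pos n)
      have h5 : (fun y => ψ (τ (n : ℝ) y ω)) = forwardEvolution (b ω) ((n + 1 : ℕ) : ℝ)
          (fun y => ψ (τ ((n + 1 : ℕ) : ℝ) y ω)) n := funext fun y => h1 n y
      have hm0 : (0 : ℝ) ≤ m := Nat.cast_nonneg m
      have hn0 : (0 : ℝ) ≤ n := Nat.cast_nonneg n
      have h6 : (n : ℝ) ≤ ((n + 1 : ℕ) : ℝ) := by push_cast; linarith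
      rw [h5, forwardEvolution_forwardEvolution hb (by linarith) h6, ← h4]
      exact ENNReal.ofReal_lt_top
    obtain ⟨H, hH0, hHof, hHd⟩ := exists_forward_solution hb
      (ρ := fun n y => ψ (τ (n : ℝ) y ω)) h1 hfin'
    refine ⟨H, fun s x => ?_, ?_, hHd⟩
    -- Altering `φ` on a null set of times does not affect the averages, and `H` is continuous. So
    -- the regularization equals `H` at every time of the orbit, not merely at almost every time.
    · have hlim := tendsto_lintegral_average (hHd x).continuous (fun s => hH0 s x) s
      have heq : ∀ k : ℕ, ∫⁻ u in Set.Ioc 0 (1 / ((k : ℝ) + 1)),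
          ENNReal.ofReal (φ (τ u 0 (τ s x ω))) =
          ∫⁻ u in Set.Ioc 0 (1 / ((k : ℝ) + 1)), ENNReal.ofReal (H (u + s) x) := by
        intro k
        refine lintegral_congr_ae (ae_restrict_of_ae ?_)
        have h4 : ∀ᵐ u : ℝ, ψ (τ u x ω) = ENNReal.ofReal (H u x) := by
          filter_upwards [h3] with u hu
          obtain ⟨n, hn⟩ := exists_nat_gt u
          rw [hu n x hn, hHof n u hn.le]
        have h5 := (measurePreserving_add_right (volume : Measure ℝ) s).quasiMeasurePreserving.ae h4
        filter_upwards [h5] with u hu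
        rw [henv.shift_add, zero_add]
        exact hu
      have hlim' := hlim.limsup_eq
      rw [timeRegularization]
      simp only [heq]
      rw [hlim', ENNReal.toReal_ofReal (hH0 s x)]
    · have h4 := h2 1 0 0 one_pos
      have h5 := hHof 1 0 (by norm_num) 0
      simp only [Nat.cast_zero, neg_zero, henv.shift_zero] at h4
      rw [← h4] at h5
      exact ((ENNReal.ofReal_eq_ofReal_iff (hH0 0 0) (hφ0 ω)).1 h5).symm
  refine ⟨timeRegularization τ φ, hφ.measurable_timeRegularization, ?_, ?_⟩
  · filter_upwards [key] with ω ⟨H, h1, h2, _⟩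
    rw [h2, ← h1, henv.shift_zero]
  · filter_upwards [key] with ω ⟨H, h1, _, h3⟩
    intro x
    have h4 : (fun t => timeRegularization τ φ (τ t x ω)) = fun t => H t x := funext fun t => h1 t x
    rw [h4]
    refine (h3 x).congr_right fun t => ?_
    simp only [adjointGen, henv.shift_add, henv.covariant, h1, zero_add]
    rw [add_comm 1 x, neg_add_eq_sub]

end IsErgodicEnvironment

end DynCond

namespace DynCond

/-! ### Stationarity of the measure with an invariant density. -/

namespace IsErgodicEnvironment

variable {Ω : Type*} [MeasurableSpace Ω] {P : Measure Ω} {b : Ω → ℝ → ℤ → ℝ}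
  {τ : ℝ → ℤ → Ω → Ω}

/-- An invariant probability density is stationary for the environment seen from the dual walk. -/
theorem isStationaryForDual (henv : IsErgodicEnvironment P b τ) {ψ : Ω → ℝ≥0∞}
    (hψ : Measurable ψ) (hψ1 : ∫⁻ ω, ψ ω ∂P = 1)
    (hinv : ∀ t : ℝ, 0 ≤ t → ∀ A : Set Ω, MeasurableSet A →
      ∫⁻ ω, ψ ω * dualSemigroup b τ t (A.indicator 1) ω ∂P = ∫⁻ ω, ψ ω * A.indicator 1 ω ∂P) :
    IsStationaryForDual b τ (P.withDensity ψ) := by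
  refine ⟨⟨by rw [withDensity_apply _ MeasurableSet.univ, setLIntegral_univ, hψ1]⟩,
    fun t ht A hA => ?_⟩
  have hA1 : Measurable (A.indicator (1 : Ω → ℝ≥0∞)) := measurable_one.indicator hA
  calc ∫⁻ ω, envTransition b τ t ω A ∂(P.withDensity ψ)
      = ∫⁻ ω, ψ ω * dualSemigroup b τ t (A.indicator 1) ω ∂P :=
        lintegral_withDensity_eq_lintegral_mul P hψ (henv.measurable_dualSemigroup t hA1)
    _ = ∫⁻ ω, ψ ω * A.indicator 1 ω ∂P := hinv t ht A hA
    _ = ∫⁻ ω, A.indicator 1 ω ∂(P.withDensity ψ) :=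
        (lintegral_withDensity_eq_lintegral_mul P hψ hA1).symm
    _ = P.withDensity ψ A := lintegral_indicator_one hA

end IsErgodicEnvironment

end DynCond

/-! ### Assembly of the theorem. -/

theorem mainTheorem4 {Ω : Type*} [MeasurableSpace Ω] (P : Measure Ω) [IsProbabilityMeasure P]
    (b : Ω → ℝ → ℤ → ℝ) (τ : ℝ → ℤ → Ω → Ω)
    (henv : DynCond.IsErgodicEnvironment P b τ)
    (hmom : Integrable (fun ω => b ω 0 0) P)
    (hmom_inv : Integrable (fun ω => (b ω 0 0)⁻¹) P) :
    ∃ Φ : ℝ → StrongDual ℝ (DynCond.WeightedL2 P b),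
      -- extension of the functionals, with the uniform norm bound
      (∀ ε : ℝ, 0 < ε →
        ∫⁻ ω, DynCond.approxDensity b ε ω ∂P = 1 ∧
        (∀ f : Ω → ℝ, MemLp f ∞ P →
          Integrable (fun ω => (DynCond.approxDensity b ε ω).toReal * f ω) P ∧
          ∃ hf : MemLp f 2 (DynCond.weightedMeasure P b),
            Φ ε (hf.toLp f) = ∫ ω, (DynCond.approxDensity b ε ω).toReal * f ω ∂P) ∧
        ‖Φ ε‖ ≤ √(∫ ω, b ω 0 0 ∂P)) ∧
      -- existence of weak sequential limits
      (∀ ε : ℕ → ℝ, (∀ k, 0 < ε k) → Tendsto ε atTop (𝓝 0) →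
        ∃ (σ : ℕ → ℕ) (ℓ : StrongDual ℝ (DynCond.WeightedL2 P b)), StrictMono σ ∧
          ∀ f : DynCond.WeightedL2 P b, Tendsto (fun k => Φ (ε (σ k)) f) atTop (𝓝 (ℓ f))) ∧
      -- form and properties of every weak sequential limit
      (∀ ε : ℕ → ℝ, (∀ k, 0 < ε k) → Tendsto ε atTop (𝓝 0) →
        ∀ ℓ : StrongDual ℝ (DynCond.WeightedL2 P b),
        (∀ f : DynCond.WeightedL2 P b, Tendsto (fun k => Φ (ε k) f) atTop (𝓝 (ℓ f))) →
        ∃ φ : Ω → ℝ, Measurable φ ∧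
          (∀ f : DynCond.WeightedL2 P b,
            Integrable (fun ω => φ ω * f ω) P ∧ ℓ f = ∫ ω, φ ω * f ω ∂P) ∧
          (∀ᵐ ω ∂P, 0 ≤ φ ω) ∧
          (Integrable φ P ∧ ∫ ω, φ ω ∂P = 1) ∧
          (Integrable (fun ω => b ω 0 0 * φ ω ^ 2) P ∧
            ∫ ω, b ω 0 0 * φ ω ^ 2 ∂P ≤ ∫ ω, b ω 0 0 ∂P) ∧
          (∀ t : ℝ, 0 < t → ∀ᵐ ω ∂P, ENNReal.ofReal (φ ω) =
            ∑' x : ℤ, ENNReal.ofReal (φ (τ t x ω)) * DynCond.dualKernel (b ω) t x 0 0) ∧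
          (∀ᵐ ω ∂P, 0 < φ ω) ∧
          (∀ᵐ ω ∂P, ∀ x : ℤ, Continuous (fun t => φ (τ t x ω)) ∧
            DynCond.HasWeakDeriv (fun t => φ (τ t x ω))
              (fun t => -DynCond.adjointGen b τ φ (τ t x ω))) ∧
          DynCond.IsStationaryForDual b τ (P.withDensity (fun ω => ENNReal.ofReal (φ ω))) ∧
          DynCond.IsErgodicForDual b τ (P.withDensity (fun ω => ENNReal.ofReal (φ ω)))) := by
  refine ⟨fun ε => innerSL ℝ (DynCond.approxVector P b ε),
    fun ε hε => ⟨henv.lintegral_approxDensity hε, fun f hf => ?_, ?_⟩,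
    fun ε hε _ => ?_, fun ε hε hε0 ℓ hℓ => ?_⟩
  · have h := henv.inner_approxVector_toLp hmom hmom_inv hε
      (DynCond.IsErgodicEnvironment.memLp_of_memLp_top hmom_inv hf)
    exact ⟨h.1, DynCond.IsErgodicEnvironment.memLp_of_memLp_top hmom_inv hf, h.2⟩
  · rw [innerSL_apply_norm]
    exact henv.norm_approxVector_le hmom hmom_inv hε
  · exact DynCond.exists_subseq_tendsto_inner (fun k => DynCond.approxVector P b (ε k)) fun k =>
      henv.norm_approxVector_le hmom hmom_inv (hε k)
  obtain ⟨φ₀, hφo, hφ0, hφsq, hφL, hφℓ⟩ := henv.exists_density hmom hmom_inv hε hℓ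
  have hφ₀m : Measurable fun ω => ENNReal.ofReal (φ₀ ω) := (hφo.measurable henv).ennreal_ofReal
  have h1 := henv.lintegral_density hmom hmom_inv hε hℓ hφ0 hφL hφℓ
  have hinv : ∀ t : ℝ, 0 ≤ t → ∀ A : Set Ω, MeasurableSet A →
      ∫⁻ ω, ENNReal.ofReal (φ₀ ω) * DynCond.dualSemigroup b τ t (A.indicator 1) ω ∂P =
        ∫⁻ ω, ENNReal.ofReal (φ₀ ω) * A.indicator 1 ω ∂P := fun t ht A hA =>
    henv.lintegral_density_mul_dualSemigroup hmom hmom_inv hε hε0 hℓ hφ0 hφL hφℓ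
      (measurable_one.indicator hA) (fun ω => Set.indicator_le_self' (by simp) ω) ht
  have hfix : ∀ t : ℝ, 0 < t → ∀ᵐ ω ∂P, ENNReal.ofReal (φ₀ ω) =
      ∑' x, ENNReal.ofReal (φ₀ (τ t x ω)) * DynCond.dualKernel (b ω) t x 0 0 := fun t ht =>
    henv.density_eq_tsum hφ₀m (hinv t ht.le)
  have hpos : ∀ᵐ ω ∂P, 0 < φ₀ ω := by
    filter_upwards [henv.density_pos hφ₀m (by rw [h1]; exact one_ne_zero) hfix] with ω hω
    exact ENNReal.ofReal_pos.1 hω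
  -- The limit density `φ₀` is measurable along orbits and carries the invariance; its regular
  -- version `φ` inherits the other properties by almost sure equality.
  obtain ⟨φ, hφm, hφφ₀, hφd⟩ := henv.exists_regular_version hφo hφ0 hfix
  have hφφ₀' : (fun ω => ENNReal.ofReal (φ ω)) =ᵐ[P] fun ω => ENNReal.ofReal (φ₀ ω) := by
    filter_upwards [hφφ₀] with ω hω
    rw [hω]
  have hpos' : ∀ᵐ ω ∂P, 0 < φ ω := by
    filter_upwards [hφφ₀, hpos] with ω hω h
    rwa [hω]
  have h1' : ∫⁻ ω, ENNReal.ofReal (φ ω) ∂P = 1 := by rw [lintegral_congr_ae hφφ₀', h1]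
  have hsq : (fun ω => b ω 0 0 * φ ω ^ 2) =ᵐ[P] fun ω => b ω 0 0 * φ₀ ω ^ 2 := by
    filter_upwards [hφφ₀] with ω hω
    rw [hω]
  have hstat : DynCond.IsStationaryForDual b τ (P.withDensity fun ω => ENNReal.ofReal (φ ω)) := by
    rw [withDensity_congr_ae hφφ₀']
    exact henv.isStationaryForDual hφ₀m h1 hinv
  have hQ := hstat.1
  refine ⟨φ, hφm, fun f => ?_, hpos'.mono fun ω h => h.le, ⟨?_, ?_⟩, ⟨?_, ?_⟩, fun t ht => ?_,
    hpos', ?_, hstat, ?_⟩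
  · have h2 := henv.inner_toLp_mul hφL f
    have h3 : (fun ω => φ ω * f ω) =ᵐ[P] fun ω => φ₀ ω * f ω := by
      filter_upwards [hφφ₀] with ω hω
      rw [hω]
    rw [integrable_congr h3, integral_congr_ae h3, hφℓ]
    exact h2
  · refine ⟨hφm.aestronglyMeasurable, ?_⟩
    rw [hasFiniteIntegral_iff_ofReal (hpos'.mono fun ω h => h.le), h1']
    exact ENNReal.one_lt_top
  · rw [integral_eq_lintegral_of_nonneg_ae (hpos'.mono fun ω h => h.le) hφm.aestronglyMeasurable,
      h1', ENNReal.toReal_one]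
  · exact (integrable_congr hsq).2 hφsq.1
  · rw [integral_congr_ae hsq]
    exact hφsq.2
  -- Each shift preserves `P` and there are countably many sites, so both versions agree
  -- simultaneously at all points of the sum.
  · have h2 : ∀ᵐ ω ∂P, ∀ x, φ (τ t x ω) = φ₀ (τ t x ω) := ae_all_iff.2 fun x =>
      (henv.invariant t x).quasiMeasurePreserving.ae hφφ₀
    filter_upwards [hφφ₀, h2, hfix t ht] with ω hω hω2 hω3
    simp only [hω, hω2]
    exact hω3
  · filter_upwards [hφd] with ω hω x
    exact ⟨(hω x).continuous, hω x⟩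
  · exact henv.isErgodicForDual (withDensity_absolutelyContinuous _ _)
      (withDensity_absolutelyContinuous' hφm.ennreal_ofReal.aemeasurable
        (hpos'.mono fun ω h => (ENNReal.ofReal_pos.2 h).ne'))
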